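/- **Setting.** Let $\mathbb R^{2,4}$ be $\mathbb R^6$ with coordinates $(y_0,\dots,y_5)$, standard basis $E_0,\dots,E_5$ and scalar product $$\langle y,y'\rangle=-(y_0y_5'+y_5y_0')-y_1y_1'+y_2y_2'+y_3y_3'+y_4y_4',$$ and let $\mathcal E^{1,3}\subset\mathbb R^{2,4}$ be the Einstein universe, given by $\tfrac12(y_0+y_5)^2+y_1^2=1$ and $y_2^2+y_3^2+y_4^2+\tfrac12(y_0-y_5)^2=1$; it contains exactly one vector of each isotropic ray. Let $I\subset\mathbb R$ be an open interval and $\gamma:I\to\mathcal E^{1,3}$ a smooth time-like curve, i.e. $\langle\gamma',\gamma'\rangle<0$. A null lift of $\gamma$ is a smooth positive multiple $\Gamma=r\gamma$. Let $\mathrm{pr}_{(k)}$ be the orthogonal projection onto the orthogonal complement of the $k$-th osculating space $\mathrm{span}(\Gamma,\Gamma',\dots,\Gamma^{(k)})$. The strain density of $\gamma$ is $$\upsilon_\gamma=\left(\frac{\langle \mathrm{pr}_{(2)}\Gamma''',\mathrm{pr}_{(2)}\Gamma'''\rangle}{|\langle\Gamma',\Gamma'\rangle|}\right)^{1/4},$$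 which does not depend on the null lift, and $\gamma$ is generic if $\upsilon_\gamma$ vanishes nowhere. A *conformal world-line* is a generic time-like curve $\gamma$ such that, for all $[a,b]\subset I$ and every smooth variation $\gamma_\tau$ of $\gamma$ in $\mathcal E^{1,3}$ with support in $[a,b]$, $\frac{d}{d\tau}\big|_{\tau=0}\int_a^b\upsilon_{\gamma_\tau}\,dt=0$. It is *linearly full* if it is contained in no $5$-dimensional subspace of $\mathbb R^{2,4}$ on which the scalar product is non-degenerate of signature $(2,3)$ (two negative, three positive directions). It is parameterized by the *conformal parameter* $u$ if $\upsilon_\gamma\equiv1$. Let $\gamma$ be a linearly full conformal world-line parameterized by the conformal parameter, and let a dot denote $d/du$. Let $\Gamma$ be its canonical null lift, the one with $|\langle\dot\Gamma,\dot\Gamma\rangle|=1$. Put $B_0=\Gamma$, $B_1=\dot\Gamma$, $B_2=-\mathrm{pr}_{(2)}\dddot\Gamma$ (a unit vector), and let $B_5$ be the isotropic vector of the second osculating space with $\langle B_0,B_5\rangle=-1$, $\langle B_1,B_5\rangle=0$. Put $S=\mathrm{pr}_{(3)}\dot B_2$ and $B_3=S/\sqrt{\langle S,S\rangle}$, and let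 $B_4$ be the unit vector orthogonal to the fourth osculating space such that $\det(B_0,\dots,B_5)>0$. The conformal curvatures of $\gamma$ are $$k_1=\langle\dot B_1,B_5\rangle,\qquad k_2=\sqrt{\langle S,S\rangle},\qquad k_3=\langle\dot B_3,B_4\rangle .$$ Assume that $\gamma$ has its intrinsic orientation, that is, the isotropic bi-vector $B_0\wedge(B_1+B_2)$ is positive: $\det(B_0,\,B_1+B_2,\,E_2,\,E_3,\,E_4,\,E_5-E_0)>0$. Assume also that $k_3>0$ (positive helicity), and that $k_1,k_2,k_3$ are not all constant. **Proposition 4.2.** There are constants $c_1,c_2,c_3$ with $c_3\ne0$ (the characters of $\gamma$) such that on $I$ $$k_1=\tfrac32k_2^2+c_1,\qquad k_3=c_3k_2^{-2},\qquad \dot k_2^2+k_2^4+c_3^2k_2^{-2}+2c_1k_2^2+c_2=0,$$ and the cubic $Q_1(t)=t^3+2c_1t^2+c_2t+c_3^2$ has three distinct real roots $e_1<e_2<e_3$ (the phase parameters of $\gamma$). The phase parameters satisfy $e_1<0<e_2<e_3$. Put $$\ell_3=e_3-e_1,\quad \ell_4=e_3-e_2,\quad \ell_1=e_2\ell_3,\quad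 \ell_2=e_1\ell_4,\quad m=\ell_4/\ell_3,$$ and let $\mathrm{sn}(\cdot,m)$ be Jacobi's function with parameter $m$ (the square of the modulus), i.e. $\mathrm{sn}(x,m)=\sin\varphi$ where $x=\int_0^\varphi(1-m\sin^2\theta)^{-1/2}d\theta$. Then there is a constant $u_0\in\mathbb R$ such that for all $u\in I$ $$k_2(u)=\sqrt{\frac{\ell_1-\ell_2\,\mathrm{sn}^2(\sqrt{\ell_3}\,u+u_0,m)}{\ell_3-\ell_4\,\mathrm{sn}^2(\sqrt{\ell_3}\,u+u_0,m)}},$$ $$k_1(u)=\tfrac32k_2(u)^2-\tfrac12(e_1+e_2+e_3),\qquad k_3(u)=\sqrt{-e_1e_2e_3}\;k_2(u)^{-2}.$$ -/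

import Mathlib

open scoped ContDiff

noncomputable section

namespace ConformalStrain

/-- The space `ℝ^{2,4}`: vectors are given by their coordinates `(y₀,…,y₅)` in the standard
light-cone basis `E₀,…,E₅`. -/
abbrev Vec : Type := Fin 6 → ℝ

/-- The scalar product of signature `(2,4)` in light-cone coordinates. -/
def sp (v w : Vec) : ℝ :=
  -(v 0 * w 5 + v 5 * w 0) - v 1 * w 1 + v 2 * w 2 + v 3 * w 3 + v 4 * w 4

/-- The Einstein universe `ℰ^{1,3} = S¹ × S³`, cut out by `x₀² + x₁² = 1` and
`x₂² + x₃² + x₄² + x₅² = 1`, where `x₀ = (y₀ + y₅)/√2`, `x₅ = (y₀ - y₅)/√2` and `xᵢ = yᵢ`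
for `i = 1,…,4`. It contains exactly one vector of each isotropic ray. -/
def einsteinUniverse : Set Vec :=
  {y | (y 0 + y 5) ^ 2 / 2 + y 1 ^ 2 = 1 ∧
    y 2 ^ 2 + y 3 ^ 2 + y 4 ^ 2 + (y 0 - y 5) ^ 2 / 2 = 1}

/-- `W` is a `(2+h)`-dimensional subspace on which the scalar product is non-degenerate of
signature `(2,h)`; the isotropic rays in `W` form an `h`-dimensional Lorentzian cycle. -/
def IsLorentzianSubspace (h : ℕ) (W : Submodule ℝ Vec) : Prop :=
  ∃ w : Fin (2 + h) → Vec,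
    (∀ i j, sp (w i) (w j) = if i = j then (if i.val < 2 then -1 else 1) else 0) ∧
    Submodule.span ℝ (Set.range w) = W

/-- The isotropic bi-vector `V ∧ W` belongs to the positive half cone `𝒞₊`:
`V, W` span an isotropic plane and `dV(V, W, E₂, E₃, E₄, E₅ - E₀) > 0`. -/
def InPositiveCone (V W : Vec) : Prop :=
  sp V V = 0 ∧ sp W W = 0 ∧ sp V W = 0 ∧
  0 < Matrix.det (Matrix.of ![V, W, Pi.single 2 1, Pi.single 3 1, Pi.single 4 1,
    Pi.single 5 1 - Pi.single 0 1])

/-! ### Time-like curves and conformal strain -/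

/-- The `k`-th osculating space at `t` of a curve of vectors. -/
def osculatingSpace (k : ℕ) (Γ : ℝ → Vec) (t : ℝ) : Submodule ℝ Vec :=
  Submodule.span ℝ {v | ∃ j ≤ k, v = iteratedDeriv j Γ t}

/-- The orthogonal projection `pr_(k)` at `t` of a vector `v` onto the `k`-th normal space, the
orthogonal complement of the `k`-th osculating space: the vector `w` of the normal space such that
`v - w` is in the osculating space (it is unique if the osculating space is non-degenerate). -/
def pr (k : ℕ) (Γ : ℝ → Vec) (t : ℝ) (v : Vec) : Vec :=
  Classical.epsilon fun w : Vec =>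
    (∀ x ∈ osculatingSpace k Γ t, sp x w = 0) ∧ v - w ∈ osculatingSpace k Γ t

/-- `γ : I → ℰ^{1,3}` is a smooth time-like curve. -/
structure IsTimelikeCurve (I : Set ℝ) (γ : ℝ → Vec) : Prop where
  smooth : ContDiffOn ℝ ∞ γ I
  mem_universe : ∀ t ∈ I, γ t ∈ einsteinUniverse
  timelike : ∀ t ∈ I, sp (deriv γ t) (deriv γ t) < 0

/-- The coefficient of `dt⁴` in the conformal strain. It does not depend on the choice of a null
lift of the curve, so it may be computed with the lift `γ` itself. -/
def strain (γ : ℝ → Vec) (t : ℝ) : ℝ :=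
  sp (pr 2 γ t (iteratedDeriv 3 γ t)) (pr 2 γ t (iteratedDeriv 3 γ t)) /
    |sp (deriv γ t) (deriv γ t)|

/-- No conformal vertices. -/
def IsGeneric (I : Set ℝ) (γ : ℝ → Vec) : Prop := ∀ t ∈ I, strain γ t ≠ 0

/-- The conformal strain density `υ`, the positive fourth root of the strain; the conformal arc
element is `υ dt`. -/
def strainDensity (γ : ℝ → Vec) (t : ℝ) : ℝ := strain γ t ^ (1 / 4 : ℝ)

/-- The canonical null lift: the positive multiple `Γ = r γ` such that the strain is
`⟨Γ'', Γ⟩² dt⁴`, equivalently `|⟨Γ', Γ'⟩| = r² |⟨γ', γ'⟩| = υ²`. -/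
def canonicalLift (γ : ℝ → Vec) (t : ℝ) : Vec :=
  (strainDensity γ t / √|sp (deriv γ t) (deriv γ t)|) • γ t

/-- `g t τ`, for `t ∈ I` and `τ ∈ (-ε, ε)`, is a smooth variation of `γ` through curves of the
Einstein universe, with support in the closed interval `[a, b]`. -/
structure IsVariation (I : Set ℝ) (γ : ℝ → Vec) (a b ε : ℝ) (g : ℝ → ℝ → Vec) : Prop where
  smooth : ContDiffOn ℝ ∞ (fun p : ℝ × ℝ => g p.1 p.2) (I ×ˢ Set.Ioo (-ε) ε)
  mem_universe : ∀ t ∈ I, ∀ τ ∈ Set.Ioo (-ε) ε, g t τ ∈ einsteinUniverse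
  at_zero : ∀ t ∈ I, g t 0 = γ t
  support : closure {t | t ∈ I ∧ ∃ τ ∈ Set.Ioo (-ε) ε, g t τ ≠ γ t} ⊆ Set.Icc a b

/-- The total strain functional over `[a, b]`. -/
def totalStrain (a b : ℝ) (γ : ℝ → Vec) : ℝ := ∫ t in a..b, strainDensity γ t

/-- A conformal world-line: a generic time-like curve which is stationary for the total strain
under all variations supported in a closed interval `[a, b] ⊆ I`. -/
structure IsConformalWorldLine (I : Set ℝ) (γ : ℝ → Vec) : Prop where
  timelike : IsTimelikeCurve I γ
  generic : IsGeneric I γ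
  stationary : ∀ a b : ℝ, a ≤ b → Set.Icc a b ⊆ I → ∀ ε > 0, ∀ g : ℝ → ℝ → Vec,
    IsVariation I γ a b ε g →
      HasDerivAt (fun τ => totalStrain a b (fun t => g t τ)) 0 0

/-- The trajectory is contained in no `3`-dimensional Lorentzian cycle of `ℰ^{1,3}`. -/
def IsLinearlyFull (I : Set ℝ) (γ : ℝ → Vec) : Prop :=
  ¬ ∃ W : Submodule ℝ Vec, IsLorentzianSubspace 3 W ∧ ∀ t ∈ I, γ t ∈ W

/-- `γ` is parameterized by the conformal parameter. -/
def IsConformalParameter (I : Set ℝ) (γ : ℝ → Vec) : Prop := ∀ u ∈ I, strainDensity γ u = 1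

/-! ### The canonical frame and the conformal curvatures

From here on `γ` is meant to be parameterized by the conformal parameter, so that the derivative
with respect to the conformal arc element is `d/du`. -/

/-- `B₀`, the canonical null lift `Γ`. -/
def frame0 (γ : ℝ → Vec) : ℝ → Vec := canonicalLift γ

/-- `B₁ = Γ' / |⟨Γ', Γ'⟩|^{1/2}`. -/
def frame1 (γ : ℝ → Vec) (u : ℝ) : Vec :=
  (√|sp (deriv (canonicalLift γ) u) (deriv (canonicalLift γ) u)|)⁻¹ • deriv (canonicalLift γ) u

/-- `B₂`, the unit vector along the projection of `Γ'''` to the second normal space, with the sign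
for which `B₅' = k₁ B₁ + B₂` and `B₂' = B₀ + k₂ B₃`. -/
def frame2 (γ : ℝ → Vec) (u : ℝ) : Vec :=
  let P := pr 2 (canonicalLift γ) u (iteratedDeriv 3 (canonicalLift γ) u)
  (-(√(sp P P))⁻¹) • P

/-- `B₅`, the isotropic vector of the second osculating space with `⟨B₀, B₅⟩ = -1` and
`⟨B₁, B₅⟩ = 0`. -/
def frame5 (γ : ℝ → Vec) (u : ℝ) : Vec :=
  let G0 := canonicalLift γ u
  let G1 := deriv (canonicalLift γ) u
  let G2 := iteratedDeriv 2 (canonicalLift γ) u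
  (-(1 / sp G0 G2)) • G2 + (sp G1 G2 / sp G0 G2) • G1 +
    (1 / 2 * (sp G2 G2 / sp G0 G2 ^ 2 - sp G2 G1 ^ 2 / sp G0 G2 ^ 2)) • G0

/-- `γ` is equipped with its intrinsic orientation. -/
def IsIntrinsicallyOriented (I : Set ℝ) (γ : ℝ → Vec) : Prop :=
  ∀ u ∈ I, InPositiveCone (frame0 γ u) (frame1 γ u + frame2 γ u)

/-- The canonical section `S = pr_(3)(B₂')` of the third normal bundle. -/
def sectionS (γ : ℝ → Vec) (u : ℝ) : Vec := pr 3 (canonicalLift γ) u (deriv (frame2 γ) u)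

/-- `B₃ = S / ⟨S, S⟩^{1/2}`. -/
def frame3 (γ : ℝ → Vec) (u : ℝ) : Vec :=
  (√(sp (sectionS γ u) (sectionS γ u)))⁻¹ • sectionS γ u

/-- `B₄`, the unique unit vector of the fourth normal space for which `(B₀,…,B₅)` is positively
oriented. -/
def frame4 (γ : ℝ → Vec) (u : ℝ) : Vec :=
  Classical.epsilon fun w : Vec =>
    (∀ x ∈ osculatingSpace 4 (canonicalLift γ) u, sp x w = 0) ∧ sp w w = 1 ∧
    0 < Matrix.det
      (Matrix.of ![frame0 γ u, frame1 γ u, frame2 γ u, frame3 γ u, w, frame5 γ u])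

/-- The first conformal curvature `k₁ = ⟨B₁', B₅⟩`. -/
def curvature1 (γ : ℝ → Vec) (u : ℝ) : ℝ := sp (deriv (frame1 γ) u) (frame5 γ u)

/-- The second conformal curvature `k₂ = ⟨S, S⟩^{1/2}`. -/
def curvature2 (γ : ℝ → Vec) (u : ℝ) : ℝ := √(sp (sectionS γ u) (sectionS γ u))

/-- The third conformal curvature, the component of `B₃'` along `B₄`. -/
def curvature3 (γ : ℝ → Vec) (u : ℝ) : ℝ := sp (deriv (frame3 γ) u) (frame4 γ u)

/-- All three conformal curvatures are constant. -/
def HasConstantCurvatures (I : Set ℝ) (γ : ℝ → Vec) : Prop :=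
  ∃ a₁ a₂ a₃ : ℝ, ∀ u ∈ I, curvature1 γ u = a₁ ∧ curvature2 γ u = a₂ ∧ curvature3 γ u = a₃

/-- The constants `c₁, c₂, c₃` are the characters of `γ`. -/
def AreCharacters (I : Set ℝ) (γ : ℝ → Vec) (c₁ c₂ c₃ : ℝ) : Prop :=
  c₃ ≠ 0 ∧ ∀ u ∈ I,
    curvature1 γ u = 3 / 2 * curvature2 γ u ^ 2 + c₁ ∧
    curvature3 γ u = c₃ * curvature2 γ u ^ (-2 : ℤ) ∧
    deriv (curvature2 γ) u ^ 2 + curvature2 γ u ^ 4 + c₃ ^ 2 * curvature2 γ u ^ (-2 : ℤ) +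
      2 * c₁ * curvature2 γ u ^ 2 + c₂ = 0

open Polynomial in
/-- The cubic polynomial `Q₁(t) = t³ + 2 c₁ t² + c₂ t + c₃²`. -/
def characterCubic (c₁ c₂ c₃ : ℝ) : ℝ[X] := X ^ 3 + C (2 * c₁) * X ^ 2 + C c₂ * X + C (c₃ ^ 2)

/-- `e₁ < e₂ < e₃` are the roots of the cubic `Q₁` built from the characters of `γ`. -/
def ArePhaseParameters (I : Set ℝ) (γ : ℝ → Vec) (e₁ e₂ e₃ : ℝ) : Prop :=
  e₁ < e₂ ∧ e₂ < e₃ ∧ ∃ c₁ c₂ c₃ : ℝ, AreCharacters I γ c₁ c₂ c₃ ∧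
    (characterCubic c₁ c₂ c₃).roots = {e₁, e₂, e₃}

/-! ### Jacobi's elliptic sine -/

/-- The incomplete elliptic integral of the first kind with parameter `m` (the square of the
modulus). -/
def ellipticF (m φ : ℝ) : ℝ := ∫ θ in (0 : ℝ)..φ, (√(1 - m * Real.sin θ ^ 2))⁻¹

/-- Jacobi's amplitude, the inverse of `φ ↦ F(φ, m)`, which is a bijection of `ℝ` if `m < 1`. -/
def jacobiAm (x m : ℝ) : ℝ := Function.invFun (ellipticF m) x

/-- Jacobi's function `sn(x, m)` with parameter `m < 1`. -/
def jacobiSn (x m : ℝ) : ℝ := Real.sin (jacobiAm x m)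

end ConformalStrain

end

namespace ConformalStrain

/-! ### The scalar product -/

/-! The strain does not depend on the null lift (`strain_eq_of_lift`), so everything is computed
with the canonical lift Γ, for which ⟨Γ', Γ'⟩ = -1 and the part of Γ''' normal to the second
osculating space is a unit vector. Signature (2,4) makes the orthogonal complement of a negative
plane positive definite, which supplies the needed positivity and the vector B₄. Differentiating the
orthogonality relations gives the structure equations (`isConformalFrame`) B₀' = B₁, B₁' = -k₁B₀ -
B₅, B₂' = B₀ + k₂B₃, B₃' = -k₂B₂ + k₃B₄, B₄' = -k₃B₃, B₅' = k₁B₁ + B₂.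

Let w be a field orthogonal to B₀ and B₅, and f a bump function. Then Γ + τ f w, corrected at second
order along B₅, stays on the null cone, and its normalization is an admissible variation.
Stationarity and three integrations by parts show that B₂''' + 2k₁B₂' + k₁'B₂ - Γ'' is orthogonal to
w (`sp_eulerLagrange_eq_zero`). The choices w = B₂, B₃, B₄ give (`curvature_eulerLagrange`) k₁' =
3k₂k₂', k₂'' = k₂³ + k₂k₃² - 2k₁k₂, 2k₂'k₃ + k₂k₃' = 0.

The first and third equations integrate to k₁ = 3k₂²/2 + c₁ and k₂²k₃ = c₃; the second becomes a
Newton equation for k₂, whose energy is the third character. For h = k₂² the energy law reads h'² =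
-4Q₁(h). If Q₁ were nonnegative on the positive half line, h would be constant, and with it all the
curvatures. So Q₁ is negative at some positive point, while Q₁(0) = c₃² > 0, and the intermediate
value theorem yields three real roots with e₁ < 0 < e₂ < e₃.

A Möbius function of sn² takes its values in [e₂, e₃] and solves the same equation; its phase can be
fitted to the data of h and h' at one point. The two solutions agree because their difference solves
a linear second order equation (`exists_jacobiSn_of_cubic_ode`). The first order law alone would not
suffice, since uniqueness fails at its turning points. -/

theorem sp_comm (v w : Vec) : sp v w = sp w v := by simp only [sp]; ring

theorem sp_add_left (u v w : Vec) : sp (u + v) w = sp u w + sp v w := by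
  simp only [sp, Pi.add_apply]; ring

theorem sp_add_right (u v w : Vec) : sp u (v + w) = sp u v + sp u w := by
  simp only [sp, Pi.add_apply]; ring

theorem sp_sub_left (u v w : Vec) : sp (u - v) w = sp u w - sp v w := by
  simp only [sp, Pi.sub_apply]; ring

theorem sp_sub_right (u v w : Vec) : sp u (v - w) = sp u v - sp u w := by
  simp only [sp, Pi.sub_apply]; ring

theorem sp_smul_left (c : ℝ) (v w : Vec) : sp (c • v) w = c * sp v w := by
  simp only [sp, Pi.smul_apply, smul_eq_mul]; ring

theorem sp_smul_right (c : ℝ) (v w : Vec) : sp v (c • w) = c * sp v w := by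
  simp only [sp, Pi.smul_apply, smul_eq_mul]; ring

theorem sp_neg_left (v w : Vec) : sp (-v) w = -sp v w := by
  simp only [sp, Pi.neg_apply]; ring

theorem sp_neg_right (v w : Vec) : sp v (-w) = -sp v w := by
  simp only [sp, Pi.neg_apply]; ring

@[simp] theorem sp_zero_left (v : Vec) : sp 0 v = 0 := by simp [sp]

@[simp] theorem sp_zero_right (v : Vec) : sp v 0 = 0 := by simp [sp]

/-- The orthogonal complement of a negative plane is positive definite. -/
theorem sp_pos_of_orthogonal {u v w : Vec} (hu : sp u u < 0) (hv : sp v v < 0) (huv : sp u v = 0)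
    (huw : sp u w = 0) (hvw : sp v w = 0) (hw : w ≠ 0) : 0 < sp w w := by
  by_contra hneg
  push Not at hneg
  -- The rows are the two negative coordinates of u, v, w. Three vectors have a nontrivial
  -- combination on which both vanish, and there the form is positive definite; if ⟨w, w⟩ ≤ 0 it
  -- would be nonpositive there as well.
  let L : (Fin 3 → ℝ) →ₗ[ℝ] (Fin 2 → ℝ) := Matrix.toLin'
    !![u 0 + u 5, v 0 + v 5, w 0 + w 5; u 1, v 1, w 1]
  have hker : LinearMap.ker L ≠ ⊥ := LinearMap.ker_ne_bot_of_finrank_lt (by simp)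
  obtain ⟨c, hc, hc0⟩ := (Submodule.ne_bot_iff _).1 hker
  have h0 := congrFun (LinearMap.mem_ker.1 hc) 0
  have h1 := congrFun (LinearMap.mem_ker.1 hc) 1
  simp [L, Matrix.toLin'_apply, Matrix.mulVec, dotProduct, Fin.sum_univ_three] at h0 h1
  set z : Vec := c 0 • u + c 1 • v + c 2 • w with hz
  have hzz : sp z z = c 0 ^ 2 * sp u u + c 1 ^ 2 * sp v v + c 2 ^ 2 * sp w w := by
    simp only [hz, sp_add_left, sp_add_right, sp_smul_left, sp_smul_right, huv, huw, hvw,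
      sp_comm v u, sp_comm w u, sp_comm w v]
    ring
  have hz0 : z 5 = -z 0 := by simp [hz]; linarith
  have hz1 : z 1 = 0 := by simp [hz]; linarith
  have hzn : sp z z = 2 * z 0 ^ 2 + z 2 ^ 2 + z 3 ^ 2 + z 4 ^ 2 := by
    simp only [sp, hz0, hz1]; ring
  have hzp : 0 ≤ sp z z := by rw [hzn]; positivity
  have e0 : c 0 = 0 := by
    by_contra h
    have := sq_pos_of_ne_zero h
    nlinarith [mul_nonneg (sq_nonneg (c 1)) (neg_nonneg.2 hv.le),
      mul_nonneg (sq_nonneg (c 2)) (neg_nonneg.2 hneg), mul_pos this (neg_pos.2 hu)]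
  have e1 : c 1 = 0 := by
    by_contra h
    have := sq_pos_of_ne_zero h
    nlinarith [mul_nonneg (sq_nonneg (c 0)) (neg_nonneg.2 hu.le),
      mul_nonneg (sq_nonneg (c 2)) (neg_nonneg.2 hneg), mul_pos this (neg_pos.2 hv)]
  have e2 : c 2 ≠ 0 := by
    intro e2
    apply hc0
    ext i
    fin_cases i <;> simp [e0, e1, e2]
  have hle : 2 * z 0 ^ 2 + z 2 ^ 2 + z 3 ^ 2 + z 4 ^ 2 ≤ 0 := by
    rw [← hzn, hzz, e0, e1]
    nlinarith [mul_nonneg (sq_nonneg (c 2)) (neg_nonneg.2 hneg)]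
  have z0 : z 0 = 0 := by
    by_contra h
    nlinarith [sq_pos_of_ne_zero h, sq_nonneg (z 2), sq_nonneg (z 3), sq_nonneg (z 4)]
  have z2 : z 2 = 0 := by
    by_contra h
    nlinarith [sq_pos_of_ne_zero h, sq_nonneg (z 0), sq_nonneg (z 3), sq_nonneg (z 4)]
  have z3 : z 3 = 0 := by
    by_contra h
    nlinarith [sq_pos_of_ne_zero h, sq_nonneg (z 2), sq_nonneg (z 0), sq_nonneg (z 4)]
  have z4 : z 4 = 0 := by
    by_contra h
    nlinarith [sq_pos_of_ne_zero h, sq_nonneg (z 2), sq_nonneg (z 3), sq_nonneg (z 0)]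
  have z5 : z 5 = 0 := by rw [hz0, z0, neg_zero]
  have hzero : c 2 • w = 0 := by
    have : z = 0 := by
      ext i
      fin_cases i <;> assumption
    simpa [hz, e0, e1] using this
  exact hw ((smul_eq_zero.1 hzero).resolve_left e2)

/-- A vector orthogonal to a basis vanishes. -/
theorem eq_zero_of_sp_eq_zero {b : Fin 6 → Vec} (hb : Matrix.det (Matrix.of b) ≠ 0) {x : Vec}
    (hx : ∀ i, sp (b i) x = 0) : x = 0 := by
  by_contra hne
  apply hb
  rw [← Matrix.exists_mulVec_eq_zero_iff]
  -- The Gram matrix of the light-cone basis applied to x, so that the scalar products with x become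
  -- a matrix product.
  refine ⟨![-x 5, -x 1, x 2, x 3, x 4, -x 0], ?_, ?_⟩
  · intro h
    apply hne
    have h0 := congrFun h 0
    have h1 := congrFun h 1
    have h2 := congrFun h 2
    have h3 := congrFun h 3
    have h4 := congrFun h 4
    have h5 := congrFun h 5
    simp at h0 h1 h2 h3 h4 h5
    ext i
    fin_cases i <;> simp [*]
  · ext i
    have := hx i
    simp only [sp] at this
    simp [Matrix.mulVec, dotProduct, Fin.sum_univ_six]
    linarith

/-- A vector is orthogonal to some nonzero vector along with any four others. -/
theorem exists_orthogonal (b : Fin 5 → Vec) : ∃ w : Vec, w ≠ 0 ∧ ∀ i, sp (b i) w = 0 := by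
  let L : Vec →ₗ[ℝ] (Fin 5 → ℝ) :=
    { toFun := fun w i => sp (b i) w
      map_add' := fun v w => by ext i; simp [sp_add_right]
      map_smul' := fun c w => by ext i; simp [sp_smul_right] }
  have hker : LinearMap.ker L ≠ ⊥ := LinearMap.ker_ne_bot_of_finrank_lt (by simp)
  obtain ⟨w, hw, hw0⟩ := (Submodule.ne_bot_iff _).1 hker
  exact ⟨w, hw0, fun i => congrFun (LinearMap.mem_ker.1 hw) i⟩

/-- Orthogonality to a spanning set. -/
theorem sp_eq_zero_of_mem_span {s : Set Vec} {w : Vec} (h : ∀ x ∈ s, sp x w = 0) {x : Vec}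
    (hx : x ∈ Submodule.span ℝ s) : sp x w = 0 := by
  induction hx using Submodule.span_induction with
  | mem x hx => exact h x hx
  | zero => simp
  | add x y _ _ hx hy => rw [sp_add_left, hx, hy, add_zero]
  | smul c x _ hx => rw [sp_smul_left, hx, mul_zero]

theorem iteratedDeriv_mem_osculatingSpace {k j : ℕ} (hj : j ≤ k) (Γ : ℝ → Vec) (t : ℝ) :
    iteratedDeriv j Γ t ∈ osculatingSpace k Γ t :=
  Submodule.subset_span ⟨j, hj, rfl⟩

theorem sp_eq_zero_of_mem_osculatingSpace {k : ℕ} {Γ : ℝ → Vec} {t : ℝ} {w : Vec}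
    (h : ∀ j ≤ k, sp (iteratedDeriv j Γ t) w = 0) {x : Vec} (hx : x ∈ osculatingSpace k Γ t) :
    sp x w = 0 := by
  refine sp_eq_zero_of_mem_span ?_ hx
  rintro _ ⟨j, hj, rfl⟩
  exact h j hj

/-- The projection to a normal space is determined by its defining properties as soon as the
osculating space is non-degenerate. -/
theorem pr_eq_of {k : ℕ} {Γ : ℝ → Vec} {t : ℝ} {v w : Vec}
    (hnd : ∀ x ∈ osculatingSpace k Γ t, (∀ y ∈ osculatingSpace k Γ t, sp y x = 0) → x = 0)
    (hw : ∀ j ≤ k, sp (iteratedDeriv j Γ t) w = 0) (hvw : v - w ∈ osculatingSpace k Γ t) :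
    pr k Γ t v = w := by
  have hw' : ∀ x ∈ osculatingSpace k Γ t, sp x w = 0 :=
    fun x hx => sp_eq_zero_of_mem_osculatingSpace hw hx
  have hex : ∃ w : Vec, (∀ x ∈ osculatingSpace k Γ t, sp x w = 0) ∧
      v - w ∈ osculatingSpace k Γ t := ⟨w, hw', hvw⟩
  obtain ⟨h1, h2⟩ := Classical.epsilon_spec hex
  change (∀ x ∈ osculatingSpace k Γ t, sp x (pr k Γ t v) = 0) at h1
  change v - pr k Γ t v ∈ _ at h2
  have h3 : pr k Γ t v - w ∈ osculatingSpace k Γ t := by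
    have := Submodule.sub_mem _ hvw h2
    simpa using this
  have h4 := hnd _ h3 fun y hy => by rw [sp_sub_right, h1 y hy, hw' y hy, sub_zero]
  exact sub_eq_zero.1 h4

/-! ### Differentiation -/

theorem hasDerivAt_sp {v w : ℝ → Vec} {v' w' : Vec} {t : ℝ} (hv : HasDerivAt v v' t)
    (hw : HasDerivAt w w' t) :
    HasDerivAt (fun s => sp (v s) (w s)) (sp v' (w t) + sp (v t) w') t := by
  have hv := hasDerivAt_pi.1 hv
  have hw := hasDerivAt_pi.1 hw
  simp only [sp]
  have := ((((((hv 0).mul (hw 5)).add ((hv 5).mul (hw 0))).neg.sub ((hv 1).mul (hw 1))).add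
    ((hv 2).mul (hw 2))).add ((hv 3).mul (hw 3))).add ((hv 4).mul (hw 4))
  refine this.congr_deriv ?_
  ring

theorem contDiffOn_sp {E : Type*} [NormedAddCommGroup E] [NormedSpace ℝ E] {n : WithTop ℕ∞}
    {v w : E → Vec} {s : Set E} (hv : ContDiffOn ℝ n v s) (hw : ContDiffOn ℝ n w s) :
    ContDiffOn ℝ n (fun x => sp (v x) (w x)) s := by
  have hv := contDiffOn_pi.1 hv
  have hw := contDiffOn_pi.1 hw
  simp only [sp]
  exact ((((((hv 0).mul (hw 5)).add ((hv 5).mul (hw 0))).neg.sub ((hv 1).mul (hw 1))).add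
    ((hv 2).mul (hw 2))).add ((hv 3).mul (hw 3))).add ((hv 4).mul (hw 4))

section Smooth

variable {F : Type*} [NormedAddCommGroup F] [NormedSpace ℝ F] {I : Set ℝ}

theorem contDiffOn_deriv (hI : IsOpen I) {f : ℝ → F} (hf : ContDiffOn ℝ ∞ f I) :
    ContDiffOn ℝ ∞ (deriv f) I :=
  ((contDiffOn_infty_iff_deriv_of_isOpen hI).1 hf).2

theorem hasDerivAt_of_contDiffOn (hI : IsOpen I) {f : ℝ → F} (hf : ContDiffOn ℝ ∞ f I) {t : ℝ}
    (ht : t ∈ I) : HasDerivAt f (deriv f t) t :=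
  ((hf.differentiableOn (by simp)).differentiableAt (hI.mem_nhds ht)).hasDerivAt

theorem contDiffOn_iteratedDeriv (hI : IsOpen I) {f : ℝ → F} (hf : ContDiffOn ℝ ∞ f I) (n : ℕ) :
    ContDiffOn ℝ ∞ (iteratedDeriv n f) I := by
  induction n with
  | zero => simpa using hf
  | succ n ih => rw [iteratedDeriv_succ]; exact contDiffOn_deriv hI ih

theorem hasDerivAt_iteratedDeriv (hI : IsOpen I) {f : ℝ → F} (hf : ContDiffOn ℝ ∞ f I) (n : ℕ)
    {t : ℝ} (ht : t ∈ I) : HasDerivAt (iteratedDeriv n f) (iteratedDeriv (n + 1) f t) t := by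
  rw [iteratedDeriv_succ]
  exact hasDerivAt_of_contDiffOn hI (contDiffOn_iteratedDeriv hI hf n) ht

theorem deriv_eqOn (hI : IsOpen I) {f g g' : ℝ → F} (hfg : Set.EqOn f g I)
    (hg : ∀ t ∈ I, HasDerivAt g (g' t) t) : Set.EqOn (deriv f) g' I := fun t ht => by
  have : f =ᶠ[nhds t] g := hfg.eventuallyEq_of_mem (hI.mem_nhds ht)
  rw [this.deriv_eq, (hg t ht).deriv]

theorem iteratedDeriv_succ_eqOn (hI : IsOpen I) {f g g' : ℝ → F} {n : ℕ}
    (hfg : Set.EqOn (iteratedDeriv n f) g I) (hg : ∀ t ∈ I, HasDerivAt g (g' t) t) :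
    Set.EqOn (iteratedDeriv (n + 1) f) g' I := by
  rw [iteratedDeriv_succ]
  exact deriv_eqOn hI hfg hg

theorem hasDerivAt_congr_eqOn (hI : IsOpen I) {f g : ℝ → F} {g' : F} {t : ℝ} (ht : t ∈ I)
    (hfg : Set.EqOn f g I) (hg : HasDerivAt g g' t) : HasDerivAt f g' t :=
  hg.congr_of_eventuallyEq (hfg.eventuallyEq_of_mem (hI.mem_nhds ht))

/-- Differentiating a constant scalar product. -/
theorem sp_deriv_add_eq_zero (hI : IsOpen I) {v w : ℝ → Vec} {v' w' : Vec} {c t : ℝ} (ht : t ∈ I)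
    (hc : ∀ s ∈ I, sp (v s) (w s) = c) (hv : HasDerivAt v v' t) (hw : HasDerivAt w w' t) :
    sp v' (w t) + sp (v t) w' = 0 :=
  (hasDerivAt_sp hv hw).unique
    (hasDerivAt_congr_eqOn hI ht (g := fun _ => c) hc (hasDerivAt_const t c))

end Smooth

/-! ### Strain of a null curve in terms of a null lift -/

/-- The part of `g₃` orthogonal to `g₀, g₁, g₂`, for the `2`-jet `g₀, g₁, g₂` of a null curve. -/
noncomputable def residual (g₀ g₁ g₂ g₃ : Vec) : Vec :=
  -- For a null jet g₀ is orthogonal to g₀ and g₁, and ⟨g₀, g₂⟩ = -⟨g₁, g₁⟩. The orthogonality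
  -- conditions are therefore triangular: pairing with g₀, g₁, g₂ determines ζ, β, α in turn.
  let ζ := -(sp g₀ g₃ / sp g₁ g₁)
  let β := (sp g₁ g₃ - ζ * sp g₁ g₂) / sp g₁ g₁
  let α := (β * sp g₁ g₂ + ζ * sp g₂ g₂ - sp g₂ g₃) / sp g₁ g₁
  g₃ - α • g₀ - β • g₁ - ζ • g₂

/-- Hides the coefficients where only the class of g₃ modulo the osculating space matters. -/
theorem exists_residual_eq (g₀ g₁ g₂ g₃ : Vec) :
    ∃ α β ζ : ℝ, residual g₀ g₁ g₂ g₃ = g₃ - α • g₀ - β • g₁ - ζ • g₂ :=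
  ⟨_, _, _, rfl⟩

/-- The scalar products of the `2`-jet of a null curve that is not isotropic. -/
structure IsNullJet (g₀ g₁ g₂ : Vec) : Prop where
  zero_zero : sp g₀ g₀ = 0
  zero_one : sp g₀ g₁ = 0
  zero_two : sp g₀ g₂ = -sp g₁ g₁
  one_one : sp g₁ g₁ ≠ 0

namespace IsNullJet

variable {g₀ g₁ g₂ : Vec}

theorem sp_zero_residual (h : IsNullJet g₀ g₁ g₂) (g₃ : Vec) :
    sp g₀ (residual g₀ g₁ g₂ g₃) = 0 := by
  have := h.one_one
  simp only [residual, sp_sub_right, sp_smul_right, h.zero_zero, h.zero_one, h.zero_two]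
  field_simp
  ring

theorem sp_one_residual (h : IsNullJet g₀ g₁ g₂) (g₃ : Vec) :
    sp g₁ (residual g₀ g₁ g₂ g₃) = 0 := by
  have := h.one_one
  simp only [residual, sp_sub_right, sp_smul_right, sp_comm g₁ g₀, h.zero_one]
  field_simp
  ring

theorem sp_two_residual (h : IsNullJet g₀ g₁ g₂) (g₃ : Vec) :
    sp g₂ (residual g₀ g₁ g₂ g₃) = 0 := by
  have := h.one_one
  simp only [residual, sp_sub_right, sp_smul_right, sp_comm g₂ g₀, sp_comm g₂ g₁, h.zero_two]
  field_simp
  ring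

end IsNullJet

theorem exists_sum_of_mem_osculatingSpace {k : ℕ} {Γ : ℝ → Vec} {t : ℝ} {x : Vec}
    (hx : x ∈ osculatingSpace k Γ t) :
    ∃ c : ℕ → ℝ, x = ∑ j ∈ Finset.range (k + 1), c j • iteratedDeriv j Γ t := by
  unfold osculatingSpace at hx
  induction hx using Submodule.span_induction with
  | mem x hx =>
    obtain ⟨j, hj, rfl⟩ := hx
    refine ⟨fun i => if i = j then 1 else 0, ?_⟩
    simp [Nat.lt_succ_of_le hj]
  | zero => exact ⟨0, by simp⟩
  | add x y _ _ hx hy =>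
    obtain ⟨c, hc⟩ := hx
    obtain ⟨d, hd⟩ := hy
    exact ⟨c + d, by simp [hc, hd, add_smul, Finset.sum_add_distrib]⟩
  | smul r x _ hx =>
    obtain ⟨c, hc⟩ := hx
    exact ⟨r • c, by simp [hc, mul_smul, Finset.smul_sum]⟩

/-- The Gram matrix of a null jet is anti-triangular with antidiagonal entries ±⟨g₁, g₁⟩ ≠ 0, so the
coefficients vanish in the order c₂, c₁, c₀. -/
theorem osculatingSpace_two_nondegenerate {δ : ℝ → Vec} {t : ℝ}
    (h : IsNullJet (iteratedDeriv 0 δ t) (iteratedDeriv 1 δ t) (iteratedDeriv 2 δ t)) :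
    ∀ x ∈ osculatingSpace 2 δ t, (∀ y ∈ osculatingSpace 2 δ t, sp y x = 0) → x = 0 := by
  intro x hx hy
  obtain ⟨c, hc⟩ := exists_sum_of_mem_osculatingSpace hx
  simp only [Finset.sum_range_succ, Finset.sum_range_zero, zero_add] at hc
  have h0 := hy _ (iteratedDeriv_mem_osculatingSpace (k := 2) (j := 0) (by norm_num) δ t)
  have h1 := hy _ (iteratedDeriv_mem_osculatingSpace (k := 2) (j := 1) (by norm_num) δ t)
  have h2 := hy _ (iteratedDeriv_mem_osculatingSpace (k := 2) (j := 2) (by norm_num) δ t)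
  generalize iteratedDeriv 0 δ t = g₀ at *
  generalize iteratedDeriv 1 δ t = g₁ at *
  generalize iteratedDeriv 2 δ t = g₂ at *
  have hne := h.one_one
  simp only [hc, sp_add_right, sp_smul_right, h.zero_zero, h.zero_one, h.zero_two,
    sp_comm g₁ g₀, sp_comm g₂ g₀] at h0 h1 h2
  have c2 : c 2 = 0 := by
    have : c 2 * sp g₁ g₁ = 0 := by linarith
    exact (mul_eq_zero.1 this).resolve_right hne
  rw [c2] at h1 h2
  have c1 : c 1 = 0 := by
    have : c 1 * sp g₁ g₁ = 0 := by linarith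
    exact (mul_eq_zero.1 this).resolve_right hne
  rw [c1] at h2
  have c0 : c 0 = 0 := by
    have : c 0 * sp g₁ g₁ = 0 := by linarith
    exact (mul_eq_zero.1 this).resolve_right hne
  rw [hc, c0, c1, c2]
  simp

/-- Differentiating ⟨δ, δ⟩ = 0 twice gives all the relations. -/
theorem isNullJet_of_null {I : Set ℝ} (hI : IsOpen I) {δ : ℝ → Vec} (hδ : ContDiffOn ℝ ∞ δ I)
    (hnull : ∀ t ∈ I, sp (δ t) (δ t) = 0) {t : ℝ} (ht : t ∈ I)
    (h1 : sp (deriv δ t) (deriv δ t) ≠ 0) :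
    IsNullJet (iteratedDeriv 0 δ t) (iteratedDeriv 1 δ t) (iteratedDeriv 2 δ t) := by
  have hd : ∀ n, ∀ s ∈ I, HasDerivAt (iteratedDeriv n δ) (iteratedDeriv (n + 1) δ s) s :=
    fun n s hs => hasDerivAt_iteratedDeriv hI hδ n hs
  have h00 : ∀ s ∈ I, sp (iteratedDeriv 0 δ s) (iteratedDeriv 0 δ s) = 0 := by simpa using hnull
  have h01 : ∀ s ∈ I, sp (iteratedDeriv 0 δ s) (iteratedDeriv 1 δ s) = 0 := fun s hs => by
    have := sp_deriv_add_eq_zero hI hs h00 (hd 0 s hs) (hd 0 s hs)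
    rw [sp_comm (iteratedDeriv (0 + 1) δ s)] at this
    simpa using this
  have h02 := sp_deriv_add_eq_zero hI ht h01 (hd 0 t ht) (hd 1 t ht)
  exact ⟨h00 t ht, h01 t ht, by simp only [zero_add, Nat.reduceAdd] at h02; linarith,
    by simpa using h1⟩

/-- The strain of a null curve `δ` computed from a null lift `G = ρ δ`. -/
theorem strain_eq_of_lift {I : Set ℝ} (hI : IsOpen I) {δ G : ℝ → Vec} {ρ : ℝ → ℝ}
    (hδ : ContDiffOn ℝ ∞ δ I) (hρ : ContDiffOn ℝ ∞ ρ I) (hG : Set.EqOn G (fun s => ρ s • δ s) I)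
    (hρ0 : ∀ s ∈ I, ρ s ≠ 0) (hnull : ∀ s ∈ I, sp (δ s) (δ s) = 0) {t : ℝ} (ht : t ∈ I)
    (hδ1' : sp (deriv δ t) (deriv δ t) ≠ 0) {P : Vec}
    (hP : P = residual (G t) (deriv G t) (iteratedDeriv 2 G t) (iteratedDeriv 3 G t)) :
    sp (deriv G t) (deriv G t) = ρ t ^ 2 * sp (deriv δ t) (deriv δ t) ∧
    strain δ t = sp P P / |sp (deriv G t) (deriv G t)| := by
  have hd : ∀ n, ∀ s ∈ I, HasDerivAt (iteratedDeriv n δ) (iteratedDeriv (n + 1) δ s) s :=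
    fun n s hs => hasDerivAt_iteratedDeriv hI hδ n hs
  have hr : ∀ n, ∀ s ∈ I, HasDerivAt (iteratedDeriv n ρ) (iteratedDeriv (n + 1) ρ s) s :=
    fun n s hs => hasDerivAt_iteratedDeriv hI hρ n hs
  have hm : ∀ i j, ∀ s ∈ I, HasDerivAt (fun s => iteratedDeriv i ρ s • iteratedDeriv j δ s)
      (iteratedDeriv i ρ s • iteratedDeriv (j + 1) δ s +
        iteratedDeriv (i + 1) ρ s • iteratedDeriv j δ s) s :=
    fun i j s hs => (hr i s hs).smul (hd j s hs)
  have e0 : Set.EqOn (iteratedDeriv 0 G)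
      (fun s => iteratedDeriv 0 ρ s • iteratedDeriv 0 δ s) I := by
    simpa using hG
  have e1 := iteratedDeriv_succ_eqOn hI e0 (hm 0 0)
  have e2 := iteratedDeriv_succ_eqOn hI e1 fun s hs => (hm 0 1 s hs).add (hm 1 0 s hs)
  have e3 := iteratedDeriv_succ_eqOn hI e2 fun s hs =>
    ((hm 0 2 s hs).add (hm 1 1 s hs)).add ((hm 1 1 s hs).add (hm 2 0 s hs))
  have hδ0 := hnull t ht
  have hδ1 : sp (deriv δ t) (δ t) = 0 := by
    have := sp_deriv_add_eq_zero hI ht hnull (hasDerivAt_of_contDiffOn hI hδ ht)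
      (hasDerivAt_of_contDiffOn hI hδ ht)
    rw [sp_comm (δ t)] at this
    linarith
  have hρt := hρ0 t ht
  have hG0 : G t = ρ t • δ t := hG ht
  have hG1 : deriv G t = ρ t • deriv δ t + deriv ρ t • δ t := by simpa using e1 ht
  have hG2 : iteratedDeriv 2 G t = ρ t • iteratedDeriv 2 δ t + deriv ρ t • deriv δ t +
      (deriv ρ t • deriv δ t + iteratedDeriv 2 ρ t • δ t) := by simpa using e2 ht
  have hG3 : iteratedDeriv 3 G t = ρ t • iteratedDeriv 3 δ t + deriv ρ t • iteratedDeriv 2 δ t +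
      (deriv ρ t • iteratedDeriv 2 δ t + iteratedDeriv 2 ρ t • deriv δ t) +
      (deriv ρ t • iteratedDeriv 2 δ t + iteratedDeriv 2 ρ t • deriv δ t +
      (iteratedDeriv 2 ρ t • deriv δ t + iteratedDeriv 3 ρ t • δ t)) := by simpa using e3 ht
  have hsp : sp (deriv G t) (deriv G t) = ρ t ^ 2 * sp (deriv δ t) (deriv δ t) := by
    rw [hG1]
    simp only [sp_add_left, sp_add_right, sp_smul_left, sp_smul_right, hδ0, hδ1,
      sp_comm (δ t) (deriv δ t)]
    ring
  have h1 : sp (deriv G t) (deriv G t) ≠ 0 := by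
    rw [hsp]
    exact mul_ne_zero (pow_ne_zero 2 hρt) hδ1'
  have hJδ := isNullJet_of_null hI hδ hnull ht hδ1'
  have hGs : ContDiffOn ℝ ∞ G I := (hρ.smul hδ).congr hG
  have hGn : ∀ s ∈ I, sp (G s) (G s) = 0 := fun s hs => by
    rw [hG hs, sp_smul_left, sp_smul_right, hnull s hs]; ring
  have hJG := isNullJet_of_null hI hGs hGn ht h1
  simp only [iteratedDeriv_zero, iteratedDeriv_one] at hJG
  have p0 := hJG.sp_zero_residual (iteratedDeriv 3 G t)
  have p1 := hJG.sp_one_residual (iteratedDeriv 3 G t)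
  have p2 := hJG.sp_two_residual (iteratedDeriv 3 G t)
  rw [← hP] at p0 p1 p2
  have q0 : sp (δ t) P = 0 := by
    rw [hG0, sp_smul_left] at p0
    exact (mul_eq_zero.1 p0).resolve_left hρt
  have q1 : sp (deriv δ t) P = 0 := by
    rw [hG1, sp_add_left, sp_smul_left, sp_smul_left, q0, mul_zero, add_zero] at p1
    exact (mul_eq_zero.1 p1).resolve_left hρt
  have q2 : sp (iteratedDeriv 2 δ t) P = 0 := by
    rw [hG2] at p2
    simp only [sp_add_left, sp_smul_left, q0, q1, mul_zero, add_zero] at p2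
    exact (mul_eq_zero.1 p2).resolve_left hρt
  -- The 2-jets of G and δ are related by a triangular matrix with diagonal ρ, so P is normal to the
  -- osculating space of δ. Modulo that space P is ρ δ'''. The resulting factor ρ⁻² in the numerator
  -- of the strain matches ⟨G', G'⟩ = ρ²⟨δ', δ'⟩.
  have hpr : pr 2 δ t (iteratedDeriv 3 δ t) = (ρ t)⁻¹ • P := by
    refine pr_eq_of (osculatingSpace_two_nondegenerate hJδ) ?_ ?_
    · intro j hj
      rw [sp_smul_right]
      interval_cases j
      · simp [q0]
      · simp [q1]
      · simp [q2]
    · have m0 := iteratedDeriv_mem_osculatingSpace (k := 2) (j := 0) (by norm_num) δ t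
      have m1 := iteratedDeriv_mem_osculatingSpace (k := 2) (j := 1) (by norm_num) δ t
      have m2 := iteratedDeriv_mem_osculatingSpace (k := 2) (j := 2) (by norm_num) δ t
      rw [iteratedDeriv_zero] at m0
      rw [iteratedDeriv_one] at m1
      have key : ∃ x y z : ℝ, P = ρ t • iteratedDeriv 3 δ t -
          (x • δ t + y • deriv δ t + z • iteratedDeriv 2 δ t) := by
        obtain ⟨α, β, ζ, h⟩ := exists_residual_eq (G t) (deriv G t) (iteratedDeriv 2 G t)
          (iteratedDeriv 3 G t)
        -- Coefficients read off from the Leibniz expansions of G, G', G'', G'''.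
        refine ⟨α * ρ t + β * deriv ρ t + ζ * iteratedDeriv 2 ρ t - iteratedDeriv 3 ρ t,
          β * ρ t + 2 * ζ * deriv ρ t - 3 * iteratedDeriv 2 ρ t,
          ζ * ρ t - 3 * deriv ρ t, ?_⟩
        rw [hP, h, hG0, hG1, hG2, hG3]
        module
      obtain ⟨x, y, z, hxyz⟩ := key
      have : iteratedDeriv 3 δ t - (ρ t)⁻¹ • P =
          (ρ t)⁻¹ • (x • δ t + y • deriv δ t + z • iteratedDeriv 2 δ t) := by
        rw [hxyz, smul_sub, smul_smul, inv_mul_cancel₀ hρt, one_smul]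
        abel
      rw [this]
      exact Submodule.smul_mem _ _ (Submodule.add_mem _ (Submodule.add_mem _
        (Submodule.smul_mem _ _ m0) (Submodule.smul_mem _ _ m1)) (Submodule.smul_mem _ _ m2))
  refine ⟨hsp, ?_⟩
  rw [strain, hpr, hsp, sp_smul_left, sp_smul_right, abs_mul, abs_of_nonneg (sq_nonneg (ρ t))]
  have := abs_ne_zero.2 hδ1'
  field_simp

/-! ### The canonical null lift -/

theorem sp_self_of_mem_einsteinUniverse {y : Vec} (hy : y ∈ einsteinUniverse) : sp y y = 0 := by
  obtain ⟨h1, h2⟩ := hy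
  simp only [sp]
  nlinarith

/-- A null curve parameterized by the conformal parameter and normalized as the canonical lift. -/
structure IsNormalizedLift (I : Set ℝ) (Γ : ℝ → Vec) : Prop where
  smooth : ContDiffOn ℝ ∞ Γ I
  null : ∀ t ∈ I, sp (Γ t) (Γ t) = 0
  unit_speed : ∀ t ∈ I, sp (deriv Γ t) (deriv Γ t) = -1
  strain_rpow : ∀ t ∈ I,
    sp (residual (Γ t) (deriv Γ t) (iteratedDeriv 2 Γ t) (iteratedDeriv 3 Γ t))
      (residual (Γ t) (deriv Γ t) (iteratedDeriv 2 Γ t) (iteratedDeriv 3 Γ t)) ^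
        (1 / 4 : ℝ) = 1

/-- The first conformal curvature in terms of the canonical lift. -/
noncomputable def liftCurvature (Γ : ℝ → Vec) (t : ℝ) : ℝ :=
  -(1 / 2) * sp (iteratedDeriv 2 Γ t) (iteratedDeriv 2 Γ t)

/-- The vector `B₂` in terms of the canonical lift. -/
noncomputable def liftNormal (Γ : ℝ → Vec) (t : ℝ) : Vec :=
  -(iteratedDeriv 3 Γ t + deriv (liftCurvature Γ) t • Γ t + (2 * liftCurvature Γ t) • deriv Γ t)

/-- The vector `B₅` in terms of the canonical lift. -/
noncomputable def liftTransversal (Γ : ℝ → Vec) (t : ℝ) : Vec :=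
  -iteratedDeriv 2 Γ t - liftCurvature Γ t • Γ t

namespace IsNormalizedLift

variable {I : Set ℝ} {Γ : ℝ → Vec}

theorem hasDerivAt_zero (h : IsNormalizedLift I Γ) (hI : IsOpen I) {t : ℝ} (ht : t ∈ I) :
    HasDerivAt Γ (deriv Γ t) t := hasDerivAt_of_contDiffOn hI h.smooth ht

theorem hasDerivAt_one (h : IsNormalizedLift I Γ) (hI : IsOpen I) {t : ℝ} (ht : t ∈ I) :
    HasDerivAt (deriv Γ) (iteratedDeriv 2 Γ t) t := by
  simpa using hasDerivAt_iteratedDeriv hI h.smooth 1 ht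

theorem hasDerivAt_two (h : IsNormalizedLift I Γ) (hI : IsOpen I) {t : ℝ} (ht : t ∈ I) :
    HasDerivAt (iteratedDeriv 2 Γ) (iteratedDeriv 3 Γ t) t :=
  hasDerivAt_iteratedDeriv hI h.smooth 2 ht

theorem sp_zero_one (h : IsNormalizedLift I Γ) (hI : IsOpen I) {t : ℝ} (ht : t ∈ I) :
    sp (Γ t) (deriv Γ t) = 0 := by
  have := sp_deriv_add_eq_zero hI ht h.null (h.hasDerivAt_zero hI ht) (h.hasDerivAt_zero hI ht)
  rw [sp_comm (deriv Γ t)] at this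
  linarith

theorem sp_zero_two (h : IsNormalizedLift I Γ) (hI : IsOpen I) {t : ℝ} (ht : t ∈ I) :
    sp (Γ t) (iteratedDeriv 2 Γ t) = 1 := by
  have := sp_deriv_add_eq_zero hI ht (fun s hs => h.sp_zero_one hI hs) (h.hasDerivAt_zero hI ht)
    (h.hasDerivAt_one hI ht)
  rw [h.unit_speed t ht] at this
  linarith

theorem sp_one_two (h : IsNormalizedLift I Γ) (hI : IsOpen I) {t : ℝ} (ht : t ∈ I) :
    sp (deriv Γ t) (iteratedDeriv 2 Γ t) = 0 := by
  have := sp_deriv_add_eq_zero hI ht h.unit_speed (h.hasDerivAt_one hI ht) (h.hasDerivAt_one hI ht)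
  rw [sp_comm (iteratedDeriv 2 Γ t)] at this
  linarith

theorem sp_two_two (Γ : ℝ → Vec) (t : ℝ) :
    sp (iteratedDeriv 2 Γ t) (iteratedDeriv 2 Γ t) = -2 * liftCurvature Γ t := by
  rw [liftCurvature]; ring

theorem sp_zero_three (h : IsNormalizedLift I Γ) (hI : IsOpen I) {t : ℝ} (ht : t ∈ I) :
    sp (Γ t) (iteratedDeriv 3 Γ t) = 0 := by
  have := sp_deriv_add_eq_zero hI ht (fun s hs => h.sp_zero_two hI hs) (h.hasDerivAt_zero hI ht)
    (h.hasDerivAt_two hI ht)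
  rw [h.sp_one_two hI ht] at this
  linarith

theorem sp_one_three (h : IsNormalizedLift I Γ) (hI : IsOpen I) {t : ℝ} (ht : t ∈ I) :
    sp (deriv Γ t) (iteratedDeriv 3 Γ t) = 2 * liftCurvature Γ t := by
  have := sp_deriv_add_eq_zero hI ht (fun s hs => h.sp_one_two hI hs) (h.hasDerivAt_one hI ht)
    (h.hasDerivAt_two hI ht)
  rw [sp_two_two] at this
  linarith

theorem hasDerivAt_liftCurvature' (h : IsNormalizedLift I Γ) (hI : IsOpen I) {t : ℝ}
    (ht : t ∈ I) :
    HasDerivAt (liftCurvature Γ) (-sp (iteratedDeriv 2 Γ t) (iteratedDeriv 3 Γ t)) t := by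
  have := (hasDerivAt_sp (h.hasDerivAt_two hI ht) (h.hasDerivAt_two hI ht)).const_mul (-(1 / 2))
  refine this.congr_deriv ?_
  rw [sp_comm (iteratedDeriv 3 Γ t)]
  ring

theorem sp_two_three (h : IsNormalizedLift I Γ) (hI : IsOpen I) {t : ℝ} (ht : t ∈ I) :
    sp (iteratedDeriv 2 Γ t) (iteratedDeriv 3 Γ t) = -deriv (liftCurvature Γ) t := by
  rw [(h.hasDerivAt_liftCurvature' hI ht).deriv, neg_neg]

theorem isNullJet (h : IsNormalizedLift I Γ) (hI : IsOpen I) {t : ℝ} (ht : t ∈ I) :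
    IsNullJet (Γ t) (deriv Γ t) (iteratedDeriv 2 Γ t) :=
  ⟨h.null t ht, h.sp_zero_one hI ht, by rw [h.sp_zero_two hI ht, h.unit_speed t ht, neg_neg],
    by rw [h.unit_speed t ht]; norm_num⟩

/-- For the normalized scalar products the coefficients of Γ, Γ', Γ'' reduce to -k₁', -2k₁ and 0. -/
theorem residual_eq (h : IsNormalizedLift I Γ) (hI : IsOpen I) {t : ℝ} (ht : t ∈ I) :
    residual (Γ t) (deriv Γ t) (iteratedDeriv 2 Γ t) (iteratedDeriv 3 Γ t) =
      -liftNormal Γ t := by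
  simp only [residual, liftNormal, h.sp_zero_three hI ht, h.sp_one_three hI ht,
    h.sp_two_three hI ht, h.sp_one_two hI ht, h.unit_speed t ht]
  module

theorem contDiffOn_liftCurvature (h : IsNormalizedLift I Γ) (hI : IsOpen I) :
    ContDiffOn ℝ ∞ (liftCurvature Γ) I :=
  contDiffOn_const.mul (contDiffOn_sp (contDiffOn_iteratedDeriv hI h.smooth 2)
    (contDiffOn_iteratedDeriv hI h.smooth 2))

theorem contDiffOn_liftNormal (h : IsNormalizedLift I Γ) (hI : IsOpen I) :
    ContDiffOn ℝ ∞ (liftNormal Γ) I :=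
  (((contDiffOn_iteratedDeriv hI h.smooth 3).add
    ((contDiffOn_deriv hI (h.contDiffOn_liftCurvature hI)).smul h.smooth)).add
    ((contDiffOn_const.mul (h.contDiffOn_liftCurvature hI)).smul
      (contDiffOn_deriv hI h.smooth))).neg

theorem contDiffOn_liftTransversal (h : IsNormalizedLift I Γ) (hI : IsOpen I) :
    ContDiffOn ℝ ∞ (liftTransversal Γ) I :=
  (contDiffOn_iteratedDeriv hI h.smooth 2).neg.sub
    ((h.contDiffOn_liftCurvature hI).smul h.smooth)

theorem hasDerivAt_liftCurvature (h : IsNormalizedLift I Γ) (hI : IsOpen I) {t : ℝ}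
    (ht : t ∈ I) : HasDerivAt (liftCurvature Γ) (deriv (liftCurvature Γ) t) t :=
  hasDerivAt_of_contDiffOn hI (h.contDiffOn_liftCurvature hI) ht

theorem sp_zero_normal (h : IsNormalizedLift I Γ) (hI : IsOpen I) {t : ℝ} (ht : t ∈ I) :
    sp (Γ t) (liftNormal Γ t) = 0 := by
  simp only [liftNormal, sp_neg_right, sp_add_right, sp_smul_right, h.null t ht,
    h.sp_zero_one hI ht, h.sp_zero_three hI ht]
  ring

theorem sp_one_normal (h : IsNormalizedLift I Γ) (hI : IsOpen I) {t : ℝ} (ht : t ∈ I) :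
    sp (deriv Γ t) (liftNormal Γ t) = 0 := by
  simp only [liftNormal, sp_neg_right, sp_add_right, sp_smul_right, h.unit_speed t ht,
    sp_comm (deriv Γ t) (Γ t), h.sp_zero_one hI ht, h.sp_one_three hI ht]
  ring

theorem sp_two_normal (h : IsNormalizedLift I Γ) (hI : IsOpen I) {t : ℝ} (ht : t ∈ I) :
    sp (iteratedDeriv 2 Γ t) (liftNormal Γ t) = 0 := by
  simp only [liftNormal, sp_neg_right, sp_add_right, sp_smul_right, h.sp_two_three hI ht,
    sp_comm (iteratedDeriv 2 Γ t) (Γ t), h.sp_zero_two hI ht,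
    sp_comm (iteratedDeriv 2 Γ t) (deriv Γ t), h.sp_one_two hI ht]
  ring

theorem sp_zero_transversal (h : IsNormalizedLift I Γ) (hI : IsOpen I) {t : ℝ} (ht : t ∈ I) :
    sp (Γ t) (liftTransversal Γ t) = -1 := by
  simp only [liftTransversal, sp_neg_right, sp_sub_right, sp_smul_right, h.null t ht,
    h.sp_zero_two hI ht]
  ring

theorem sp_one_transversal (h : IsNormalizedLift I Γ) (hI : IsOpen I) {t : ℝ} (ht : t ∈ I) :
    sp (deriv Γ t) (liftTransversal Γ t) = 0 := by
  simp only [liftTransversal, sp_neg_right, sp_sub_right, sp_smul_right,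
    sp_comm (deriv Γ t) (Γ t), h.sp_zero_one hI ht, h.sp_one_two hI ht]
  ring

theorem sp_transversal_self (h : IsNormalizedLift I Γ) (hI : IsOpen I) {t : ℝ} (ht : t ∈ I) :
    sp (liftTransversal Γ t) (liftTransversal Γ t) = 0 := by
  simp only [liftTransversal, sp_neg_right, sp_sub_right, sp_smul_right, sp_neg_left, sp_sub_left,
    sp_smul_left, sp_comm (iteratedDeriv 2 Γ t) (Γ t), h.sp_zero_two hI ht, sp_two_two,
    h.null t ht]
  ring

theorem sp_normal_transversal (h : IsNormalizedLift I Γ) (hI : IsOpen I) {t : ℝ} (ht : t ∈ I) :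
    sp (liftNormal Γ t) (liftTransversal Γ t) = 0 := by
  rw [sp_comm]
  simp only [liftTransversal, sp_neg_left, sp_sub_left, sp_smul_left,
    h.sp_zero_normal hI ht, h.sp_two_normal hI ht]
  ring

/-- Vectors orthogonal to `B₀, B₁, B₅` are space-like. -/
theorem sp_pos (h : IsNormalizedLift I Γ) (hI : IsOpen I) {t : ℝ} (ht : t ∈ I) {w : Vec}
    (h0 : sp (Γ t) w = 0) (h1 : sp (deriv Γ t) w = 0) (h5 : sp (liftTransversal Γ t) w = 0)
    (hw : w ≠ 0) : 0 < sp w w := by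
  refine sp_pos_of_orthogonal (u := deriv Γ t) (v := Γ t + liftTransversal Γ t) ?_ ?_ ?_ h1 ?_ hw
  · rw [h.unit_speed t ht]; norm_num
  · simp only [sp_add_left, sp_add_right, h.null t ht, h.sp_transversal_self hI ht,
      h.sp_zero_transversal hI ht, sp_comm (liftTransversal Γ t) (Γ t)]
    norm_num
  · rw [sp_add_right, h.sp_one_transversal hI ht, sp_comm, h.sp_zero_one hI ht, add_zero]
  · rw [sp_add_left, h0, h5, add_zero]

theorem sp_nonneg (h : IsNormalizedLift I Γ) (hI : IsOpen I) {t : ℝ} (ht : t ∈ I) {w : Vec}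
    (h0 : sp (Γ t) w = 0) (h1 : sp (deriv Γ t) w = 0) (h5 : sp (liftTransversal Γ t) w = 0) :
    0 ≤ sp w w := by
  by_cases hw : w = 0
  · simp [hw]
  · exact (h.sp_pos hI ht h0 h1 h5 hw).le

/-- A real fourth root equal to 1 determines its argument only once this is known to be nonnegative;
the signature argument of `sp_nonneg` provides that. -/
theorem sp_normal_self (h : IsNormalizedLift I Γ) (hI : IsOpen I) {t : ℝ} (ht : t ∈ I) :
    sp (liftNormal Γ t) (liftNormal Γ t) = 1 := by
  have h1 := h.strain_rpow t ht
  rw [h.residual_eq hI ht, sp_neg_left, sp_neg_right, neg_neg] at h1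
  have h2 := h.sp_nonneg hI ht (h.sp_zero_normal hI ht) (h.sp_one_normal hI ht)
    (by rw [sp_comm]; exact h.sp_normal_transversal hI ht)
  exact (Real.rpow_left_inj h2 zero_le_one (by norm_num)).1 (h1.trans (Real.one_rpow _).symm)

theorem hasDerivAt_one' (h : IsNormalizedLift I Γ) (hI : IsOpen I) {t : ℝ} (ht : t ∈ I) :
    HasDerivAt (deriv Γ) (-(liftCurvature Γ t • Γ t) - liftTransversal Γ t) t :=
  (h.hasDerivAt_one hI ht).congr_deriv (by rw [liftTransversal]; module)

theorem hasDerivAt_transversal (h : IsNormalizedLift I Γ) (hI : IsOpen I) {t : ℝ} (ht : t ∈ I) :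
    HasDerivAt (liftTransversal Γ) (liftCurvature Γ t • deriv Γ t + liftNormal Γ t) t := by
  refine ((h.hasDerivAt_two hI ht).neg.sub ((h.hasDerivAt_liftCurvature hI ht).smul
    (h.hasDerivAt_zero hI ht))).congr_deriv ?_
  rw [liftNormal]
  module

theorem hasDerivAt_normal (h : IsNormalizedLift I Γ) (hI : IsOpen I) {t : ℝ} (ht : t ∈ I) :
    HasDerivAt (liftNormal Γ) (deriv (liftNormal Γ) t) t :=
  hasDerivAt_of_contDiffOn hI (h.contDiffOn_liftNormal hI) ht

theorem iteratedDeriv_three_eq (Γ : ℝ → Vec) (t : ℝ) :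
    iteratedDeriv 3 Γ t = -(liftNormal Γ t + deriv (liftCurvature Γ) t • Γ t +
      (2 * liftCurvature Γ t) • deriv Γ t) := by
  rw [liftNormal]; module

theorem iteratedDeriv_two_eq (Γ : ℝ → Vec) (t : ℝ) :
    iteratedDeriv 2 Γ t = -liftTransversal Γ t - liftCurvature Γ t • Γ t := by
  rw [liftTransversal]; module

theorem pr_two (h : IsNormalizedLift I Γ) (hI : IsOpen I) {t : ℝ} (ht : t ∈ I) :
    pr 2 Γ t (iteratedDeriv 3 Γ t) = -liftNormal Γ t := by
  have hJ := h.isNullJet hI ht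
  refine pr_eq_of (osculatingSpace_two_nondegenerate (by simpa using hJ)) ?_ ?_
  · intro j hj
    rw [sp_neg_right, neg_eq_zero]
    interval_cases j
    · simpa using h.sp_zero_normal hI ht
    · simpa using h.sp_one_normal hI ht
    · exact h.sp_two_normal hI ht
  · have m0 := iteratedDeriv_mem_osculatingSpace (k := 2) (j := 0) (by norm_num) Γ t
    have m1 := iteratedDeriv_mem_osculatingSpace (k := 2) (j := 1) (by norm_num) Γ t
    rw [iteratedDeriv_zero] at m0
    rw [iteratedDeriv_one] at m1
    have : iteratedDeriv 3 Γ t - -liftNormal Γ t =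
        (-deriv (liftCurvature Γ) t) • Γ t + (-(2 * liftCurvature Γ t)) • deriv Γ t := by
      rw [liftNormal]; module
    rw [this]
    exact Submodule.add_mem _ (Submodule.smul_mem _ _ m0) (Submodule.smul_mem _ _ m1)

/-- B₂ lies in the third osculating space, is orthogonal to Γ, Γ', Γ'' and has product -1 with Γ'''.
Pairing with it and with Γ removes the two top coefficients; the rest is triangular. -/
theorem osculatingSpace_three_nondegenerate (h : IsNormalizedLift I Γ) (hI : IsOpen I) {t : ℝ}
    (ht : t ∈ I) :
    ∀ x ∈ osculatingSpace 3 Γ t, (∀ y ∈ osculatingSpace 3 Γ t, sp y x = 0) → x = 0 := by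
  intro x hx hy
  obtain ⟨c, hc⟩ := exists_sum_of_mem_osculatingSpace hx
  simp only [Finset.sum_range_succ, Finset.sum_range_zero, zero_add, iteratedDeriv_zero,
    iteratedDeriv_one] at hc
  have m0 := iteratedDeriv_mem_osculatingSpace (k := 3) (j := 0) (by norm_num) Γ t
  have m1 := iteratedDeriv_mem_osculatingSpace (k := 3) (j := 1) (by norm_num) Γ t
  have m2 := iteratedDeriv_mem_osculatingSpace (k := 3) (j := 2) (by norm_num) Γ t
  have m3 := iteratedDeriv_mem_osculatingSpace (k := 3) (j := 3) (by norm_num) Γ t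
  rw [iteratedDeriv_zero] at m0
  rw [iteratedDeriv_one] at m1
  have h0 := hy _ m0
  have h1 := hy _ m1
  have h2 := hy _ m2
  have h3 : sp (liftNormal Γ t) x = 0 := by
    rw [liftNormal, sp_neg_left, sp_add_left, sp_add_left, sp_smul_left, sp_smul_left, h0, h1,
      hy _ m3]
    ring
  have hN3 : sp (liftNormal Γ t) (iteratedDeriv 3 Γ t) = -1 := by
    rw [iteratedDeriv_three_eq, sp_neg_right, sp_add_right, sp_add_right, sp_smul_right,
      sp_smul_right, h.sp_normal_self hI ht, sp_comm _ (Γ t), sp_comm _ (deriv Γ t),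
      h.sp_zero_normal hI ht, h.sp_one_normal hI ht]
    ring
  simp only [hc, sp_add_right, sp_smul_right, sp_comm (liftNormal Γ t) (Γ t),
    sp_comm (liftNormal Γ t) (deriv Γ t), sp_comm (liftNormal Γ t) (iteratedDeriv 2 Γ t),
    h.sp_zero_normal hI ht, h.sp_one_normal hI ht, h.sp_two_normal hI ht, hN3] at h3
  simp only [hc, sp_add_right, sp_smul_right, sp_comm (deriv Γ t) (Γ t),
    sp_comm (iteratedDeriv 2 Γ t) (Γ t), sp_comm (iteratedDeriv 2 Γ t) (deriv Γ t), h.null t ht,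
    h.sp_zero_one hI ht, h.sp_zero_two hI ht, h.sp_zero_three hI ht, h.unit_speed t ht,
    h.sp_one_two hI ht] at h0 h1 h2
  have c3 : c 3 = 0 := by linarith
  have c2 : c 2 = 0 := by linarith
  rw [c3, c2] at h1 h2
  have c1 : c 1 = 0 := by linarith
  have c0 : c 0 = 0 := by
    rw [c1] at h2
    linarith
  rw [hc, c0, c1, c2, c3]
  simp

/-- The section `S = B₂' - B₀` and its scalar products with `B₀, B₁, B₂, B₅`. -/
theorem section_orthogonal (h : IsNormalizedLift I Γ) (hI : IsOpen I) {t : ℝ} (ht : t ∈ I) :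
    sp (Γ t) (deriv (liftNormal Γ) t - Γ t) = 0 ∧
    sp (deriv Γ t) (deriv (liftNormal Γ) t - Γ t) = 0 ∧
    sp (liftNormal Γ t) (deriv (liftNormal Γ) t - Γ t) = 0 ∧
    sp (liftTransversal Γ t) (deriv (liftNormal Γ) t - Γ t) = 0 := by
  have d := h.hasDerivAt_normal hI ht
  have e0 := sp_deriv_add_eq_zero hI ht (fun s hs => h.sp_zero_normal hI hs)
    (h.hasDerivAt_zero hI ht) d
  have e1 := sp_deriv_add_eq_zero hI ht (fun s hs => h.sp_one_normal hI hs)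
    (h.hasDerivAt_one' hI ht) d
  have e2 := sp_deriv_add_eq_zero hI ht (fun s hs => h.sp_normal_self hI hs) d d
  have e5 := sp_deriv_add_eq_zero hI ht (fun s hs => h.sp_normal_transversal hI hs) d
    (h.hasDerivAt_transversal hI ht)
  simp only [sp_sub_right, sp_sub_left, sp_neg_left, sp_smul_left, sp_add_right, sp_smul_right,
    h.null t ht, sp_comm (deriv Γ t) (Γ t), sp_comm (liftNormal Γ t) (Γ t),
    sp_comm (liftNormal Γ t) (deriv Γ t), sp_comm (deriv (liftNormal Γ) t) (liftNormal Γ t),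
    sp_comm (deriv (liftNormal Γ) t) (liftTransversal Γ t), h.sp_normal_transversal hI ht,
    sp_comm (liftTransversal Γ t) (Γ t), sp_comm (liftTransversal Γ t) (liftNormal Γ t),
    h.sp_zero_one hI ht, h.sp_zero_normal hI ht, h.sp_one_normal hI ht, h.sp_normal_self hI ht,
    h.sp_zero_transversal hI ht] at e0 e1 e2 e5 ⊢
  refine ⟨?_, ?_, ?_, ?_⟩ <;> linarith

/-- B₂' - B₀ is orthogonal to B₀, B₁, B₂, B₅, hence to the third osculating space, and B₀ belongs to
that space. -/
theorem pr_three (h : IsNormalizedLift I Γ) (hI : IsOpen I) {t : ℝ} (ht : t ∈ I) :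
    pr 3 Γ t (deriv (liftNormal Γ) t) = deriv (liftNormal Γ) t - Γ t := by
  obtain ⟨s0, s1, s2, s5⟩ := h.section_orthogonal hI ht
  refine pr_eq_of (h.osculatingSpace_three_nondegenerate hI ht) ?_ ?_
  · intro j hj
    interval_cases j
    · simpa using s0
    · simpa using s1
    · rw [iteratedDeriv_two_eq, sp_sub_left, sp_neg_left, sp_smul_left, s0, s5]; ring
    · rw [iteratedDeriv_three_eq, sp_neg_left, sp_add_left, sp_add_left, sp_smul_left,
        sp_smul_left, s0, s1, s2]
      ring
  · have m0 := iteratedDeriv_mem_osculatingSpace (k := 3) (j := 0) (by norm_num) Γ t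
    rw [iteratedDeriv_zero] at m0
    simpa using m0

end IsNormalizedLift

/-! ### The conformal frame and its structure equations -/

/-- The factor between a time-like curve and its canonical lift, in the conformal parameter. -/
noncomputable def liftFactor (γ : ℝ → Vec) (t : ℝ) : ℝ := (√(-sp (deriv γ t) (deriv γ t)))⁻¹

theorem liftFactor_pos {I : Set ℝ} {γ : ℝ → Vec} (hγ : IsTimelikeCurve I γ) {t : ℝ} (ht : t ∈ I) :
    0 < liftFactor γ t :=
  inv_pos.2 (Real.sqrt_pos.2 (neg_pos.2 (hγ.timelike t ht)))

theorem contDiffOn_liftFactor {I : Set ℝ} (hI : IsOpen I) {γ : ℝ → Vec}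
    (hγ : IsTimelikeCurve I γ) : ContDiffOn ℝ ∞ (liftFactor γ) I := by
  have hd := contDiffOn_deriv hI hγ.smooth
  have hn : ∀ t ∈ I, -sp (deriv γ t) (deriv γ t) ≠ 0 := fun t ht =>
    (neg_pos.2 (hγ.timelike t ht)).ne'
  exact ((contDiffOn_sp hd hd).neg.sqrt hn).inv fun t ht =>
    (Real.sqrt_pos.2 (neg_pos.2 (hγ.timelike t ht))).ne'

theorem canonicalLift_eqOn {I : Set ℝ} {γ : ℝ → Vec} (hγ : IsTimelikeCurve I γ)
    (hpar : IsConformalParameter I γ) :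
    Set.EqOn (canonicalLift γ) (fun t => liftFactor γ t • γ t) I := fun t ht => by
  simp only [canonicalLift, liftFactor, hpar t ht, abs_of_neg (hγ.timelike t ht), one_div]

/-- In the conformal parameter the lift factor is |⟨γ', γ'⟩|^(-1/2). The scaling law then gives unit
speed, and the strain computed from Γ itself has no denominator left. -/
theorem isNormalizedLift_canonicalLift {I : Set ℝ} (hI : IsOpen I) {γ : ℝ → Vec}
    (hγ : IsTimelikeCurve I γ) (hpar : IsConformalParameter I γ) :
    IsNormalizedLift I (canonicalLift γ) := by
  have hG := canonicalLift_eqOn hγ hpar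
  have hnull : ∀ t ∈ I, sp (γ t) (γ t) = 0 := fun t ht =>
    sp_self_of_mem_einsteinUniverse (hγ.mem_universe t ht)
  have key := fun t (ht : t ∈ I) => strain_eq_of_lift hI hγ.smooth (contDiffOn_liftFactor hI hγ) hG
    (fun s hs => (liftFactor_pos hγ hs).ne') hnull ht (hγ.timelike t ht).ne rfl
  have hunit : ∀ t ∈ I, sp (deriv (canonicalLift γ) t) (deriv (canonicalLift γ) t) = -1 := by
    intro t ht
    have hp := neg_pos.2 (hγ.timelike t ht)
    rw [(key t ht).1, liftFactor, inv_pow, Real.sq_sqrt hp.le]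
    have := (hγ.timelike t ht).ne
    field_simp
  refine ⟨((contDiffOn_liftFactor hI hγ).smul hγ.smooth).congr hG, ?_, hunit, ?_⟩
  · intro t ht
    rw [hG ht, sp_smul_left, sp_smul_right, hnull t ht, mul_zero, mul_zero]
  · intro t ht
    have h2 := (key t ht).2
    rw [hunit t ht, abs_neg, abs_one, div_one] at h2
    rw [← h2]
    exact hpar t ht

namespace IsNormalizedLift

variable {I : Set ℝ} {Γ : ℝ → Vec}

theorem iteratedDeriv_four_eq (h : IsNormalizedLift I Γ) (hI : IsOpen I) {t : ℝ} (ht : t ∈ I) :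
    iteratedDeriv 4 Γ t = -(deriv (liftNormal Γ) t + deriv (deriv (liftCurvature Γ)) t • Γ t +
      (3 * deriv (liftCurvature Γ) t) • deriv Γ t +
      (2 * liftCurvature Γ t) • iteratedDeriv 2 Γ t) := by
  have hk := h.contDiffOn_liftCurvature hI
  have := iteratedDeriv_succ_eqOn hI (n := 3) (fun t _ => iteratedDeriv_three_eq Γ t)
    (fun s hs => (((h.hasDerivAt_normal hI hs).add
      ((hasDerivAt_of_contDiffOn hI (contDiffOn_deriv hI hk) hs).smul
        (h.hasDerivAt_zero hI hs))).add
      (((h.hasDerivAt_liftCurvature hI hs).const_mul 2).smul (h.hasDerivAt_one hI hs))).neg) ht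
  refine this.trans ?_
  module

end IsNormalizedLift

/-- Pairing a linear relation among the vectors with each of them isolates one coefficient, up to
sign. -/
theorem det_ne_zero_of_gram {b₀ b₁ b₂ b₃ b₄ b₅ : Vec} (h00 : sp b₀ b₀ = 0) (h01 : sp b₀ b₁ = 0)
    (h02 : sp b₀ b₂ = 0) (h03 : sp b₀ b₃ = 0) (h04 : sp b₀ b₄ = 0) (h05 : sp b₀ b₅ = -1)
    (h11 : sp b₁ b₁ = -1) (h12 : sp b₁ b₂ = 0) (h13 : sp b₁ b₃ = 0) (h14 : sp b₁ b₄ = 0)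
    (h15 : sp b₁ b₅ = 0) (h22 : sp b₂ b₂ = 1) (h23 : sp b₂ b₃ = 0) (h24 : sp b₂ b₄ = 0)
    (h25 : sp b₂ b₅ = 0) (h33 : sp b₃ b₃ = 1) (h34 : sp b₃ b₄ = 0) (h35 : sp b₃ b₅ = 0)
    (h44 : sp b₄ b₄ = 1) (h45 : sp b₄ b₅ = 0) (h55 : sp b₅ b₅ = 0) :
    Matrix.det (Matrix.of ![b₀, b₁, b₂, b₃, b₄, b₅]) ≠ 0 := by
  intro hdet
  obtain ⟨c, hc, hc0⟩ := Matrix.exists_vecMul_eq_zero_iff.2 hdet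
  have hsum : c 0 • b₀ + c 1 • b₁ + c 2 • b₂ + c 3 • b₃ + c 4 • b₄ + c 5 • b₅ = 0 := by
    ext j
    have := congrFun hc0 j
    simpa [Matrix.vecMul, dotProduct, Fin.sum_univ_six] using this
  have e := fun x => (congrArg (fun v => sp v x) hsum).trans (sp_zero_left x)
  simp only [sp_add_left, sp_smul_left] at e
  have e0 := e b₀
  have e1 := e b₁
  have e2 := e b₂
  have e3 := e b₃
  have e4 := e b₄
  have e5 := e b₅
  simp only [sp_comm b₁ b₀, sp_comm b₂ b₀, sp_comm b₃ b₀, sp_comm b₄ b₀, sp_comm b₅ b₀,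
    sp_comm b₂ b₁, sp_comm b₃ b₁, sp_comm b₄ b₁, sp_comm b₅ b₁, sp_comm b₃ b₂, sp_comm b₄ b₂,
    sp_comm b₅ b₂, sp_comm b₄ b₃, sp_comm b₅ b₃, sp_comm b₅ b₄, h00, h01, h02, h03, h04, h05,
    h11, h12, h13, h14, h15, h22, h23, h24, h25, h33, h34, h35, h44, h45, h55]
    at e0 e1 e2 e3 e4 e5
  apply hc
  ext i
  fin_cases i <;> simp <;> linarith

theorem det_neg_fourth (b₀ b₁ b₂ b₃ b₄ b₅ : Vec) :
    Matrix.det (Matrix.of ![b₀, b₁, b₂, b₃, -b₄, b₅]) =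
      -Matrix.det (Matrix.of ![b₀, b₁, b₂, b₃, b₄, b₅]) := by
  have hu : ∀ w : Vec, Matrix.of ![b₀, b₁, b₂, b₃, w, b₅] =
      Matrix.updateRow (Matrix.of ![b₀, b₁, b₂, b₃, 0, b₅]) 4 w := by
    intro w
    ext i j
    fin_cases i <;> rfl
  have := Matrix.det_updateRow_smul (Matrix.of ![b₀, b₁, b₂, b₃, 0, b₅]) 4 (-1) b₄
  rw [← neg_one_smul ℝ b₄, hu, this, ← hu, neg_one_mul]

/-- A smooth moving frame with conformal curvatures `k₁, k₂, k₃`. -/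
structure IsConformalFrame (I : Set ℝ) (B₀ B₁ B₂ B₃ B₄ B₅ : ℝ → Vec) (k₁ k₂ k₃ : ℝ → ℝ) :
    Prop where
  smooth_one : ContDiffOn ℝ ∞ k₁ I
  smooth_two : ContDiffOn ℝ ∞ k₂ I
  smooth_three : ContDiffOn ℝ ∞ k₃ I
  smooth : ∀ i, ContDiffOn ℝ ∞ (![B₀, B₁, B₂, B₃, B₄, B₅] i) I
  pos_two : ∀ t ∈ I, 0 < k₂ t
  pos_three : ∀ t ∈ I, 0 < k₃ t
  deriv_zero : ∀ t ∈ I, HasDerivAt B₀ (B₁ t) t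
  deriv_one : ∀ t ∈ I, HasDerivAt B₁ (-(k₁ t • B₀ t) - B₅ t) t
  deriv_two : ∀ t ∈ I, HasDerivAt B₂ (B₀ t + k₂ t • B₃ t) t
  deriv_three : ∀ t ∈ I, HasDerivAt B₃ (-(k₂ t • B₂ t) + k₃ t • B₄ t) t
  deriv_four : ∀ t ∈ I, HasDerivAt B₄ (-(k₃ t • B₃ t)) t
  deriv_five : ∀ t ∈ I, HasDerivAt B₅ (k₁ t • B₁ t + B₂ t) t
  zero_zero : ∀ t ∈ I, sp (B₀ t) (B₀ t) = 0
  zero_one : ∀ t ∈ I, sp (B₀ t) (B₁ t) = 0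
  zero_two : ∀ t ∈ I, sp (B₀ t) (B₂ t) = 0
  zero_three : ∀ t ∈ I, sp (B₀ t) (B₃ t) = 0
  zero_four : ∀ t ∈ I, sp (B₀ t) (B₄ t) = 0
  zero_five : ∀ t ∈ I, sp (B₀ t) (B₅ t) = -1
  one_one : ∀ t ∈ I, sp (B₁ t) (B₁ t) = -1
  one_two : ∀ t ∈ I, sp (B₁ t) (B₂ t) = 0
  one_three : ∀ t ∈ I, sp (B₁ t) (B₃ t) = 0
  one_four : ∀ t ∈ I, sp (B₁ t) (B₄ t) = 0
  one_five : ∀ t ∈ I, sp (B₁ t) (B₅ t) = 0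
  two_two : ∀ t ∈ I, sp (B₂ t) (B₂ t) = 1
  two_three : ∀ t ∈ I, sp (B₂ t) (B₃ t) = 0
  two_four : ∀ t ∈ I, sp (B₂ t) (B₄ t) = 0
  two_five : ∀ t ∈ I, sp (B₂ t) (B₅ t) = 0
  three_three : ∀ t ∈ I, sp (B₃ t) (B₃ t) = 1
  three_four : ∀ t ∈ I, sp (B₃ t) (B₄ t) = 0
  three_five : ∀ t ∈ I, sp (B₃ t) (B₅ t) = 0
  four_four : ∀ t ∈ I, sp (B₄ t) (B₄ t) = 1
  four_five : ∀ t ∈ I, sp (B₄ t) (B₅ t) = 0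
  five_five : ∀ t ∈ I, sp (B₅ t) (B₅ t) = 0

section Curve

variable {I : Set ℝ} {γ : ℝ → Vec}

theorem frame1_eqOn (h : IsNormalizedLift I (canonicalLift γ)) :
    Set.EqOn (frame1 γ) (deriv (canonicalLift γ)) I := fun t ht => by
  simp [frame1, h.unit_speed t ht]

theorem frame2_eqOn (h : IsNormalizedLift I (canonicalLift γ)) (hI : IsOpen I) :
    Set.EqOn (frame2 γ) (liftNormal (canonicalLift γ)) I := fun t ht => by
  simp [frame2, h.pr_two hI ht, sp_neg_left, sp_neg_right, h.sp_normal_self hI ht]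

theorem frame5_eqOn (h : IsNormalizedLift I (canonicalLift γ)) (hI : IsOpen I) :
    Set.EqOn (frame5 γ) (liftTransversal (canonicalLift γ)) I := fun t ht => by
  simp only [frame5, h.sp_zero_two hI ht, h.sp_one_two hI ht, IsNormalizedLift.sp_two_two,
    sp_comm (iteratedDeriv 2 (canonicalLift γ) t) (deriv (canonicalLift γ) t), liftTransversal]
  module

theorem sectionS_eqOn (h : IsNormalizedLift I (canonicalLift γ)) (hI : IsOpen I) :
    Set.EqOn (sectionS γ)
      (fun t => deriv (liftNormal (canonicalLift γ)) t - canonicalLift γ t) I := fun t ht => by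
  have := deriv_eqOn hI (frame2_eqOn h hI) (fun s hs => h.hasDerivAt_normal hI hs) ht
  simp only [sectionS, this, h.pr_three hI ht]

theorem curvature1_eqOn (h : IsNormalizedLift I (canonicalLift γ)) (hI : IsOpen I) :
    Set.EqOn (curvature1 γ) (liftCurvature (canonicalLift γ)) I := fun t ht => by
  have := deriv_eqOn hI (frame1_eqOn h) (fun s hs => h.hasDerivAt_one' hI hs) ht
  rw [curvature1, this, frame5_eqOn h hI ht, sp_sub_left, sp_neg_left, sp_smul_left,
    h.sp_zero_transversal hI ht, h.sp_transversal_self hI ht]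
  ring

theorem contDiffOn_sectionS (h : IsNormalizedLift I (canonicalLift γ)) (hI : IsOpen I) :
    ContDiffOn ℝ ∞ (sectionS γ) I :=
  ((contDiffOn_deriv hI (h.contDiffOn_liftNormal hI)).sub h.smooth).congr (sectionS_eqOn h hI)

theorem sectionS_pos (h : IsNormalizedLift I (canonicalLift γ)) (hI : IsOpen I) {t : ℝ}
    (ht : t ∈ I) (hS : sectionS γ t ≠ 0) : 0 < sp (sectionS γ t) (sectionS γ t) := by
  obtain ⟨s0, s1, -, s5⟩ := h.section_orthogonal hI ht
  rw [sectionS_eqOn h hI ht] at hS ⊢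
  exact h.sp_pos hI ht s0 s1 s5 hS

/-- The second curvature has no zero where the third one is positive. -/
theorem sectionS_ne_zero (h : IsNormalizedLift I (canonicalLift γ)) (hI : IsOpen I) {t : ℝ}
    (ht : t ∈ I) (h3 : 0 < curvature3 γ t) : sectionS γ t ≠ 0 := by
  intro hS
  -- Since 0⁻¹ = 0, the field `frame3` is zero where S is, and has unit length elsewhere. A positive
  -- k₃ needs a nonzero derivative, hence continuity at t; continuity forces the field to vanish
  -- near t, and then its derivative is zero.
  have hf : frame3 γ t = 0 := by simp [frame3, hS]
  have hd : deriv (frame3 γ) t ≠ 0 := fun h0 => by simp [curvature3, h0] at h3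
  have hcont : ContinuousAt (frame3 γ) t :=
    (differentiableAt_of_deriv_ne_zero hd).continuousAt
  have hsp : ContinuousAt (fun s => sp (frame3 γ s) (frame3 γ s)) t := by
    have hc := fun i => (continuousAt_pi.1 hcont) i
    simp only [sp]
    exact ((((((hc 0).mul (hc 5)).add ((hc 5).mul (hc 0))).neg.sub ((hc 1).mul (hc 1))).add
      ((hc 2).mul (hc 2))).add ((hc 3).mul (hc 3))).add ((hc 4).mul (hc 4))
  have hlt : ∀ᶠ s in nhds t, sp (frame3 γ s) (frame3 γ s) < 1 :=
    hsp.eventually_lt continuousAt_const (by simp [hf])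
  have hzero : frame3 γ =ᶠ[nhds t] fun _ => 0 := by
    filter_upwards [hlt, hI.mem_nhds ht] with s hs hsI
    by_contra hne
    have hSs : sectionS γ s ≠ 0 := fun h0 => hne (by simp [frame3, h0])
    have hp := sectionS_pos h hI hsI hSs
    rw [frame3, sp_smul_left, sp_smul_right, ← mul_assoc, ← mul_inv, Real.mul_self_sqrt hp.le,
      inv_mul_cancel₀ hp.ne'] at hs
    exact lt_irrefl _ hs
  exact hd (by rw [hzero.deriv_eq]; simp)

/-- When S does not vanish, B₀, B₁, B₂, B₃, B₅ arise from the 4-jet of Γ by an invertible triangular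
change, so the two families have the same orthogonal complement. -/
theorem orthogonal_osculatingSpace_four_iff (h : IsNormalizedLift I (canonicalLift γ))
    (hI : IsOpen I) {t : ℝ} (ht : t ∈ I) (hk : sectionS γ t ≠ 0) {w : Vec} :
    (∀ x ∈ osculatingSpace 4 (canonicalLift γ) t, sp x w = 0) ↔
      sp (canonicalLift γ t) w = 0 ∧ sp (deriv (canonicalLift γ) t) w = 0 ∧
      sp (liftNormal (canonicalLift γ) t) w = 0 ∧ sp (frame3 γ t) w = 0 ∧
      sp (liftTransversal (canonicalLift γ) t) w = 0 := by
  set Γ := canonicalLift γ with hΓ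
  have hne : √(sp (sectionS γ t) (sectionS γ t)) ≠ 0 :=
    (Real.sqrt_pos.2 (sectionS_pos h hI ht hk)).ne'
  have hS : sectionS γ t = deriv (liftNormal Γ) t - Γ t := sectionS_eqOn h hI ht
  constructor
  · intro hw
    have h0 := hw _ (iteratedDeriv_mem_osculatingSpace (k := 4) (j := 0) (by norm_num) Γ t)
    have h1 := hw _ (iteratedDeriv_mem_osculatingSpace (k := 4) (j := 1) (by norm_num) Γ t)
    have h2 := hw _ (iteratedDeriv_mem_osculatingSpace (k := 4) (j := 2) (by norm_num) Γ t)
    have h3 := hw _ (iteratedDeriv_mem_osculatingSpace (k := 4) (j := 3) (by norm_num) Γ t)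
    have h4 := hw _ (iteratedDeriv_mem_osculatingSpace (k := 4) (j := 4) (by norm_num) Γ t)
    rw [iteratedDeriv_zero] at h0
    rw [iteratedDeriv_one] at h1
    have h5 : sp (liftTransversal Γ t) w = 0 := by
      rw [liftTransversal, sp_sub_left, sp_neg_left, sp_smul_left, h0, h2]; ring
    have hN : sp (liftNormal Γ t) w = 0 := by
      rw [liftNormal, sp_neg_left, sp_add_left, sp_add_left, sp_smul_left, sp_smul_left, h0, h1,
        h3]
      ring
    refine ⟨h0, h1, hN, ?_, h5⟩
    rw [h.iteratedDeriv_four_eq hI ht, sp_neg_left, sp_add_left, sp_add_left, sp_add_left,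
      sp_smul_left, sp_smul_left, sp_smul_left, h0, h1, h2] at h4
    have hS' : sp (sectionS γ t) w = 0 := by rw [hS, sp_sub_left, h0]; linarith
    rw [frame3, sp_smul_left, hS', mul_zero]
  · rintro ⟨h0, h1, hN, h3, h5⟩ x hx
    have hS' : sp (sectionS γ t) w = 0 := by
      rw [frame3, sp_smul_left] at h3
      exact (mul_eq_zero.1 h3).resolve_left (inv_ne_zero hne)
    have hN' : sp (deriv (liftNormal Γ) t) w = 0 := by
      rw [hS, sp_sub_left, h0] at hS'
      linarith
    have h2 : sp (iteratedDeriv 2 Γ t) w = 0 := by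
      rw [IsNormalizedLift.iteratedDeriv_two_eq, sp_sub_left, sp_neg_left, sp_smul_left, h0, h5]
      ring
    refine sp_eq_zero_of_mem_osculatingSpace ?_ hx
    intro j hj
    interval_cases j
    · simpa using h0
    · simpa using h1
    · exact h2
    · rw [IsNormalizedLift.iteratedDeriv_three_eq, sp_neg_left, sp_add_left, sp_add_left,
        sp_smul_left, sp_smul_left, h0, h1, hN]
      ring
    · rw [h.iteratedDeriv_four_eq hI ht, sp_neg_left, sp_add_left, sp_add_left, sp_add_left,
        sp_smul_left, sp_smul_left, sp_smul_left, h0, h1, h2, hN']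
      ring

theorem frame3_orthogonal (h : IsNormalizedLift I (canonicalLift γ)) (hI : IsOpen I) {t : ℝ}
    (ht : t ∈ I) (hk : sectionS γ t ≠ 0) :
    sp (canonicalLift γ t) (frame3 γ t) = 0 ∧ sp (deriv (canonicalLift γ) t) (frame3 γ t) = 0 ∧
    sp (liftNormal (canonicalLift γ) t) (frame3 γ t) = 0 ∧ sp (frame3 γ t) (frame3 γ t) = 1 ∧
    sp (frame3 γ t) (liftTransversal (canonicalLift γ) t) = 0 := by
  obtain ⟨s0, s1, s2, s5⟩ := h.section_orthogonal hI ht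
  have hp := sectionS_pos h hI ht hk
  rw [sp_comm (frame3 γ t) (liftTransversal _ t)]
  refine ⟨?_, ?_, ?_, ?_, ?_⟩
  · rw [frame3, sp_smul_right, sectionS_eqOn h hI ht, s0, mul_zero]
  · rw [frame3, sp_smul_right, sectionS_eqOn h hI ht, s1, mul_zero]
  · rw [frame3, sp_smul_right, sectionS_eqOn h hI ht, s2, mul_zero]
  · rw [frame3, sp_smul_left, sp_smul_right, ← mul_assoc, ← mul_inv, Real.mul_self_sqrt hp.le,
      inv_mul_cancel₀ hp.ne']
  · rw [frame3, sp_smul_right, sectionS_eqOn h hI ht, s5, mul_zero]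

/-- The choice operator is meaningful only if a vector exists. Some nonzero vector is orthogonal to
the five others; it is space-like, so it can be normalized, and its sign is adjusted to make the
determinant positive. -/
theorem frame4_spec (h : IsNormalizedLift I (canonicalLift γ)) (hI : IsOpen I) {t : ℝ}
    (ht : t ∈ I) (hk : sectionS γ t ≠ 0) :
    (∀ x ∈ osculatingSpace 4 (canonicalLift γ) t, sp x (frame4 γ t) = 0) ∧
    sp (frame4 γ t) (frame4 γ t) = 1 ∧
    0 < Matrix.det (Matrix.of ![frame0 γ t, frame1 γ t, frame2 γ t, frame3 γ t, frame4 γ t,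
      frame5 γ t]) := by
  refine Classical.epsilon_spec (p := fun w : Vec =>
    (∀ x ∈ osculatingSpace 4 (canonicalLift γ) t, sp x w = 0) ∧ sp w w = 1 ∧
    0 < Matrix.det
      (Matrix.of ![frame0 γ t, frame1 γ t, frame2 γ t, frame3 γ t, w, frame5 γ t])) ?_
  rw [frame0, frame1_eqOn h ht, frame2_eqOn h hI ht, frame5_eqOn h hI ht]
  obtain ⟨f0, f1, f2, f3, f5⟩ := frame3_orthogonal h hI ht hk
  set Γ := canonicalLift γ with hΓ
  obtain ⟨v, hv0, hv⟩ := exists_orthogonal ![Γ t, deriv Γ t, liftNormal Γ t, frame3 γ t,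
    liftTransversal Γ t]
  have v0 : sp (Γ t) v = 0 := hv 0
  have v1 : sp (deriv Γ t) v = 0 := hv 1
  have v2 : sp (liftNormal Γ t) v = 0 := hv 2
  have v3 : sp (frame3 γ t) v = 0 := hv 3
  have v5 : sp (liftTransversal Γ t) v = 0 := hv 4
  have hvv := h.sp_pos hI ht v0 v1 v5 hv0
  set w : Vec := (√(sp v v))⁻¹ • v with hw
  have w0 : sp (Γ t) w = 0 := by rw [hw, sp_smul_right, v0, mul_zero]
  have w1 : sp (deriv Γ t) w = 0 := by rw [hw, sp_smul_right, v1, mul_zero]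
  have w2 : sp (liftNormal Γ t) w = 0 := by rw [hw, sp_smul_right, v2, mul_zero]
  have w3 : sp (frame3 γ t) w = 0 := by rw [hw, sp_smul_right, v3, mul_zero]
  have w5 : sp (liftTransversal Γ t) w = 0 := by rw [hw, sp_smul_right, v5, mul_zero]
  have ww : sp w w = 1 := by
    rw [hw, sp_smul_left, sp_smul_right, ← mul_assoc, ← mul_inv, Real.mul_self_sqrt hvv.le,
      inv_mul_cancel₀ hvv.ne']
  have hdet := det_ne_zero_of_gram (h.null t ht) (h.sp_zero_one hI ht) (h.sp_zero_normal hI ht)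
    f0 w0 (h.sp_zero_transversal hI ht) (h.unit_speed t ht) (h.sp_one_normal hI ht) f1 w1
    (h.sp_one_transversal hI ht) (h.sp_normal_self hI ht) f2 w2 (h.sp_normal_transversal hI ht)
    f3 w3 f5 ww (by rw [sp_comm]; exact w5) (h.sp_transversal_self hI ht)
  have horth := (orthogonal_osculatingSpace_four_iff h hI ht hk).2 ⟨w0, w1, w2, w3, w5⟩
  rcases lt_or_gt_of_ne hdet with hneg | hpos
  · refine ⟨-w, fun x hx => by rw [sp_neg_right, horth x hx, neg_zero], ?_, ?_⟩
    · rw [sp_neg_left, sp_neg_right, neg_neg, ww]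
    · rw [det_neg_fourth]
      exact neg_pos.2 hneg
  · exact ⟨w, horth, ww, hpos⟩

/-- Differentiating the constant scalar products gives every product of B₃' and B₄' with the frame,
and the frame is a basis. The other derivatives come directly from the definitions of the vectors
through Γ. -/
theorem isConformalFrame (hI : IsOpen I) (hγ : IsTimelikeCurve I γ)
    (hpar : IsConformalParameter I γ) (hhel : ∀ u ∈ I, 0 < curvature3 γ u) :
    IsConformalFrame I (canonicalLift γ) (deriv (canonicalLift γ)) (liftNormal (canonicalLift γ))
      (frame3 γ) (frame4 γ) (liftTransversal (canonicalLift γ)) (curvature1 γ) (curvature2 γ)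
      (curvature3 γ) := by
  have h := isNormalizedLift_canonicalLift hI hγ hpar
  have hk : ∀ t ∈ I, sectionS γ t ≠ 0 := fun t ht => sectionS_ne_zero h hI ht (hhel t ht)
  have hpS : ∀ t ∈ I, 0 < sp (sectionS γ t) (sectionS γ t) := fun t ht =>
    sectionS_pos h hI ht (hk t ht)
  have hS := contDiffOn_sectionS h hI
  have pos2 : ∀ t ∈ I, 0 < curvature2 γ t := fun t ht => Real.sqrt_pos.2 (hpS t ht)
  have smooth2 : ContDiffOn ℝ ∞ (curvature2 γ) I :=
    (contDiffOn_sp hS hS).sqrt fun t ht => (hpS t ht).ne'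
  have smooth1 : ContDiffOn ℝ ∞ (curvature1 γ) I :=
    (h.contDiffOn_liftCurvature hI).congr (curvature1_eqOn h hI)
  have smoothB3 : ContDiffOn ℝ ∞ (frame3 γ) I :=
    (smooth2.inv fun t ht => (pos2 t ht).ne').smul hS
  have f := fun t (ht : t ∈ I) => frame3_orthogonal h hI ht (hk t ht)
  have spec := fun t (ht : t ∈ I) => frame4_spec h hI ht (hk t ht)
  have w := fun t (ht : t ∈ I) => (orthogonal_osculatingSpace_four_iff h hI ht (hk t ht)).1
    (spec t ht).1
  have k1 := curvature1_eqOn h hI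
  set Γ := canonicalLift γ with hΓ
  have d0 : ∀ t ∈ I, HasDerivAt Γ (deriv Γ t) t := fun t ht => h.hasDerivAt_zero hI ht
  have d1 : ∀ t ∈ I, HasDerivAt (deriv Γ) (-(curvature1 γ t • Γ t) - liftTransversal Γ t) t :=
    fun t ht => by rw [k1 ht]; exact h.hasDerivAt_one' hI ht
  have d5 : ∀ t ∈ I, HasDerivAt (liftTransversal Γ) (curvature1 γ t • deriv Γ t + liftNormal Γ t)
      t := fun t ht => by rw [k1 ht]; exact h.hasDerivAt_transversal hI ht
  have d2 : ∀ t ∈ I, HasDerivAt (liftNormal Γ) (Γ t + curvature2 γ t • frame3 γ t) t := by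
    intro t ht
    refine (h.hasDerivAt_normal hI ht).congr_deriv ?_
    have h1 := sectionS_eqOn h hI ht
    have h2 : curvature2 γ t • frame3 γ t = sectionS γ t := by
      change √(sp (sectionS γ t) (sectionS γ t)) • (√(sp (sectionS γ t) (sectionS γ t)))⁻¹ •
        sectionS γ t = _
      rw [smul_smul, mul_inv_cancel₀ (Real.sqrt_pos.2 (hpS t ht)).ne', one_smul]
    rw [h2, h1]
    simp [hΓ]
  have d3' : ∀ t ∈ I, HasDerivAt (frame3 γ) (deriv (frame3 γ) t) t := fun t ht =>
    hasDerivAt_of_contDiffOn hI smoothB3 ht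
  have d3 : ∀ t ∈ I,
      deriv (frame3 γ) t = -(curvature2 γ t • liftNormal Γ t) + curvature3 γ t • frame4 γ t := by
    intro t ht
    obtain ⟨w0, w1, w2, w3, w5⟩ := w t ht
    obtain ⟨f0, f1, f2, f3, f5⟩ := f t ht
    have e0 := sp_deriv_add_eq_zero hI ht (fun s hs => (f s hs).1) (d0 t ht) (d3' t ht)
    have e1 := sp_deriv_add_eq_zero hI ht (fun s hs => (f s hs).2.1) (d1 t ht) (d3' t ht)
    have e2 := sp_deriv_add_eq_zero hI ht (fun s hs => (f s hs).2.2.1) (d2 t ht) (d3' t ht)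
    have e3 := sp_deriv_add_eq_zero hI ht (fun s hs => (f s hs).2.2.2.1) (d3' t ht) (d3' t ht)
    have e5 := sp_deriv_add_eq_zero hI ht (fun s hs => (f s hs).2.2.2.2) (d3' t ht) (d5 t ht)
    have hdet := (spec t ht).2.2.ne'
    have h4 : sp (frame4 γ t) (deriv (frame3 γ) t) = curvature3 γ t := by
      rw [curvature3, sp_comm]
    rw [frame0, frame1_eqOn h ht, frame2_eqOn h hI ht, frame5_eqOn h hI ht] at hdet
    -- Both sides are compared through their products with the six frame vectors.
    refine sub_eq_zero.1 (eq_zero_of_sp_eq_zero hdet ?_)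
    simp only [sp_sub_left, sp_neg_left, sp_add_left, sp_smul_left, sp_add_right, sp_smul_right,
      sp_comm (deriv (frame3 γ) t) (frame3 γ t),
      sp_comm (deriv (frame3 γ) t) (liftTransversal Γ t),
      sp_comm (liftTransversal Γ t) (frame3 γ t),
      sp_comm (frame3 γ t) (deriv Γ t), sp_comm (frame3 γ t) (liftNormal Γ t), f0, f1, f2, f3, f5]
      at e0 e1 e2 e3 e5
    intro i
    fin_cases i <;>
      simp only [Fin.isValue, Matrix.cons_val, Fin.reduceFinMk, Fin.zero_eta, Fin.mk_one,
        sp_sub_right, sp_add_right, sp_neg_right, sp_smul_right, ← hΓ]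
    · rw [h.sp_zero_normal hI ht, w0]; linarith
    · rw [h.sp_one_normal hI ht, w1]; linarith
    · rw [h.sp_normal_self hI ht, w2]; linarith
    · rw [sp_comm (frame3 γ t) (liftNormal Γ t), f2, w3]; linarith
    · rw [sp_comm (frame4 γ t) (liftNormal Γ t), w2, (spec t ht).2.1, h4]; ring
    · rw [sp_comm (liftTransversal Γ t) (liftNormal Γ t), h.sp_normal_transversal hI ht, w5]
      linarith
  -- B₄ is chosen pointwise, so its smoothness is not automatic. The vector B₃' + k₂B₂ = k₃B₄ is
  -- smooth and has length k₃ > 0; hence k₃, and then B₄, is smooth.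
  have hT : ContDiffOn ℝ ∞ (fun t => deriv (frame3 γ) t + curvature2 γ t • liftNormal Γ t) I :=
    (contDiffOn_deriv hI smoothB3).add (smooth2.smul (h.contDiffOn_liftNormal hI))
  have hT' : ∀ t ∈ I, deriv (frame3 γ) t + curvature2 γ t • liftNormal Γ t =
      curvature3 γ t • frame4 γ t := fun t ht => by rw [d3 t ht]; module
  have hk3 : ∀ t ∈ I, curvature3 γ t ^ 2 =
      sp (deriv (frame3 γ) t + curvature2 γ t • liftNormal Γ t)
        (deriv (frame3 γ) t + curvature2 γ t • liftNormal Γ t) := fun t ht => by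
    rw [hT' t ht, sp_smul_left, sp_smul_right, (spec t ht).2.1]; ring
  have smooth3 : ContDiffOn ℝ ∞ (curvature3 γ) I := by
    refine ((contDiffOn_sp hT hT).sqrt fun t ht => ?_).congr fun t ht => ?_
    · rw [← hk3 t ht]
      exact (pow_pos (hhel t ht) 2).ne'
    · rw [← hk3 t ht, Real.sqrt_sq (hhel t ht).le]
  have smoothB4 : ContDiffOn ℝ ∞ (frame4 γ) I := by
    refine ((smooth3.inv fun t ht => (hhel t ht).ne').smul hT).congr fun t ht => ?_
    rw [Pi.smul_apply', Pi.inv_apply, hT' t ht, smul_smul, inv_mul_cancel₀ (hhel t ht).ne',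
      one_smul]
  have d3'' : ∀ t ∈ I, HasDerivAt (frame3 γ)
      (-(curvature2 γ t • liftNormal Γ t) + curvature3 γ t • frame4 γ t) t := fun t ht => by
    rw [← d3 t ht]; exact d3' t ht
  have d4 : ∀ t ∈ I, HasDerivAt (frame4 γ) (-(curvature3 γ t • frame3 γ t)) t := by
    intro t ht
    have d4' := hasDerivAt_of_contDiffOn hI smoothB4 ht
    refine d4'.congr_deriv ?_
    obtain ⟨w0, w1, w2, w3, w5⟩ := w t ht
    obtain ⟨f0, f1, f2, f3, f5⟩ := f t ht
    have ww := (spec t ht).2.1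
    have e0 := sp_deriv_add_eq_zero hI ht (fun s hs => (w s hs).1) (d0 t ht) d4'
    have e1 := sp_deriv_add_eq_zero hI ht (fun s hs => (w s hs).2.1) (d1 t ht) d4'
    have e2 := sp_deriv_add_eq_zero hI ht (fun s hs => (w s hs).2.2.1) (d2 t ht) d4'
    have e3 := sp_deriv_add_eq_zero hI ht (fun s hs => (w s hs).2.2.2.1) (d3'' t ht) d4'
    have e5 := sp_deriv_add_eq_zero hI ht (fun s hs => (w s hs).2.2.2.2) (d5 t ht) d4'
    have e4 := sp_deriv_add_eq_zero hI ht (fun s hs => (spec s hs).2.1) d4' d4'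
    have hdet := (spec t ht).2.2.ne'
    rw [frame0, frame1_eqOn h ht, frame2_eqOn h hI ht, frame5_eqOn h hI ht] at hdet
    refine sub_eq_zero.1 (eq_zero_of_sp_eq_zero hdet ?_)
    simp only [sp_sub_left, sp_neg_left, sp_add_left, sp_smul_left, w0, w1, w2, w3, w5, ww,
      sp_comm (deriv (frame4 γ) t) (frame4 γ t)]
      at e0 e1 e2 e3 e5 e4
    intro i
    fin_cases i <;>
      simp only [Fin.isValue, Matrix.cons_val, Fin.reduceFinMk, Fin.zero_eta, Fin.mk_one,
        sp_sub_right, sp_neg_right, sp_smul_right, ← hΓ]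
    · rw [f0]; linarith
    · rw [f1]; linarith
    · rw [f2]; linarith
    · rw [f3]; linarith
    · rw [sp_comm (frame4 γ t) (frame3 γ t), w3]; linarith
    · rw [sp_comm (liftTransversal Γ t) (frame3 γ t), f5]; linarith
  refine
    { smooth_one := smooth1
      smooth_two := smooth2
      smooth_three := smooth3
      smooth := fun i => ?_
      pos_two := pos2
      pos_three := hhel
      deriv_zero := d0
      deriv_one := d1
      deriv_two := d2
      deriv_three := d3''
      deriv_four := d4
      deriv_five := d5
      zero_zero := h.null
      zero_one := fun t ht => h.sp_zero_one hI ht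
      zero_two := fun t ht => h.sp_zero_normal hI ht
      zero_three := fun t ht => (f t ht).1
      zero_four := fun t ht => (w t ht).1
      zero_five := fun t ht => h.sp_zero_transversal hI ht
      one_one := h.unit_speed
      one_two := fun t ht => h.sp_one_normal hI ht
      one_three := fun t ht => (f t ht).2.1
      one_four := fun t ht => (w t ht).2.1
      one_five := fun t ht => h.sp_one_transversal hI ht
      two_two := fun t ht => h.sp_normal_self hI ht
      two_three := fun t ht => (f t ht).2.2.1
      two_four := fun t ht => (w t ht).2.2.1
      two_five := fun t ht => h.sp_normal_transversal hI ht
      three_three := fun t ht => (f t ht).2.2.2.1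
      three_four := fun t ht => (w t ht).2.2.2.1
      three_five := fun t ht => (f t ht).2.2.2.2
      four_four := fun t ht => (spec t ht).2.1
      four_five := fun t ht => by rw [sp_comm]; exact (w t ht).2.2.2.2
      five_five := fun t ht => h.sp_transversal_self hI ht }
  fin_cases i
  · exact h.smooth
  · exact contDiffOn_deriv hI h.smooth
  · exact h.contDiffOn_liftNormal hI
  · exact smoothB3
  · exact smoothB4
  · exact h.contDiffOn_liftTransversal hI

end Curve

/-! ### Differentiation of integrals depending on a parameter -/

theorem exists_tube {O : Set (ℝ × ℝ)} (hO : IsOpen O) {a b : ℝ}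
    (h0 : ∀ t ∈ Set.Icc a b, (t, (0 : ℝ)) ∈ O) :
    ∃ ε > 0, ∀ t ∈ Set.Icc a b, ∀ τ ∈ Metric.closedBall (0 : ℝ) ε, (t, τ) ∈ O := by
  obtain ⟨u, v, hu, hv, hsu, hsv, huv⟩ := generalized_tube_lemma
    (isCompact_Icc : IsCompact (Set.Icc a b)) (isCompact_singleton : IsCompact {(0 : ℝ)}) hO
    (by rintro ⟨t, τ⟩ ⟨ht, hτ⟩; obtain rfl : τ = 0 := hτ; exact h0 t ht)
  obtain ⟨ε, hε, hball⟩ := Metric.nhds_basis_closedBall.mem_iff.1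
    (hv.mem_nhds (hsv (Set.mem_singleton 0)))
  exact ⟨ε, hε, fun t ht τ hτ => huv ⟨hsu ht, hball hτ⟩⟩

theorem hasDerivAt_prodMk_right (t τ : ℝ) : HasDerivAt (fun s : ℝ => (t, s)) ((0 : ℝ), (1 : ℝ)) τ :=
  (hasDerivAt_const τ t).prodMk (hasDerivAt_id τ)

/-- By compactness of [a, b] the open set contains a closed tube around τ = 0, on which the
τ-derivative is bounded; dominated convergence applies. -/
theorem hasDerivAt_integral_of_contDiffOn {O : Set (ℝ × ℝ)} (hO : IsOpen O) {F : ℝ × ℝ → ℝ}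
    (hF : ContDiffOn ℝ 1 F O) {a b : ℝ} (hab : a ≤ b)
    (h0 : ∀ t ∈ Set.Icc a b, (t, (0 : ℝ)) ∈ O) :
    HasDerivAt (fun τ => ∫ t in a..b, F (t, τ)) (∫ t in a..b, fderiv ℝ F (t, 0) (0, 1)) 0 := by
  obtain ⟨ε, hε, htube⟩ := exists_tube hO h0
  have hfd : ContinuousOn (fun p => fderiv ℝ F p (0, 1)) O :=
    (hF.continuousOn_fderiv_of_isOpen hO le_rfl).clm_apply continuousOn_const
  have hK : IsCompact (Set.Icc a b ×ˢ Metric.closedBall (0 : ℝ) ε) :=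
    isCompact_Icc.prod (isCompact_closedBall 0 ε)
  have hKO : Set.Icc a b ×ˢ Metric.closedBall (0 : ℝ) ε ⊆ O := fun p hp => htube p.1 hp.1 p.2 hp.2
  obtain ⟨C, hC⟩ := hK.exists_bound_of_continuousOn (hfd.mono hKO)
  have hslice : ∀ {f : ℝ × ℝ → ℝ}, ContinuousOn f O → ∀ τ ∈ Metric.closedBall (0 : ℝ) ε,
      ContinuousOn (fun t => f (t, τ)) (Set.Icc a b) := fun hf τ hτ =>
    hf.comp (by fun_prop) fun t ht => htube t ht τ hτ
  have hint : ∀ {f : ℝ × ℝ → ℝ}, ContinuousOn f O → ∀ τ ∈ Metric.closedBall (0 : ℝ) ε,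
      IntervalIntegrable (fun t => f (t, τ)) MeasureTheory.volume a b := fun hf τ hτ =>
    ContinuousOn.intervalIntegrable (by rw [Set.uIcc_of_le hab]; exact hslice hf τ hτ)
  have hmem : Set.uIoc a b ⊆ Set.Icc a b := by
    rw [Set.uIoc_of_le hab]; exact Set.Ioc_subset_Icc_self
  have h00 : (0 : ℝ) ∈ Metric.closedBall (0 : ℝ) ε := Metric.mem_closedBall_self hε.le
  refine (intervalIntegral.hasDerivAt_integral_of_dominated_loc_of_deriv_le
    (F := fun τ t => F (t, τ)) (F' := fun τ t => fderiv ℝ F (t, τ) (0, 1)) (bound := fun _ => C)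
    (Metric.closedBall_mem_nhds 0 hε) ?_ (hint hF.continuousOn 0 h00) ?_ ?_ (by simp) ?_).2
  · filter_upwards [Metric.closedBall_mem_nhds 0 hε] with τ hτ
    exact (intervalIntegrable_iff.1 (hint hF.continuousOn τ hτ)).aestronglyMeasurable
  · exact (intervalIntegrable_iff.1 (hint hfd 0 h00)).aestronglyMeasurable
  · exact Filter.Eventually.of_forall fun t ht τ hτ => hC (t, τ) ⟨hmem ht, hτ⟩
  · refine Filter.Eventually.of_forall fun t ht τ hτ => ?_
    have hd : DifferentiableAt ℝ F (t, τ) :=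
      (hF.differentiableOn (by simp)).differentiableAt (hO.mem_nhds (htube t (hmem ht) τ hτ))
    exact hd.hasFDerivAt.comp_hasDerivAt τ (hasDerivAt_prodMk_right t τ)

/-! ### Smooth dependence of the strain -/

/-- The coefficient of `g₂` in the projection of `g₃` to the span of `g₀, g₁, g₂`. -/
noncomputable def coeffTwo (g₀ g₁ g₃ : Vec) : ℝ := -(sp g₀ g₃ / sp g₁ g₁)

/-- The coefficient of `g₁` in the projection of `g₃` to the span of `g₀, g₁, g₂`. -/
noncomputable def coeffOne (g₀ g₁ g₂ g₃ : Vec) : ℝ :=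
  (sp g₁ g₃ - coeffTwo g₀ g₁ g₃ * sp g₁ g₂) / sp g₁ g₁

/-- The coefficient of `g₀` in the projection of `g₃` to the span of `g₀, g₁, g₂`. -/
noncomputable def coeffZero (g₀ g₁ g₂ g₃ : Vec) : ℝ :=
  (coeffOne g₀ g₁ g₂ g₃ * sp g₁ g₂ + coeffTwo g₀ g₁ g₃ * sp g₂ g₂ - sp g₂ g₃) / sp g₁ g₁

section Coefficients

variable {E : Type*} [NormedAddCommGroup E] [NormedSpace ℝ E] {n : WithTop ℕ∞}
  {g₀ g₁ g₂ g₃ : E → Vec} {s : Set E}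

theorem contDiffOn_coeffTwo (h0 : ContDiffOn ℝ n g₀ s) (h1 : ContDiffOn ℝ n g₁ s)
    (h3 : ContDiffOn ℝ n g₃ s) (hne : ∀ x ∈ s, sp (g₁ x) (g₁ x) ≠ 0) :
    ContDiffOn ℝ n (fun x => coeffTwo (g₀ x) (g₁ x) (g₃ x)) s :=
  ((contDiffOn_sp h0 h3).div (contDiffOn_sp h1 h1) hne).neg

theorem contDiffOn_coeffOne (h0 : ContDiffOn ℝ n g₀ s) (h1 : ContDiffOn ℝ n g₁ s)
    (h2 : ContDiffOn ℝ n g₂ s) (h3 : ContDiffOn ℝ n g₃ s)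
    (hne : ∀ x ∈ s, sp (g₁ x) (g₁ x) ≠ 0) :
    ContDiffOn ℝ n (fun x => coeffOne (g₀ x) (g₁ x) (g₂ x) (g₃ x)) s :=
  ((contDiffOn_sp h1 h3).sub ((contDiffOn_coeffTwo h0 h1 h3 hne).mul (contDiffOn_sp h1 h2))).div
    (contDiffOn_sp h1 h1) hne

theorem contDiffOn_coeffZero (h0 : ContDiffOn ℝ n g₀ s) (h1 : ContDiffOn ℝ n g₁ s)
    (h2 : ContDiffOn ℝ n g₂ s) (h3 : ContDiffOn ℝ n g₃ s)
    (hne : ∀ x ∈ s, sp (g₁ x) (g₁ x) ≠ 0) :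
    ContDiffOn ℝ n (fun x => coeffZero (g₀ x) (g₁ x) (g₂ x) (g₃ x)) s :=
  ((((contDiffOn_coeffOne h0 h1 h2 h3 hne).mul (contDiffOn_sp h1 h2)).add
    ((contDiffOn_coeffTwo h0 h1 h3 hne).mul (contDiffOn_sp h2 h2))).sub
      (contDiffOn_sp h2 h3)).div (contDiffOn_sp h1 h1) hne

theorem contDiffOn_residual (h0 : ContDiffOn ℝ n g₀ s) (h1 : ContDiffOn ℝ n g₁ s)
    (h2 : ContDiffOn ℝ n g₂ s) (h3 : ContDiffOn ℝ n g₃ s)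
    (hne : ∀ x ∈ s, sp (g₁ x) (g₁ x) ≠ 0) :
    ContDiffOn ℝ n (fun x => residual (g₀ x) (g₁ x) (g₂ x) (g₃ x)) s :=
  ((h3.sub ((contDiffOn_coeffZero h0 h1 h2 h3 hne).smul h0)).sub
    ((contDiffOn_coeffOne h0 h1 h2 h3 hne).smul h1)).sub
      ((contDiffOn_coeffTwo h0 h1 h3 hne).smul h2)

end Coefficients

/-- The `j`-th derivative along the curve of the family `X + τ Y + τ² Z`. -/
noncomputable def familyJet (X Y Z : ℝ → Vec) (j : ℕ) (p : ℝ × ℝ) : Vec :=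
  iteratedDeriv j X p.1 + p.2 • iteratedDeriv j Y p.1 + p.2 ^ 2 • iteratedDeriv j Z p.1

/-- The orthogonal part of the third derivative of the family `X + τ Y + τ² Z`. -/
noncomputable def familyResidual (X Y Z : ℝ → Vec) (p : ℝ × ℝ) : Vec :=
  residual (familyJet X Y Z 0 p) (familyJet X Y Z 1 p) (familyJet X Y Z 2 p)
    (familyJet X Y Z 3 p)

/-- The strain of the family `X + τ Y + τ² Z` of time-like null curves. -/
noncomputable def familyStrain (X Y Z : ℝ → Vec) (p : ℝ × ℝ) : ℝ :=
  sp (familyResidual X Y Z p) (familyResidual X Y Z p) /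
    -sp (familyJet X Y Z 1 p) (familyJet X Y Z 1 p)

/-- The parameters where the family `X + τ Y + τ² Z` is time-like. -/
def familyTimelike (I : Set ℝ) (X Y Z : ℝ → Vec) : Set (ℝ × ℝ) :=
  (I ×ˢ Set.univ) ∩ {p | sp (familyJet X Y Z 1 p) (familyJet X Y Z 1 p) < 0}

/-- The parameters where the family `X + τ Y + τ² Z` is time-like with positive strain. -/
def familyDomain (I : Set ℝ) (X Y Z : ℝ → Vec) : Set (ℝ × ℝ) :=
  familyTimelike I X Y Z ∩ {p | 0 < sp (familyResidual X Y Z p) (familyResidual X Y Z p)}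

section Family

variable {I : Set ℝ} {X Y Z : ℝ → Vec}

theorem contDiffOn_familyJet (hI : IsOpen I) (hX : ContDiffOn ℝ ∞ X I) (hY : ContDiffOn ℝ ∞ Y I)
    (hZ : ContDiffOn ℝ ∞ Z I) (j : ℕ) :
    ContDiffOn ℝ ∞ (familyJet X Y Z j) (I ×ˢ Set.univ) := by
  have hfst : ∀ {W : ℝ → Vec}, ContDiffOn ℝ ∞ W I →
      ContDiffOn ℝ ∞ (fun p : ℝ × ℝ => iteratedDeriv j W p.1) (I ×ˢ Set.univ) := fun hW =>
    (contDiffOn_iteratedDeriv hI hW j).comp contDiffOn_fst fun p hp => hp.1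
  exact ((hfst hX).add (contDiffOn_snd.smul (hfst hY))).add
    ((contDiffOn_snd.pow 2).smul (hfst hZ))

theorem iteratedDeriv_family (hI : IsOpen I) (hX : ContDiffOn ℝ ∞ X I) (hY : ContDiffOn ℝ ∞ Y I)
    (hZ : ContDiffOn ℝ ∞ Z I) (τ : ℝ) (j : ℕ) :
    Set.EqOn (iteratedDeriv j (fun t => X t + τ • Y t + τ ^ 2 • Z t))
      (fun t => familyJet X Y Z j (t, τ)) I := by
  induction j with
  | zero => intro t _; simp [familyJet]
  | succ j ih =>
    exact iteratedDeriv_succ_eqOn hI ih fun t ht =>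
      ((hasDerivAt_iteratedDeriv hI hX j ht).add
        ((hasDerivAt_iteratedDeriv hI hY j ht).const_smul τ)).add
          ((hasDerivAt_iteratedDeriv hI hZ j ht).const_smul (τ ^ 2))

theorem isOpen_familyTimelike (hI : IsOpen I) (hX : ContDiffOn ℝ ∞ X I)
    (hY : ContDiffOn ℝ ∞ Y I) (hZ : ContDiffOn ℝ ∞ Z I) : IsOpen (familyTimelike I X Y Z) :=
  (contDiffOn_sp (contDiffOn_familyJet hI hX hY hZ 1)
    (contDiffOn_familyJet hI hX hY hZ 1)).continuousOn.isOpen_inter_preimage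
      (hI.prod isOpen_univ) isOpen_Iio

theorem contDiffOn_familyResidual (hI : IsOpen I) (hX : ContDiffOn ℝ ∞ X I)
    (hY : ContDiffOn ℝ ∞ Y I) (hZ : ContDiffOn ℝ ∞ Z I) :
    ContDiffOn ℝ ∞ (familyResidual X Y Z) (familyTimelike I X Y Z) := by
  have hj := fun j => (contDiffOn_familyJet hI hX hY hZ j).mono
    (Set.inter_subset_left : familyTimelike I X Y Z ⊆ _)
  exact contDiffOn_residual (hj 0) (hj 1) (hj 2) (hj 3) fun p hp => hp.2.ne

theorem isOpen_familyDomain (hI : IsOpen I) (hX : ContDiffOn ℝ ∞ X I)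
    (hY : ContDiffOn ℝ ∞ Y I) (hZ : ContDiffOn ℝ ∞ Z I) : IsOpen (familyDomain I X Y Z) :=
  (contDiffOn_sp (contDiffOn_familyResidual hI hX hY hZ)
    (contDiffOn_familyResidual hI hX hY hZ)).continuousOn.isOpen_inter_preimage
      (isOpen_familyTimelike hI hX hY hZ) isOpen_Ioi

theorem contDiffOn_familyStrain (hI : IsOpen I) (hX : ContDiffOn ℝ ∞ X I)
    (hY : ContDiffOn ℝ ∞ Y I) (hZ : ContDiffOn ℝ ∞ Z I) :
    ContDiffOn ℝ ∞ (familyStrain X Y Z) (familyTimelike I X Y Z) := by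
  have hR := contDiffOn_familyResidual hI hX hY hZ
  have hj := (contDiffOn_familyJet hI hX hY hZ 1).mono
    (Set.inter_subset_left : familyTimelike I X Y Z ⊆ _)
  exact (contDiffOn_sp hR hR).div (contDiffOn_sp hj hj).neg fun p hp => (neg_pos.2 hp.2).ne'

theorem familyStrain_pos {p : ℝ × ℝ} (hp : p ∈ familyDomain I X Y Z) : 0 < familyStrain X Y Z p :=
  div_pos hp.2 (neg_pos.2 hp.1.2)

/-- The fourth root is smooth only away from zero, hence the restriction to positive strain. -/
theorem contDiffOn_familyDensity (hI : IsOpen I) (hX : ContDiffOn ℝ ∞ X I)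
    (hY : ContDiffOn ℝ ∞ Y I) (hZ : ContDiffOn ℝ ∞ Z I) :
    ContDiffOn ℝ ∞ (fun p => familyStrain X Y Z p ^ (1 / 4 : ℝ)) (familyDomain I X Y Z) :=
  ((contDiffOn_familyStrain hI hX hY hZ).mono Set.inter_subset_left).rpow_const_of_ne
    fun _ hp => (familyStrain_pos hp).ne'

theorem familyJet_zero_right (X Y Z : ℝ → Vec) (j : ℕ) (t : ℝ) :
    familyJet X Y Z j (t, 0) = iteratedDeriv j X t := by
  simp [familyJet]

/-- The correction Z enters with τ² and leaves no trace at first order. -/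
theorem hasDerivAt_familyJet (X Y Z : ℝ → Vec) (j : ℕ) (t : ℝ) :
    HasDerivAt (fun τ => familyJet X Y Z j (t, τ)) (iteratedDeriv j Y t) 0 := by
  have := (((hasDerivAt_id (0 : ℝ)).smul_const (iteratedDeriv j Y t)).const_add
    (iteratedDeriv j X t)).add (((hasDerivAt_id (0 : ℝ)).pow 2).smul_const (iteratedDeriv j Z t))
  exact this.congr_deriv (by simp)

theorem mem_familyDomain (h : IsNormalizedLift I X) (hI : IsOpen I) {t : ℝ} (ht : t ∈ I) :
    (t, (0 : ℝ)) ∈ familyDomain I X Y Z := by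
  refine ⟨⟨⟨ht, trivial⟩, ?_⟩, ?_⟩
  · simp only [Set.mem_ofPred_eq, familyJet_zero_right, iteratedDeriv_one, h.unit_speed t ht]
    norm_num
  · simp only [Set.mem_ofPred_eq, familyResidual, familyJet_zero_right, iteratedDeriv_one,
      iteratedDeriv_zero, h.residual_eq hI ht, sp_neg_left, sp_neg_right, neg_neg,
      h.sp_normal_self hI ht]
    norm_num

/-- The derivative of the strain density at a curve in its conformal parameter. -/
theorem fderiv_familyDensity (h : IsNormalizedLift I X) (hI : IsOpen I)
    (hY : ContDiffOn ℝ ∞ Y I) (hZ : ContDiffOn ℝ ∞ Z I) {t : ℝ} (ht : t ∈ I) :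
    fderiv ℝ (fun p => familyStrain X Y Z p ^ (1 / 4 : ℝ)) (t, 0) (0, 1) =
      1 / 2 * (-sp (liftNormal X t) (iteratedDeriv 3 Y t + deriv (liftCurvature X) t • Y t +
        (2 * liftCurvature X t) • deriv Y t) + sp (deriv X t) (deriv Y t)) := by
  have hX := h.smooth
  have hmem := mem_familyDomain (Y := Y) (Z := Z) h hI ht
  have hO := isOpen_familyDomain hI hX hY hZ
  have hO1 := isOpen_familyTimelike hI hX hY hZ
  have hL := hasDerivAt_prodMk_right t 0
  have hj := fun j => (contDiffOn_familyJet hI hX hY hZ j).mono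
    (Set.inter_subset_left : familyTimelike I X Y Z ⊆ _)
  have hslice : ∀ {f : ℝ × ℝ → ℝ}, ContDiffOn ℝ ∞ f (familyTimelike I X Y Z) →
      HasDerivAt (fun τ => f (t, τ)) (fderiv ℝ f (t, 0) (0, 1)) 0 := fun hf =>
    ((hf.differentiableOn (by simp)).differentiableAt
      (hO1.mem_nhds hmem.1)).hasFDerivAt.comp_hasDerivAt 0 hL
  have hne : ∀ p ∈ familyTimelike I X Y Z,
      sp (familyJet X Y Z 1 p) (familyJet X Y Z 1 p) ≠ 0 := fun p hp => hp.2.ne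
  -- The derivatives of the three coefficients are never computed: they multiply X, X', X'', which
  -- are orthogonal to B₂, and only the product with B₂ enters the derivative of the strain.
  obtain ⟨A₀, a0⟩ : ∃ A, HasDerivAt _ A 0 :=
    ⟨_, hslice (contDiffOn_coeffZero (hj 0) (hj 1) (hj 2) (hj 3) hne)⟩
  obtain ⟨A₁, a1⟩ : ∃ A, HasDerivAt _ A 0 :=
    ⟨_, hslice (contDiffOn_coeffOne (hj 0) (hj 1) (hj 2) (hj 3) hne)⟩
  obtain ⟨A₂, a2⟩ : ∃ A, HasDerivAt _ A 0 :=
    ⟨_, hslice (contDiffOn_coeffTwo (hj 0) (hj 1) (hj 3) hne)⟩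
  have g := fun j => hasDerivAt_familyJet X Y Z j t
  have e0 : coeffZero (X t) (deriv X t) (iteratedDeriv 2 X t) (iteratedDeriv 3 X t) =
      -deriv (liftCurvature X) t := by
    simp only [coeffZero, coeffOne, coeffTwo, h.sp_zero_three hI ht, h.sp_one_three hI ht,
      h.sp_two_three hI ht, h.sp_one_two hI ht, h.unit_speed t ht]
    ring
  have e1 : coeffOne (X t) (deriv X t) (iteratedDeriv 2 X t) (iteratedDeriv 3 X t) =
      -(2 * liftCurvature X t) := by
    simp only [coeffOne, coeffTwo, h.sp_zero_three hI ht, h.sp_one_three hI ht,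
      h.sp_one_two hI ht, h.unit_speed t ht]
    ring
  have e2 : coeffTwo (X t) (deriv X t) (iteratedDeriv 3 X t) = 0 := by
    simp [coeffTwo, h.sp_zero_three hI ht]
  set V : Vec := iteratedDeriv 3 Y t + deriv (liftCurvature X) t • Y t +
    (2 * liftCurvature X t) • deriv Y t with hV
  have hR : HasDerivAt (fun τ => familyResidual X Y Z (t, τ))
      (V - A₀ • X t - A₁ • deriv X t - A₂ • iteratedDeriv 2 X t) 0 := by
    refine ((((g 3).sub (a0.smul (g 0))).sub (a1.smul (g 1))).sub (a2.smul (g 2))).congr_deriv ?_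
    simp only [familyJet_zero_right, iteratedDeriv_one, iteratedDeriv_zero, e0, e1, e2]
    module
  have hN := hasDerivAt_sp hR hR
  have hA : HasDerivAt (fun τ => -sp (familyJet X Y Z 1 (t, τ)) (familyJet X Y Z 1 (t, τ))) _ 0 :=
    (hasDerivAt_sp (g 1) (g 1)).neg
  have hval : familyResidual X Y Z (t, 0) = -liftNormal X t := by
    simp only [familyResidual, familyJet_zero_right, iteratedDeriv_one, iteratedDeriv_zero,
      h.residual_eq hI ht]
  have hone : sp (familyJet X Y Z 1 (t, 0)) (familyJet X Y Z 1 (t, 0)) = -1 := by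
    simp only [familyJet_zero_right, iteratedDeriv_one, h.unit_speed t ht]
  have hN1 := h.sp_normal_self hI ht
  have hS : HasDerivAt (fun τ => familyStrain X Y Z (t, τ))
      (2 * (-sp (liftNormal X t) V + sp (deriv X t) (deriv Y t))) 0 := by
    refine (hN.div hA (by rw [hone]; norm_num)).congr_deriv ?_
    rw [hone, hval]
    simp only [sp_neg_left, sp_neg_right, sp_sub_left, sp_sub_right, sp_smul_left, sp_smul_right,
      hN1, sp_comm V (liftNormal X t), sp_comm (liftNormal X t) (X t),
      sp_comm (liftNormal X t) (deriv X t), sp_comm (liftNormal X t) (iteratedDeriv 2 X t),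
      h.sp_zero_normal hI ht, h.sp_one_normal hI ht, h.sp_two_normal hI ht, familyJet_zero_right,
      iteratedDeriv_one, sp_comm (deriv Y t) (deriv X t)]
    ring
  have hS1 : familyStrain X Y Z (t, 0) = 1 := by
    rw [familyStrain, hval, hone, sp_neg_left, sp_neg_right, neg_neg, hN1]
    norm_num
  have hU := hS.rpow_const (p := 1 / 4) (Or.inl (by rw [hS1]; exact one_ne_zero))
  have hfd : HasDerivAt (fun τ => familyStrain X Y Z (t, τ) ^ (1 / 4 : ℝ)) _ 0 :=
    (((contDiffOn_familyDensity hI hX hY hZ).differentiableOn (by simp)).differentiableAt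
      (hO.mem_nhds hmem)).hasFDerivAt.comp_hasDerivAt 0 hL
  rw [hfd.unique hU, hS1, Real.one_rpow]
  ring

end Family

/-! ### Normalization of isotropic vectors -/

/-- The length of an isotropic vector relative to the Einstein universe. -/
noncomputable def universeNorm (y : Vec) : ℝ := √((y 0 + y 5) ^ 2 / 2 + y 1 ^ 2)

/-- An isotropic vector whose two negative coordinates vanish lies in a positive definite subspace,
so it is zero. -/
theorem universeNorm_radicand_pos {y : Vec} (hy : sp y y = 0) (hy0 : y ≠ 0) :
    0 < (y 0 + y 5) ^ 2 / 2 + y 1 ^ 2 := by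
  have hnn : 0 ≤ (y 0 + y 5) ^ 2 / 2 + y 1 ^ 2 := by positivity
  refine lt_of_le_of_ne hnn fun h0 => hy0 ?_
  have h1 : y 1 = 0 := by
    by_contra h
    nlinarith [sq_pos_of_ne_zero h, sq_nonneg (y 0 + y 5)]
  have h05 : y 5 = -y 0 := by
    rw [h1] at h0
    nlinarith [sq_nonneg (y 0 + y 5), pow_eq_zero_iff (two_ne_zero) |>.1
      (show (y 0 + y 5) ^ 2 = 0 by linarith)]
  have hs : 2 * y 0 ^ 2 + y 2 ^ 2 + y 3 ^ 2 + y 4 ^ 2 = 0 := by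
    rw [← hy]; simp only [sp, h1, h05]; ring
  have h2 : y 0 ^ 2 = 0 := by
    nlinarith [sq_nonneg (y 0), sq_nonneg (y 2), sq_nonneg (y 3), sq_nonneg (y 4)]
  have h3 : y 2 ^ 2 = 0 := by
    nlinarith [sq_nonneg (y 0), sq_nonneg (y 2), sq_nonneg (y 3), sq_nonneg (y 4)]
  have h4 : y 3 ^ 2 = 0 := by
    nlinarith [sq_nonneg (y 0), sq_nonneg (y 2), sq_nonneg (y 3), sq_nonneg (y 4)]
  have h5 : y 4 ^ 2 = 0 := by
    nlinarith [sq_nonneg (y 0), sq_nonneg (y 2), sq_nonneg (y 3), sq_nonneg (y 4)]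
  simp only [ne_eq, OfNat.ofNat_ne_zero, not_false_eq_true, pow_eq_zero_iff] at h2 h3 h4 h5
  ext i
  fin_cases i <;> simp [h1, h2, h3, h4, h5, h05]

theorem universeNorm_pos {y : Vec} (hy : sp y y = 0) (hy0 : y ≠ 0) : 0 < universeNorm y :=
  Real.sqrt_pos.2 (universeNorm_radicand_pos hy hy0)

/-- Isotropy says that the left sides of the two defining equations of the universe are equal, so
one scaling factor serves both. -/
theorem normalize_mem_einsteinUniverse {y : Vec} (hy : sp y y = 0) (hy0 : y ≠ 0) :
    (universeNorm y)⁻¹ • y ∈ einsteinUniverse := by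
  have hp := universeNorm_pos hy hy0
  have hsq : universeNorm y ^ 2 = (y 0 + y 5) ^ 2 / 2 + y 1 ^ 2 :=
    Real.sq_sqrt (universeNorm_radicand_pos hy hy0).le
  have hsq' : universeNorm y ^ 2 = y 2 ^ 2 + y 3 ^ 2 + y 4 ^ 2 + (y 0 - y 5) ^ 2 / 2 := by
    simp only [sp] at hy
    rw [hsq]
    linarith
  constructor
  · simp only [Pi.smul_apply, smul_eq_mul]
    field_simp
    linarith
  · simp only [Pi.smul_apply, smul_eq_mul]
    field_simp
    linarith

theorem universeNorm_smul_of_mem {y : Vec} (hy : y ∈ einsteinUniverse) {r : ℝ} (hr : 0 < r) :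
    universeNorm (r • y) = r := by
  have : ((r • y) 0 + (r • y) 5) ^ 2 / 2 + (r • y) 1 ^ 2 = r ^ 2 := by
    simp only [Pi.smul_apply, smul_eq_mul]
    linear_combination r ^ 2 * hy.1
  rw [universeNorm, this, Real.sqrt_sq hr.le]

theorem contDiffOn_universeNorm {E : Type*} [NormedAddCommGroup E] [NormedSpace ℝ E]
    {n : WithTop ℕ∞} {v : E → Vec} {s : Set E} (hv : ContDiffOn ℝ n v s)
    (h0 : ∀ x ∈ s, sp (v x) (v x) = 0) (hne : ∀ x ∈ s, v x ≠ 0) :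
    ContDiffOn ℝ n (fun x => universeNorm (v x)) s := by
  have hc := contDiffOn_pi.1 hv
  exact (((((hc 0).add (hc 5)).pow 2).div_const 2).add ((hc 1).pow 2)).sqrt fun x hx =>
    (universeNorm_radicand_pos (h0 x hx) (hne x hx)).ne'

/-! ### The first variation of the total strain -/

section Variation

variable {I : Set ℝ} {γ : ℝ → Vec}

/-- The coefficient of B is chosen so that its product with X, which equals -1 for X and B alone,
cancels the term τ²c²⟨W, W⟩; no higher terms arise because B is isotropic and orthogonal to W. -/
theorem null_quadratic_family (X W B : Vec) (h00 : sp X X = 0) (h0w : sp X W = 0)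
    (h05 : sp X B = -1) (hw5 : sp W B = 0) (h55 : sp B B = 0) (c τ : ℝ) :
    sp (X + τ • c • W + τ ^ 2 • (1 / 2 * c ^ 2 * sp W W) • B)
      (X + τ • c • W + τ ^ 2 • (1 / 2 * c ^ 2 * sp W W) • B) = 0 := by
  simp only [sp_add_left, sp_add_right, sp_smul_left, sp_smul_right, sp_comm W X, sp_comm B X,
    sp_comm B W, h00, h0w, h05, hw5, h55]
  ring

/-- The strain of the normalization of a curve of isotropic vectors. -/
theorem strain_normalize (hI : IsOpen I) {G : ℝ → Vec} (hG : ContDiffOn ℝ ∞ G I)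
    (hnull : ∀ s ∈ I, sp (G s) (G s) = 0) (hne : ∀ s ∈ I, G s ≠ 0) {t : ℝ} (ht : t ∈ I)
    (hlt : sp (deriv G t) (deriv G t) < 0) :
    strain (fun s => (universeNorm (G s))⁻¹ • G s) t =
      sp (residual (G t) (deriv G t) (iteratedDeriv 2 G t) (iteratedDeriv 3 G t))
        (residual (G t) (deriv G t) (iteratedDeriv 2 G t) (iteratedDeriv 3 G t)) /
          -sp (deriv G t) (deriv G t) := by
  set g : ℝ → Vec := fun s => (universeNorm (G s))⁻¹ • G s with hg
  have hρ : ContDiffOn ℝ ∞ (fun s => universeNorm (G s)) I := contDiffOn_universeNorm hG hnull hne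
  have hρ0 : ∀ s ∈ I, universeNorm (G s) ≠ 0 := fun s hs =>
    (universeNorm_pos (hnull s hs) (hne s hs)).ne'
  have hgs : ContDiffOn ℝ ∞ g I := (hρ.inv hρ0).smul hG
  have hgnull : ∀ s ∈ I, sp (g s) (g s) = 0 := fun s hs => by
    simp only [hg, sp_smul_left, sp_smul_right, hnull s hs, mul_zero]
  have hback := (strain_eq_of_lift hI hG (hρ.inv hρ0) (G := g)
    (fun s _ => rfl) (fun s hs => inv_ne_zero (hρ0 s hs)) hnull ht hlt.ne rfl).1
  have hgne : sp (deriv g t) (deriv g t) ≠ 0 := by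
    rw [hback]
    exact mul_ne_zero (pow_ne_zero 2 (inv_ne_zero (hρ0 t ht))) hlt.ne
  have hGg : Set.EqOn G (fun s => universeNorm (G s) • g s) I := fun s hs => by
    simp only [hg, smul_smul]
    rw [mul_inv_cancel₀ (hρ0 s hs), one_smul]
  rw [(strain_eq_of_lift hI hgs hρ hGg hρ0 hgnull ht hgne rfl).2, abs_of_neg hlt]

/-- The normalized null family is an admissible variation. Near τ = 0 its total strain is the
integral of a smooth density, so the vanishing derivative can be computed under the integral sign.
-/
theorem integral_firstVariation_eq_zero (hI : IsOpen I) (hγ : IsConformalWorldLine I γ)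
    (hpar : IsConformalParameter I γ) {a b : ℝ} (hab : a ≤ b) (hsub : Set.Icc a b ⊆ I)
    {w : ℝ → Vec} (hw : ContDiffOn ℝ ∞ w I) (hw0 : ∀ t ∈ I, sp (canonicalLift γ t) (w t) = 0)
    (hw5 : ∀ t ∈ I, sp (w t) (liftTransversal (canonicalLift γ) t) = 0) {f : ℝ → ℝ}
    (hf : ContDiff ℝ ∞ f) (hsupp : tsupport f ⊆ Set.Icc a b) {Y : ℝ → Vec}
    (hYdef : Y = fun t => f t • w t) :
    ∫ t in a..b, (-sp (liftNormal (canonicalLift γ) t) (iteratedDeriv 3 Y t +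
      deriv (liftCurvature (canonicalLift γ)) t • Y t +
        (2 * liftCurvature (canonicalLift γ) t) • deriv Y t) +
          sp (deriv (canonicalLift γ) t) (deriv Y t)) = 0 := by
  have h := isNormalizedLift_canonicalLift hI hγ.timelike hpar
  have hlift := canonicalLift_eqOn hγ.timelike hpar
  set X := canonicalLift γ with hXdef
  set Z : ℝ → Vec := fun t => (1 / 2 * f t ^ 2 * sp (w t) (w t)) • liftTransversal X t with hZdef
  have hX := h.smooth
  have hY : ContDiffOn ℝ ∞ Y I := hYdef ▸ hf.contDiffOn.smul hw
  have hZ : ContDiffOn ℝ ∞ Z I := ((contDiffOn_const.mul (hf.contDiffOn.pow 2)).mul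
    (contDiffOn_sp hw hw)).smul (h.contDiffOn_liftTransversal hI)
  set G : ℝ → ℝ → Vec := fun t τ => X t + τ • Y t + τ ^ 2 • Z t with hG
  have hGnull : ∀ t ∈ I, ∀ τ, sp (G t τ) (G t τ) = 0 := fun t ht τ => by
    simp only [hG, hYdef, hZdef]
    exact null_quadratic_family _ _ _ (h.null t ht) (hw0 t ht) (h.sp_zero_transversal hI ht)
      (hw5 t ht) (h.sp_transversal_self hI ht) _ _
  -- The product with B₅ stays equal to -1 along the family, so the family avoids the origin and can
  -- be normalized.
  have hGne : ∀ t ∈ I, ∀ τ, G t τ ≠ 0 := fun t ht τ h0 => by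
    have h1 : sp (G t τ) (liftTransversal X t) = -1 := by
      simp only [hG, hYdef, hZdef, sp_add_left, sp_smul_left, h.sp_zero_transversal hI ht,
        hw5 t ht, h.sp_transversal_self hI ht]
      ring
    rw [h0, sp_zero_left] at h1
    norm_num at h1
  have hGsmooth : ContDiffOn ℝ ∞ (fun p : ℝ × ℝ => G p.1 p.2) (I ×ˢ Set.univ) := by
    refine (contDiffOn_familyJet hI hX hY hZ 0).congr fun p _ => ?_
    simp [familyJet, hG]
  set g : ℝ → ℝ → Vec := fun t τ => (universeNorm (G t τ))⁻¹ • G t τ with hg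
  have hgsmooth : ContDiffOn ℝ ∞ (fun p : ℝ × ℝ => g p.1 p.2) (I ×ˢ Set.univ) :=
    ((contDiffOn_universeNorm hGsmooth (fun p hp => hGnull p.1 hp.1 p.2)
      fun p hp => hGne p.1 hp.1 p.2).inv fun p hp =>
        (universeNorm_pos (hGnull p.1 hp.1 p.2) (hGne p.1 hp.1 p.2)).ne').smul hGsmooth
  have hgX : ∀ t ∈ I, (universeNorm (X t))⁻¹ • X t = γ t := fun t ht => by
    have hr := liftFactor_pos hγ.timelike ht
    rw [hlift ht, universeNorm_smul_of_mem (hγ.timelike.mem_universe t ht) hr, smul_smul,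
      inv_mul_cancel₀ hr.ne', one_smul]
  have hvar : IsVariation I γ a b 1 g := by
    refine ⟨hgsmooth.mono (Set.prod_mono le_rfl (Set.subset_univ _)), ?_, ?_, ?_⟩
    · exact fun t ht τ _ => normalize_mem_einsteinUniverse (hGnull t ht τ) (hGne t ht τ)
    · intro t ht
      simpa [hg, hG] using hgX t ht
    -- Where f vanishes, so do Y and Z, and the normalization of Γ is γ.
    · refine (closure_minimal ?_ (isClosed_tsupport f)).trans hsupp
      rintro t ⟨ht, τ, -, hne⟩
      refine subset_tsupport f fun h0 => hne ?_
      simpa [hg, hG, hYdef, hZdef, h0] using hgX t ht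
  have hO := isOpen_familyDomain hI hX hY hZ
  have hmem : ∀ t ∈ Set.Icc a b, (t, (0 : ℝ)) ∈ familyDomain I X Y Z := fun t ht =>
    mem_familyDomain h hI (hsub ht)
  have hderiv := hasDerivAt_integral_of_contDiffOn hO
    ((contDiffOn_familyDensity hI hX hY hZ).of_le (by simp)) hab hmem
  obtain ⟨ε, hε, htube⟩ := exists_tube hO hmem
  have hdens : ∀ τ ∈ Metric.closedBall (0 : ℝ) ε, ∀ t ∈ Set.Icc a b,
      strainDensity (fun s => g s τ) t = familyStrain X Y Z (t, τ) ^ (1 / 4 : ℝ) := by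
    intro τ hτ t ht
    have htI := hsub ht
    obtain ⟨⟨-, hlt⟩, -⟩ := htube t ht τ hτ
    have hj0 : G t τ = _ := iteratedDeriv_family hI hX hY hZ τ 0 htI
    have hj1 := iteratedDeriv_family hI hX hY hZ τ 1 htI
    have hj2 := iteratedDeriv_family hI hX hY hZ τ 2 htI
    have hj3 := iteratedDeriv_family hI hX hY hZ τ 3 htI
    rw [iteratedDeriv_one] at hj1
    have hGτ : ContDiffOn ℝ ∞ (fun s => G s τ) I :=
      (hX.add (hY.const_smul τ)).add (hZ.const_smul (τ ^ 2))
    have hlt' : sp (deriv (fun s => G s τ) t) (deriv (fun s => G s τ) t) < 0 := by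
      rw [hj1]; exact hlt
    rw [strainDensity, strain_normalize hI hGτ (fun s hs => hGnull s hs τ)
      (fun s hs => hGne s hs τ) htI hlt', familyStrain, familyResidual]
    rw [hj0, hj1, hj2, hj3]
  have hst := hγ.stationary a b hab hsub 1 one_pos g hvar
  -- The formula is needed only inside the tube, where the family stays time-like with positive
  -- strain.
  have heq : (fun τ => totalStrain a b (fun t => g t τ)) =ᶠ[nhds 0]
      fun τ => ∫ t in a..b, familyStrain X Y Z (t, τ) ^ (1 / 4 : ℝ) := by
    filter_upwards [Metric.closedBall_mem_nhds (0 : ℝ) hε] with τ hτ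
    refine intervalIntegral.integral_congr fun t ht => ?_
    rw [Set.uIcc_of_le hab] at ht
    exact hdens τ hτ t ht
  have hzero := (hst.congr_of_eventuallyEq heq.symm).unique hderiv
  have hcongr := intervalIntegral.integral_congr (μ := MeasureTheory.volume) (a := a) (b := b)
    (fun t ht => fderiv_familyDensity (Z := Z) h hI hY hZ
      (hsub (by rwa [Set.uIcc_of_le hab] at ht)))
  rw [hcongr, intervalIntegral.integral_const_mul] at hzero
  linarith

/-- The Euler-Lagrange equation, in weak form along a smooth field. -/
theorem sp_eulerLagrange_eq_zero (hI : IsOpen I) (hγ : IsConformalWorldLine I γ)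
    (hpar : IsConformalParameter I γ) {w : ℝ → Vec} (hw : ContDiffOn ℝ ∞ w I)
    (hw0 : ∀ t ∈ I, sp (canonicalLift γ t) (w t) = 0)
    (hw5 : ∀ t ∈ I, sp (w t) (liftTransversal (canonicalLift γ) t) = 0) {u : ℝ} (hu : u ∈ I) :
    sp (iteratedDeriv 3 (liftNormal (canonicalLift γ)) u +
      (2 * liftCurvature (canonicalLift γ) u) • deriv (liftNormal (canonicalLift γ)) u +
      deriv (liftCurvature (canonicalLift γ)) u • liftNormal (canonicalLift γ) u -
      iteratedDeriv 2 (canonicalLift γ) u) (w u) = 0 := by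
  have h := isNormalizedLift_canonicalLift hI hγ.timelike hpar
  have hstat := fun {a b} hab hsub {f} hf hsupp => integral_firstVariation_eq_zero (a := a) (b := b)
    (f := f) hI hγ hpar hab hsub hw hw0 hw5 hf hsupp rfl
  set X := canonicalLift γ with hXdef
  set N := liftNormal X with hNdef
  set k := liftCurvature X with hkdef
  have hN : ContDiffOn ℝ ∞ N I := h.contDiffOn_liftNormal hI
  have hk : ContDiffOn ℝ ∞ k I := h.contDiffOn_liftCurvature hI
  set E : ℝ → Vec := fun t => iteratedDeriv 3 N t + (2 * k t) • deriv N t + deriv k t • N t -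
    iteratedDeriv 2 X t with hE
  have hEs : ContDiffOn ℝ ∞ E I :=
    (((contDiffOn_iteratedDeriv hI hN 3).add ((contDiffOn_const.mul hk).smul
      (contDiffOn_deriv hI hN))).add ((contDiffOn_deriv hI hk).smul hN)).sub
        (contDiffOn_iteratedDeriv hI h.smooth 2)
  have hφ : ContinuousOn (fun t => sp (E t) (w t)) I := (contDiffOn_sp hEs hw).continuousOn
  obtain ⟨ε, hε, hball⟩ := Metric.nhds_basis_closedBall.mem_iff.1 (hI.mem_nhds hu)
  rw [Real.closedBall_eq_Icc] at hball
  set a := u - ε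
  set b := u + ε
  have hab : a ≤ b := by simp only [a, b]; linarith
  have haI : a ∈ I := hball ⟨le_rfl, hab⟩
  have hbI : b ∈ I := hball ⟨hab, le_rfl⟩
  have hIoo : Set.Ioo a b ⊆ I := Set.Ioo_subset_Icc_self.trans hball
  have hweak : ∀ f : ℝ → ℝ, ContDiff ℝ ∞ f → HasCompactSupport f → tsupport f ⊆ Set.Ioo a b →
      ∫ t, f t • sp (E t) (w t) = 0 := by
    intro f hf _ hsupp
    set Y : ℝ → Vec := fun t => f t • w t with hYdef
    have hY : ContDiffOn ℝ ∞ Y I := hf.contDiffOn.smul hw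
    have hvan : ∀ t ∉ Set.Ioo a b, ∀ j, iteratedDeriv j Y t = 0 := by
      intro t ht j
      have hf0 : f =ᶠ[nhds t] 0 := notMem_tsupport_iff_eventuallyEq.1 fun h' => ht (hsupp h')
      have : Y =ᶠ[nhds t] fun _ => 0 := by
        filter_upwards [hf0] with s hs
        simp [hYdef, hs]
      rw [this.iteratedDeriv_eq j]
      simp
    -- The boundary term of the integrations by parts, so that Φ' = ⟨E, Y⟩ - J. It vanishes at both
    -- ends because Y is zero near them.
    set Φ : ℝ → ℝ := fun t => sp (N t) (iteratedDeriv 2 Y t) -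
      sp (iteratedDeriv 1 N t) (iteratedDeriv 1 Y t) +
      sp (iteratedDeriv 2 N t) (iteratedDeriv 0 Y t) +
      2 * k t * sp (N t) (iteratedDeriv 0 Y t) - sp (deriv X t) (iteratedDeriv 0 Y t) with hΦ
    have hdY := fun j t (ht : t ∈ I) => hasDerivAt_iteratedDeriv hI hY j ht
    have hdN := fun j t (ht : t ∈ I) => hasDerivAt_iteratedDeriv hI hN j ht
    have hdN0 := fun t (ht : t ∈ I) => hasDerivAt_of_contDiffOn hI hN ht
    have hdk := fun t (ht : t ∈ I) => hasDerivAt_of_contDiffOn hI hk ht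
    set J : ℝ → ℝ := fun t => -sp (N t) (iteratedDeriv 3 Y t + deriv k t • Y t +
      (2 * k t) • deriv Y t) + sp (deriv X t) (deriv Y t) with hJ
    have hΦd : ∀ t ∈ I, HasDerivAt Φ (sp (E t) (Y t) - J t) t := by
      intro t ht
      have := ((((hasDerivAt_sp (hdN0 t ht) (hdY 2 t ht)).sub
        (hasDerivAt_sp (hdN 1 t ht) (hdY 1 t ht))).add
        (hasDerivAt_sp (hdN 2 t ht) (hdY 0 t ht))).add
        (((hdk t ht).const_mul 2).mul (hasDerivAt_sp (hdN0 t ht) (hdY 0 t ht)))).sub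
        (hasDerivAt_sp (h.hasDerivAt_one hI ht) (hdY 0 t ht))
      refine this.congr_deriv ?_
      simp only [hE, hJ, sp_add_left, sp_sub_left, sp_add_right, sp_smul_left, sp_smul_right,
        iteratedDeriv_zero, iteratedDeriv_one, zero_add, Nat.reduceAdd]
      ring
    have hEY : ContinuousOn (fun t => sp (E t) (Y t)) I := (contDiffOn_sp hEs hY).continuousOn
    have hJc : ContinuousOn J I :=
      ((contDiffOn_sp hN (((contDiffOn_iteratedDeriv hI hY 3).add
        ((contDiffOn_deriv hI hk).smul hY)).add ((contDiffOn_const.mul hk).smul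
          (contDiffOn_deriv hI hY)))).neg.add (contDiffOn_sp (contDiffOn_deriv hI h.smooth)
            (contDiffOn_deriv hI hY))).continuousOn
    have hII : ∀ {φ : ℝ → ℝ}, ContinuousOn φ I →
        IntervalIntegrable φ MeasureTheory.volume a b := fun hφ =>
      ContinuousOn.intervalIntegrable (by rw [Set.uIcc_of_le hab]; exact hφ.mono hball)
    have hftc := intervalIntegral.integral_eq_sub_of_hasDerivAt
      (fun t ht => hΦd t (hball (by rwa [Set.uIcc_of_le hab] at ht)))
      ((hII hEY).sub (hII hJc))
    have hends : ∀ t ∉ Set.Ioo a b, Φ t = 0 := fun t ht => by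
      simp only [hΦ, hvan t ht, sp_zero_right]
      ring
    rw [hends b (by simp), hends a (by simp), intervalIntegral.integral_sub (hII hEY) (hII hJc),
      hstat hab hball hf (hsupp.trans Set.Ioo_subset_Icc_self)] at hftc
    have hsuppE : Function.support (fun t => sp (E t) (Y t)) ⊆ Set.Ioc a b := by
      intro t ht
      by_contra hnt
      have h1 : Y t = 0 := by
        simpa using hvan t (fun h' => hnt (Set.Ioo_subset_Ioc_self h')) 0
      exact ht (by simp [h1])
    have hre : (fun t => f t • sp (E t) (w t)) = fun t => sp (E t) (Y t) := by
      funext t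
      simp [hYdef, sp_smul_right]
    rw [hre, ← intervalIntegral.integral_eq_integral_of_support_subset hsuppE]
    linarith
  -- The fundamental lemma of the calculus of variations gives vanishing almost everywhere;
  -- continuity then gives it at u.
  have hae := isOpen_Ioo.ae_eq_zero_of_integral_contDiff_smul_eq_zero
    ((hφ.mono hIoo).locallyIntegrableOn measurableSet_Ioo) hweak
  have hae' : (fun t => sp (E t) (w t)) =ᵐ[MeasureTheory.volume.restrict (Set.Ioo a b)]
      fun _ => 0 := (MeasureTheory.ae_restrict_iff' measurableSet_Ioo).2 hae
  exact MeasureTheory.Measure.eqOn_open_of_ae_eq hae' isOpen_Ioo (hφ.mono hIoo)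
    continuousOn_const ⟨by simp only [a]; linarith, by simp only [b]; linarith⟩

/-- The Euler-Lagrange equations of the total strain in terms of the conformal curvatures. -/
theorem curvature_eulerLagrange (hI : IsOpen I) (hγ : IsConformalWorldLine I γ)
    (hpar : IsConformalParameter I γ) (hhel : ∀ u ∈ I, 0 < curvature3 γ u) {u : ℝ} (hu : u ∈ I) :
    deriv (curvature1 γ) u = 3 * curvature2 γ u * deriv (curvature2 γ) u ∧
    iteratedDeriv 2 (curvature2 γ) u = curvature2 γ u ^ 3 + curvature2 γ u * curvature3 γ u ^ 2 -
      2 * curvature1 γ u * curvature2 γ u ∧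
    2 * deriv (curvature2 γ) u * curvature3 γ u + curvature2 γ u * deriv (curvature3 γ) u = 0 := by
  have h := isNormalizedLift_canonicalLift hI hγ.timelike hpar
  have F := isConformalFrame hI hγ.timelike hpar hhel
  have k1 := curvature1_eqOn h hI
  have key := fun {w} hw hw0 hw5 => sp_eulerLagrange_eq_zero (w := w) hI hγ hpar hw hw0 hw5 hu
  set X := canonicalLift γ with hXdef
  set N := liftNormal X with hNdef
  have dk2 := fun t (ht : t ∈ I) => hasDerivAt_of_contDiffOn hI F.smooth_two ht
  have dk2' := fun t (ht : t ∈ I) =>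
    hasDerivAt_of_contDiffOn hI (contDiffOn_deriv hI F.smooth_two) ht
  have dk3 := fun t (ht : t ∈ I) => hasDerivAt_of_contDiffOn hI F.smooth_three ht
  have e1 : Set.EqOn (iteratedDeriv 1 N) (fun t => X t + curvature2 γ t • frame3 γ t) I := by
    rw [iteratedDeriv_one]
    exact fun t ht => (F.deriv_two t ht).deriv
  have e2 := iteratedDeriv_succ_eqOn hI e1 fun t ht =>
    (F.deriv_zero t ht).add ((dk2 t ht).smul (F.deriv_three t ht))
  have e3 := iteratedDeriv_succ_eqOn hI e2 fun t ht =>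
    (F.deriv_one t ht).add (((dk2 t ht).smul
      (((dk2 t ht).smul (F.deriv_two t ht)).neg.add
        ((dk3 t ht).smul (F.deriv_four t ht)))).add
          ((dk2' t ht).smul (F.deriv_three t ht)))
  have e3u := e3 hu
  have e1u := e1 hu
  rw [iteratedDeriv_one] at e1u
  have hX2 : iteratedDeriv 2 X u = -(curvature1 γ u • X u) - liftTransversal X u := by
    rw [IsNormalizedLift.iteratedDeriv_two_eq, k1 hu]; module
  have hk1' : deriv (liftCurvature X) u = deriv (curvature1 γ) u := by
    have : curvature1 γ =ᶠ[nhds u] liftCurvature X := k1.eventuallyEq_of_mem (hI.mem_nhds hu)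
    exact this.deriv_eq.symm
  -- The admissible fields B₂, B₃, B₄ pick out the three components of the Euler-Lagrange vector,
  -- expanded in the frame by the structure equations.
  have r2 := key (F.smooth 2) F.zero_two F.two_five
  have r3 := key (F.smooth 3) F.zero_three F.three_five
  have r4 := key (F.smooth 4) F.zero_four F.four_five
  simp only [Nat.reduceAdd, Pi.add_apply, Pi.smul_apply', Pi.neg_apply] at e3u
  simp only [e3u, e1u, hX2, hk1', ← k1 hu, Matrix.cons_val, sp_sub_left, sp_add_left, sp_smul_left,
    sp_neg_left, sp_comm (frame3 γ u) (N u), sp_comm (frame4 γ u) (N u),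
    sp_comm (frame4 γ u) (frame3 γ u), sp_comm (liftTransversal X u) (N u),
    sp_comm (liftTransversal X u) (frame3 γ u), sp_comm (liftTransversal X u) (frame4 γ u),
    F.zero_two u hu, F.zero_three u hu, F.zero_four u hu, F.two_two u hu, F.two_three u hu,
    F.two_four u hu, F.two_five u hu, F.three_three u hu, F.three_four u hu, F.three_five u hu,
    F.four_four u hu, F.four_five u hu] at r2 r3 r4
  rw [iteratedDeriv_succ, iteratedDeriv_one]
  refine ⟨?_, ?_, ?_⟩
  · linear_combination r2
  · linear_combination r3
  · linear_combination r4

end Variation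

/-! ### Jacobi's amplitude -/

theorem one_sub_mul_sin_sq_pos {m : ℝ} (hm0 : 0 ≤ m) (hm1 : m < 1) (θ : ℝ) :
    0 < 1 - m * Real.sin θ ^ 2 := by
  nlinarith [mul_le_mul_of_nonneg_left (Real.sin_sq_le_one θ) hm0]

theorem continuous_ellipticIntegrand {m : ℝ} (hm0 : 0 ≤ m) (hm1 : m < 1) :
    Continuous fun θ => (√(1 - m * Real.sin θ ^ 2))⁻¹ :=
  Continuous.inv₀ (by fun_prop) fun θ =>
    (Real.sqrt_pos.2 (one_sub_mul_sin_sq_pos hm0 hm1 θ)).ne'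

theorem hasDerivAt_ellipticF {m : ℝ} (hm0 : 0 ≤ m) (hm1 : m < 1) (φ : ℝ) :
    HasDerivAt (ellipticF m) (√(1 - m * Real.sin φ ^ 2))⁻¹ φ :=
  ((continuous_ellipticIntegrand hm0 hm1).integral_hasStrictDerivAt 0 φ).hasDerivAt

theorem strictMono_ellipticF {m : ℝ} (hm0 : 0 ≤ m) (hm1 : m < 1) : StrictMono (ellipticF m) :=
  strictMono_of_hasDerivAt_pos (hasDerivAt_ellipticF hm0 hm1) fun φ =>
    inv_pos.2 (Real.sqrt_pos.2 (one_sub_mul_sin_sq_pos hm0 hm1 φ))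

/-- The integrand is at least 1, so F(φ) - φ is monotone and F tends to ±∞ together with φ. -/
theorem surjective_ellipticF {m : ℝ} (hm0 : 0 ≤ m) (hm1 : m < 1) :
    Function.Surjective (ellipticF m) := by
  have hd := hasDerivAt_ellipticF hm0 hm1
  have hmono : Monotone fun φ => ellipticF m φ - φ := by
    refine monotone_of_hasDerivAt_nonneg (fun φ => (hd φ).sub (hasDerivAt_id φ)) fun φ => ?_
    have hp := one_sub_mul_sin_sq_pos hm0 hm1 φ
    have hle : √(1 - m * Real.sin φ ^ 2) ≤ 1 :=
      Real.sqrt_le_one.2 (by nlinarith [mul_nonneg hm0 (sq_nonneg (Real.sin φ))])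
    exact sub_nonneg.2 ((one_le_inv₀ (Real.sqrt_pos.2 hp)).2 hle)
  have h0 : ellipticF m 0 = 0 := by simp [ellipticF]
  refine Continuous.surjective (continuous_iff_continuousAt.2 fun φ => (hd φ).continuousAt) ?_ ?_
  · refine Filter.tendsto_atTop_mono' _ ?_ Filter.tendsto_id
    filter_upwards [Filter.eventually_ge_atTop 0] with φ hφ
    have := hmono hφ
    simp only [h0, sub_zero] at this
    simpa using this
  · refine Filter.tendsto_atBot_mono' _ ?_ Filter.tendsto_id
    filter_upwards [Filter.eventually_le_atBot 0] with φ hφ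
    have := hmono hφ
    simp only [h0, sub_zero] at this
    simpa using this

theorem jacobiAm_ellipticF {m : ℝ} (hm0 : 0 ≤ m) (hm1 : m < 1) (φ : ℝ) :
    jacobiAm (ellipticF m φ) m = φ :=
  Function.leftInverse_invFun (strictMono_ellipticF hm0 hm1).injective φ

theorem ellipticF_jacobiAm {m : ℝ} (hm0 : 0 ≤ m) (hm1 : m < 1) (x : ℝ) :
    ellipticF m (jacobiAm x m) = x :=
  Function.rightInverse_invFun (surjective_ellipticF hm0 hm1) x

/-- The derivative of an inverse function; its continuity comes from the order isomorphism defined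
by F. -/
theorem hasDerivAt_jacobiAm {m : ℝ} (hm0 : 0 ≤ m) (hm1 : m < 1) (x : ℝ) :
    HasDerivAt (fun x => jacobiAm x m) √(1 - m * Real.sin (jacobiAm x m) ^ 2) x := by
  let e := (strictMono_ellipticF hm0 hm1).orderIsoOfSurjective _ (surjective_ellipticF hm0 hm1)
  have he : (fun x => jacobiAm x m) = e.symm := by
    funext y
    rw [← jacobiAm_ellipticF hm0 hm1 (e.symm y)]
    congr 1
    exact (e.apply_symm_apply y).symm
  have hc : ContinuousAt (fun x => jacobiAm x m) x := by
    rw [he]; exact e.symm.continuous.continuousAt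
  have hp := Real.sqrt_pos.2 (one_sub_mul_sin_sq_pos hm0 hm1 (jacobiAm x m))
  have := (hasDerivAt_ellipticF hm0 hm1 (jacobiAm x m)).of_local_left_inverse hc
    (inv_ne_zero hp.ne') (Filter.Eventually.of_forall fun y => ellipticF_jacobiAm hm0 hm1 y)
  rwa [inv_inv] at this

/-! ### Uniqueness for a linear second order equation -/

theorem exists_mem_lt {I : Set ℝ} (hI : IsOpen I) {x : ℝ} (hx : x ∈ I) : ∃ a ∈ I, a < x := by
  obtain ⟨a, ha, hsub⟩ := exists_Ioc_subset_of_mem_nhds (hI.mem_nhds hx) ⟨x - 1, by linarith⟩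
  exact ⟨(a + x) / 2, hsub ⟨by linarith, by linarith⟩, by linarith⟩

theorem exists_mem_gt {I : Set ℝ} (hI : IsOpen I) {x : ℝ} (hx : x ∈ I) : ∃ b ∈ I, x < b := by
  obtain ⟨b, hb, hsub⟩ := exists_Ico_subset_of_mem_nhds (hI.mem_nhds hx) ⟨x + 1, by linarith⟩
  exact ⟨(x + b) / 2, hsub ⟨by linarith, by linarith⟩, by linarith⟩

/-- On a compact interval inside I that surrounds t₀ and u, the function q is bounded, so the planar
field (x, y) ↦ (y, q x) is Lipschitz; its solution is compared with the zero solution. -/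
theorem eq_zero_of_linear_ode {I : Set ℝ} (hI : IsOpen I) (hI' : I.OrdConnected)
    {d d' q : ℝ → ℝ} (hd : ∀ u ∈ I, HasDerivAt d (d' u) u)
    (hd' : ∀ u ∈ I, HasDerivAt d' (q u * d u) u) (hq : ContinuousOn q I) {t₀ : ℝ} (ht₀ : t₀ ∈ I)
    (h0 : d t₀ = 0) (h0' : d' t₀ = 0) {u : ℝ} (hu : u ∈ I) : d u = 0 := by
  obtain ⟨a, haI, ha⟩ : ∃ a ∈ I, a < min t₀ u :=
    exists_mem_lt hI (by rcases min_choice t₀ u with h | h <;> rw [h] <;> assumption)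
  obtain ⟨b, hbI, hb⟩ : ∃ b ∈ I, max t₀ u < b :=
    exists_mem_gt hI (by rcases max_choice t₀ u with h | h <;> rw [h] <;> assumption)
  have hsub : Set.Icc a b ⊆ I := hI'.out haI hbI
  obtain ⟨C, hC⟩ := isCompact_Icc.exists_bound_of_continuousOn (hq.mono hsub)
  set v : ℝ → ℝ × ℝ → ℝ × ℝ := fun t x => (x.2, q t * x.1) with hv
  have hlip : ∀ t ∈ Set.Ioo a b, LipschitzOnWith (1 + Real.toNNReal C) (v t) Set.univ := by
    intro t ht
    have hCt := hC t (Set.Ioo_subset_Icc_self ht)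
    have hC0 : 0 ≤ C := (norm_nonneg _).trans hCt
    refine LipschitzOnWith.of_dist_le_mul fun x _ y _ => ?_
    have h1 : dist x.1 y.1 ≤ dist x y := le_max_left _ _
    have h2 : dist x.2 y.2 ≤ dist x y := le_max_right _ _
    have hnn : 0 ≤ dist x y := dist_nonneg
    rw [NNReal.coe_add, NNReal.coe_one, Real.coe_toNNReal C hC0]
    refine max_le ?_ ?_
    · simp only [hv]
      nlinarith [mul_nonneg hC0 hnn]
    · simp only [hv]
      rw [Real.dist_eq, ← mul_sub, abs_mul, ← Real.dist_eq]
      have : |q t| * dist x.1 y.1 ≤ C * dist x y :=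
        mul_le_mul hCt h1 dist_nonneg hC0
      linarith
  have hmem : ∀ {x}, min t₀ u ≤ x → x ≤ max t₀ u → x ∈ Set.Ioo a b := fun h1 h2 =>
    ⟨ha.trans_le h1, h2.trans_lt hb⟩
  have huniq := ODE_solution_unique_of_mem_Ioo (s := fun _ => Set.univ)
    (f := fun t => (d t, d' t)) (g := fun _ => ((0 : ℝ), (0 : ℝ))) hlip
    (hmem (min_le_left t₀ u) (le_max_left t₀ u))
    (fun t ht => ⟨(hd t (hsub (Set.Ioo_subset_Icc_self ht))).prodMk
      (hd' t (hsub (Set.Ioo_subset_Icc_self ht))), trivial⟩)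
    (fun t ht => ⟨(hasDerivAt_const t ((0 : ℝ), (0 : ℝ))).congr_deriv
      (by simp only [hv, mul_zero]; rfl), trivial⟩)
    (by simp [h0, h0'])
  exact congrArg Prod.fst (huniq (hmem (min_le_right t₀ u) (le_max_right t₀ u)))

/-! ### The elliptic solution of a cubic equation -/

/-- The elliptic profile as a function of the amplitude. -/
noncomputable def ellipticProfile (e₁ e₂ e₃ φ : ℝ) : ℝ :=
  (e₂ * (e₃ - e₁) - e₁ * (e₃ - e₂) * Real.sin φ ^ 2) / (e₃ - e₁ - (e₃ - e₂) * Real.sin φ ^ 2)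

/-- The derivative of the elliptic profile along a solution. -/
noncomputable def ellipticProfileDeriv (e₁ e₂ e₃ φ : ℝ) : ℝ :=
  -- With D the denominator of the profile, the power is D⁻² from the quotient rule times φ' =
  -- D^(1/2).
  2 * (e₃ - e₁) * (e₃ - e₂) * (e₂ - e₁) * (Real.sin φ * Real.cos φ) /
    √(e₃ - e₁ - (e₃ - e₂) * Real.sin φ ^ 2) ^ 3

section Profile

variable {e₁ e₂ e₃ : ℝ}

theorem ellipticProfile_denom_pos (h12 : e₁ < e₂) (h23 : e₂ < e₃) (φ : ℝ) :
    0 < e₃ - e₁ - (e₃ - e₂) * Real.sin φ ^ 2 := by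
  nlinarith [mul_le_mul_of_nonneg_left (Real.sin_sq_le_one φ) (sub_pos.2 h23).le]

theorem hasDerivAt_ellipticProfile (h12 : e₁ < e₂) (h23 : e₂ < e₃) {φ : ℝ → ℝ} {u : ℝ}
    (hφ : HasDerivAt φ √(e₃ - e₁ - (e₃ - e₂) * Real.sin (φ u) ^ 2) u) :
    HasDerivAt (fun u => ellipticProfile e₁ e₂ e₃ (φ u))
      (ellipticProfileDeriv e₁ e₂ e₃ (φ u)) u := by
  have hD := ellipticProfile_denom_pos h12 h23 (φ u)
  have hs := (hφ.sin.pow 2)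
  have := ((hs.const_mul (e₁ * (e₃ - e₂))).const_sub (e₂ * (e₃ - e₁))).div
    ((hs.const_mul (e₃ - e₂)).const_sub (e₃ - e₁)) hD.ne'
  refine this.congr_deriv ?_
  have hW := Real.sq_sqrt hD.le
  have hWp := Real.sqrt_pos.2 hD
  simp only [Pi.pow_apply, ellipticProfileDeriv]
  set W := √(e₃ - e₁ - (e₃ - e₂) * Real.sin (φ u) ^ 2)
  rw [← hW]
  have hWne := hWp.ne'
  field_simp
  rw [hW]
  push_cast
  ring

/-- The profile satisfies h'' = -2Q'(h) with Q(t) = (t - e₁)(t - e₂)(t - e₃). This is h'² = -4Q(h)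
differentiated, but it stays valid at the turning points. -/
theorem hasDerivAt_ellipticProfileDeriv (h12 : e₁ < e₂) (h23 : e₂ < e₃) {φ : ℝ → ℝ} {u : ℝ}
    (hφ : HasDerivAt φ √(e₃ - e₁ - (e₃ - e₂) * Real.sin (φ u) ^ 2) u) :
    HasDerivAt (fun u => ellipticProfileDeriv e₁ e₂ e₃ (φ u))
      (-2 * ((ellipticProfile e₁ e₂ e₃ (φ u) - e₂) * (ellipticProfile e₁ e₂ e₃ (φ u) - e₃) +
        (ellipticProfile e₁ e₂ e₃ (φ u) - e₁) * (ellipticProfile e₁ e₂ e₃ (φ u) - e₃) +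
        (ellipticProfile e₁ e₂ e₃ (φ u) - e₁) * (ellipticProfile e₁ e₂ e₃ (φ u) - e₂))) u := by
  have hD := ellipticProfile_denom_pos h12 h23 (φ u)
  have hWp := Real.sqrt_pos.2 hD
  have hs := (hφ.sin.pow 2)
  have hWd := ((hs.const_mul (e₃ - e₂)).const_sub (e₃ - e₁)).sqrt hD.ne'
  have := (((hφ.sin.mul hφ.cos).const_mul (2 * (e₃ - e₁) * (e₃ - e₂) * (e₂ - e₁))).div
    (hWd.pow 3) (pow_pos hWp 3).ne')
  refine this.congr_deriv ?_
  have hW := Real.sq_sqrt hD.le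
  simp only [Pi.pow_apply, Pi.mul_apply, ellipticProfile]
  have hc := Real.cos_sq' (φ u)
  set W := √(e₃ - e₁ - (e₃ - e₂) * Real.sin (φ u) ^ 2)
  set s := Real.sin (φ u)
  set c := Real.cos (φ u)
  have hWne := hWp.ne'
  have hDne := hD.ne'
  -- Reduces the quotient to even powers of W, so that W² can be replaced by its rational expression
  -- in s².
  have hnum : (2 * (e₃ - e₁) * (e₃ - e₂) * (e₂ - e₁) * (c * W * c + s * (-s * W)) * W ^ 3 -
      2 * (e₃ - e₁) * (e₃ - e₂) * (e₂ - e₁) * (s * c) *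
        (3 * W ^ 2 * (-((e₃ - e₂) * (2 * s * (c * W))) / (2 * W)))) / (W ^ 3) ^ 2 =
      2 * (e₃ - e₁) * (e₃ - e₂) * (e₂ - e₁) * ((c ^ 2 - s ^ 2) * W ^ 2 +
        3 * (e₃ - e₂) * s ^ 2 * c ^ 2) / (W ^ 2) ^ 2 := by
    field_simp
    ring
  refine Eq.trans ?_ (hnum.trans ?_)
  · push_cast
    ring
  · rw [hW, hc]
    field_simp
    ring

theorem ellipticProfileDeriv_sq (h12 : e₁ < e₂) (h23 : e₂ < e₃) (φ : ℝ) :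
    ellipticProfileDeriv e₁ e₂ e₃ φ ^ 2 = -4 * ((ellipticProfile e₁ e₂ e₃ φ - e₁) *
      (ellipticProfile e₁ e₂ e₃ φ - e₂) * (ellipticProfile e₁ e₂ e₃ φ - e₃)) := by
  have hD := ellipticProfile_denom_pos h12 h23 φ
  have hDne := hD.ne'
  have hW := Real.sq_sqrt hD.le
  have hc := Real.cos_sq' φ
  rw [ellipticProfileDeriv, div_pow, ← pow_mul, mul_comm 3 2, pow_mul, hW, mul_pow _ (_ * _),
    mul_pow (Real.sin φ), hc, ellipticProfile]
  field_simp
  ring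

/-- The profile is a Möbius function of sin² φ mapping [0, 1] onto [e₂, e₃], the interval to which
the cubic relation confines x. The relation fixes the derivative up to sign, and φ ↦ -φ flips the
sign. -/
theorem exists_ellipticProfile_eq (h12 : e₁ < e₂) (h23 : e₂ < e₃) {x y : ℝ} (hx : e₁ < x)
    (hxy : y ^ 2 = -4 * ((x - e₁) * (x - e₂) * (x - e₃))) :
    ∃ φ, ellipticProfile e₁ e₂ e₃ φ = x ∧ ellipticProfileDeriv e₁ e₂ e₃ φ = y := by
  have hx1 := sub_pos.2 hx
  have h13 := sub_pos.2 (h12.trans h23)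
  have h23' := sub_pos.2 h23
  have h12' := sub_pos.2 h12
  have hle : (x - e₂) * (x - e₃) ≤ 0 := by
    by_contra hcon
    push Not at hcon
    nlinarith [mul_pos hx1 hcon, sq_nonneg y]
  have hx2 : e₂ ≤ x := by
    by_contra hcon
    push Not at hcon
    nlinarith
  have hx3 : x ≤ e₃ := by
    by_contra hcon
    push Not at hcon
    nlinarith
  -- The value of sin² φ obtained by inverting the Möbius function.
  set S := (e₃ - e₁) * (x - e₂) / ((e₃ - e₂) * (x - e₁)) with hS
  have hS0 : 0 ≤ S := div_nonneg (mul_nonneg h13.le (sub_nonneg.2 hx2)) (mul_pos h23' hx1).le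
  have hS1 : S ≤ 1 := by
    rw [hS, div_le_one (mul_pos h23' hx1)]
    nlinarith [mul_nonneg h12'.le (sub_nonneg.2 hx3)]
  have hsin : Real.sin (Real.arcsin √S) ^ 2 = S := by
    rw [Real.sin_arcsin (by linarith [Real.sqrt_nonneg S]) (Real.sqrt_le_one.2 hS1),
      Real.sq_sqrt hS0]
  have hprof : ∀ φ, Real.sin φ ^ 2 = S → ellipticProfile e₁ e₂ e₃ φ = x := by
    intro φ hφ
    have hD := ellipticProfile_denom_pos h12 h23 φ
    rw [ellipticProfile, div_eq_iff hD.ne', hφ, hS]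
    have hx1ne := hx1.ne'
    have h23ne := h23'.ne'
    field_simp
    ring
  set φ := Real.arcsin √S
  have hsq : ellipticProfileDeriv e₁ e₂ e₃ φ ^ 2 = y ^ 2 := by
    rw [ellipticProfileDeriv_sq h12 h23, hprof φ hsin, hxy]
  rcases sq_eq_sq_iff_eq_or_eq_neg.1 hsq with h | h
  · exact ⟨φ, hprof φ hsin, h⟩
  · refine ⟨-φ, hprof (-φ) (by rw [Real.sin_neg, neg_sq, hsin]), ?_⟩
    have hodd : ellipticProfileDeriv e₁ e₂ e₃ (-φ) = -ellipticProfileDeriv e₁ e₂ e₃ φ := by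
      simp only [ellipticProfileDeriv, Real.sin_neg, Real.cos_neg, neg_sq]
      ring
    rw [hodd, h, neg_neg]

/-- Solutions of `h'² = -4 (h - e₁) (h - e₂) (h - e₃)` above `e₁` are elliptic. -/
theorem exists_jacobiSn_of_cubic_ode {I : Set ℝ} (hI : IsOpen I) (hI' : I.OrdConnected)
    (hne : I.Nonempty) (h12 : e₁ < e₂) (h23 : e₂ < e₃) {h h' : ℝ → ℝ}
    (hd : ∀ u ∈ I, HasDerivAt h (h' u) u)
    (hd' : ∀ u ∈ I, HasDerivAt h' (-2 * ((h u - e₂) * (h u - e₃) + (h u - e₁) * (h u - e₃) +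
      (h u - e₁) * (h u - e₂))) u)
    (hsq : ∀ u ∈ I, h' u ^ 2 = -4 * ((h u - e₁) * (h u - e₂) * (h u - e₃)))
    (hlt : ∀ u ∈ I, e₁ < h u) :
    ∃ u₀ : ℝ, ∀ u ∈ I, h u =
      (e₂ * (e₃ - e₁) - e₁ * (e₃ - e₂) *
        jacobiSn (√(e₃ - e₁) * u + u₀) ((e₃ - e₂) / (e₃ - e₁)) ^ 2) /
      (e₃ - e₁ - (e₃ - e₂) *
        jacobiSn (√(e₃ - e₁) * u + u₀) ((e₃ - e₂) / (e₃ - e₁)) ^ 2) := by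
  obtain ⟨t₀, ht₀⟩ := hne
  obtain ⟨φ₀, hφ₀, hφ₀'⟩ := exists_ellipticProfile_eq h12 h23 (hlt t₀ ht₀) (hsq t₀ ht₀)
  have h13 := sub_pos.2 (h12.trans h23)
  set m := (e₃ - e₂) / (e₃ - e₁) with hm
  have hm0 : 0 ≤ m := div_nonneg (sub_pos.2 h23).le h13.le
  have hm1 : m < 1 := by rw [hm, div_lt_one h13]; linarith
  -- This phase makes the amplitude at t₀ equal to φ₀, matching both initial data.
  refine ⟨ellipticF m φ₀ - √(e₃ - e₁) * t₀, fun u hu => ?_⟩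
  set u₀ := ellipticF m φ₀ - √(e₃ - e₁) * t₀ with hu₀
  set φ : ℝ → ℝ := fun u => jacobiAm (√(e₃ - e₁) * u + u₀) m with hφ
  have hφd : ∀ u, HasDerivAt φ √(e₃ - e₁ - (e₃ - e₂) * Real.sin (φ u) ^ 2) u := by
    intro u
    have h1 : HasDerivAt (fun u => √(e₃ - e₁) * u + u₀) √(e₃ - e₁) u := by
      simpa using ((hasDerivAt_id u).const_mul √(e₃ - e₁)).add_const u₀
    have h2 := (hasDerivAt_jacobiAm hm0 hm1 (√(e₃ - e₁) * u + u₀)).comp u h1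
    refine h2.congr_deriv ?_
    rw [← Real.sqrt_mul (one_sub_mul_sin_sq_pos hm0 hm1 _).le]
    congr 1
    rw [hm]
    field_simp
    rfl
  have hφt : φ t₀ = φ₀ := by
    simp only [hφ, hu₀]
    rw [add_sub_cancel, jacobiAm_ellipticF hm0 hm1]
  set H : ℝ → ℝ := fun u => ellipticProfile e₁ e₂ e₃ (φ u) with hH
  have hHd := fun u => hasDerivAt_ellipticProfile h12 h23 (hφd u)
  have hHd' := fun u => hasDerivAt_ellipticProfileDeriv h12 h23 (hφd u)
  have hHc : ContinuousOn H I := fun u _ => (hHd u).continuousAt.continuousWithinAt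
  have hhc : ContinuousOn h I := fun u hu => (hd u hu).continuousAt.continuousWithinAt
  -- The right side of the second order equation is a quadratic polynomial in h, so the difference
  -- of two values has the factor h - H; the cofactor is q.
  have hzero := eq_zero_of_linear_ode hI hI' (d := fun u => h u - H u)
    (d' := fun u => h' u - ellipticProfileDeriv e₁ e₂ e₃ (φ u))
    (q := fun u => -2 * (3 * (h u + H u) - 2 * (e₁ + e₂ + e₃)))
    (fun u hu => (hd u hu).sub (hHd u))
    (fun u hu => ((hd' u hu).sub (hHd' u)).congr_deriv (by simp only [hH]; ring))
    (by fun_prop) ht₀ (by simp only [hH, hφt, hφ₀, sub_self])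
    (by simp only [hφt, hφ₀', sub_self]) hu
  exact sub_eq_zero.1 hzero

end Profile

/-! ### The character cubic -/

theorem characterCubic_monic (c₁ c₂ c₃ : ℝ) : (characterCubic c₁ c₂ c₃).Monic := by
  unfold characterCubic
  monicity!

theorem characterCubic_natDegree (c₁ c₂ c₃ : ℝ) : (characterCubic c₁ c₂ c₃).natDegree = 3 := by
  unfold characterCubic
  compute_degree!

theorem characterCubic_eval (c₁ c₂ c₃ t : ℝ) : (characterCubic c₁ c₂ c₃).eval t =
    t ^ 3 + 2 * c₁ * t ^ 2 + c₂ * t + c₃ ^ 2 := by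
  simp [characterCubic]

theorem characterCubic_eq_of_roots {c₁ c₂ c₃ e₁ e₂ e₃ : ℝ}
    (h : (characterCubic c₁ c₂ c₃).roots = {e₁, e₂, e₃}) (t : ℝ) :
    t ^ 3 + 2 * c₁ * t ^ 2 + c₂ * t + c₃ ^ 2 = (t - e₁) * (t - e₂) * (t - e₃) := by
  have hprod := Polynomial.prod_multiset_X_sub_C_of_monic_of_roots_card_eq
    (characterCubic_monic c₁ c₂ c₃) (by rw [h, characterCubic_natDegree]; rfl)
  rw [← characterCubic_eval, ← hprod, h]
  simp [mul_assoc]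

/-- Three distinct roots already exhaust a multiset whose size is bounded by the degree. -/
theorem characterCubic_roots_eq {c₁ c₂ c₃ e₁ e₂ e₃ : ℝ} (h12 : e₁ < e₂) (h23 : e₂ < e₃)
    (h1 : (characterCubic c₁ c₂ c₃).eval e₁ = 0) (h2 : (characterCubic c₁ c₂ c₃).eval e₂ = 0)
    (h3 : (characterCubic c₁ c₂ c₃).eval e₃ = 0) :
    (characterCubic c₁ c₂ c₃).roots = {e₁, e₂, e₃} := by
  have hne := (characterCubic_monic c₁ c₂ c₃).ne_zero
  refine (Multiset.eq_of_le_of_card_le ?_ ?_).symm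
  · have hnd : ({e₁, e₂, e₃} : Multiset ℝ).Nodup := by
      simp [h12.ne, h23.ne, (h12.trans h23).ne]
    rw [Multiset.le_iff_subset hnd]
    intro x hx
    rw [Polynomial.mem_roots hne, Polynomial.IsRoot]
    simp only [Multiset.insert_eq_cons, Multiset.mem_cons, Multiset.mem_singleton] at hx
    rcases hx with rfl | rfl | rfl <;> assumption
  · refine (Polynomial.card_roots' _).trans ?_
    rw [characterCubic_natDegree]
    rfl

/-- The cubic has a negative and two positive roots as soon as it is negative somewhere on the
positive half line. -/
theorem exists_characterCubic_roots {c₁ c₂ c₃ x : ℝ} (hc : c₃ ≠ 0) (hx : 0 < x)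
    (hneg : x ^ 3 + 2 * c₁ * x ^ 2 + c₂ * x + c₃ ^ 2 < 0) :
    ∃ e₁ e₂ e₃ : ℝ, e₁ < e₂ ∧ e₂ < e₃ ∧ (characterCubic c₁ c₂ c₃).roots = {e₁, e₂, e₃} := by
  set Q := characterCubic c₁ c₂ c₃ with hQ
  have hcont : ∀ {s : Set ℝ}, ContinuousOn (fun t => Q.eval t) s := Q.continuous.continuousOn
  have hev : ∀ t, Q.eval t = t ^ 3 + 2 * c₁ * t ^ 2 + c₂ * t + c₃ ^ 2 :=
    characterCubic_eval c₁ c₂ c₃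
  have hx' : Q.eval x < 0 := by rw [hev]; exact hneg
  have hc2 : 0 < c₃ ^ 2 := by positivity
  have h0 : 0 < Q.eval 0 := by rw [hev]; simpa using hc2
  -- Beyond this bound t³ dominates the lower terms and decides the sign.
  have hbound : ∀ M : ℝ, 1 + |2 * c₁| + |c₂| + c₃ ^ 2 ≤ M → Q.eval (-M) < 0 ∧ 0 < Q.eval M := by
    intro M hM
    have hM1 : 1 ≤ M := by linarith [abs_nonneg (2 * c₁), abs_nonneg c₂]
    have hM2 : M ≤ M ^ 2 := by nlinarith
    have a1 : |2 * c₁ * M ^ 2| ≤ |2 * c₁| * M ^ 2 := by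
      rw [abs_mul, abs_of_nonneg (sq_nonneg M)]
    have a2 : |c₂ * M| ≤ |c₂| * M ^ 2 := by
      rw [abs_mul, abs_of_nonneg (by linarith : (0 : ℝ) ≤ M)]
      exact mul_le_mul_of_nonneg_left hM2 (abs_nonneg _)
    have a3 : c₃ ^ 2 ≤ c₃ ^ 2 * M ^ 2 := le_mul_of_one_le_right hc2.le (by linarith)
    have a4 : (1 + |2 * c₁| + |c₂| + c₃ ^ 2) * M ^ 2 ≤ M * M ^ 2 :=
      mul_le_mul_of_nonneg_right hM (sq_nonneg M)
    have b1 := abs_le.1 a1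
    have b2 := abs_le.1 a2
    rw [hev, hev]
    constructor
    · nlinarith
    · nlinarith
  set M := 1 + |2 * c₁| + |c₂| + c₃ ^ 2
  have hM0 : 0 < M := by positivity
  -- The signs at -M, 0, x, M + x are -, +, -, +, giving one root in each gap.
  obtain ⟨e₁, he₁, hr₁⟩ := intermediate_value_Ioo (neg_lt_zero.2 hM0).le hcont
    ⟨(hbound M le_rfl).1, h0⟩
  obtain ⟨e₂, he₂, hr₂⟩ := intermediate_value_Ioo' hx.le hcont ⟨hx', h0⟩
  obtain ⟨e₃, he₃, hr₃⟩ := intermediate_value_Ioo (by linarith : x ≤ M + x) hcont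
    ⟨hx', (hbound (M + x) (by linarith)).2⟩
  exact ⟨e₁, e₂, e₃, he₁.2.trans he₂.1, he₂.2.trans he₃.1,
    characterCubic_roots_eq (he₁.2.trans he₂.1) (he₂.2.trans he₃.1) hr₁ hr₂ hr₃⟩

/-! ### Characters of a world-line -/

section Characters

variable {I : Set ℝ} {γ : ℝ → Vec}

theorem exists_eq_const {I : Set ℝ} (hI : IsOpen I) (hI' : I.OrdConnected) {f : ℝ → ℝ}
    (hf : ∀ u ∈ I, HasDerivAt f 0 u) : ∃ c, ∀ u ∈ I, f u = c :=
  hI.exists_is_const_of_deriv_eq_zero hI'.isPreconnected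
    (fun u hu => (hf u hu).differentiableAt.differentiableWithinAt) fun u hu => (hf u hu).deriv

/-- Each character is a first integral of the Euler-Lagrange equations. Once k₁ and k₃ are expressed
through k₂, the equation for k₂'' is conservative, and the last integral is its energy. -/
theorem exists_characters (hI : IsOpen I) (hI' : I.OrdConnected) (hne : I.Nonempty)
    (hγ : IsConformalWorldLine I γ) (hpar : IsConformalParameter I γ)
    (hhel : ∀ u ∈ I, 0 < curvature3 γ u) : ∃ c₁ c₂ c₃ : ℝ, AreCharacters I γ c₁ c₂ c₃ := by
  have F := isConformalFrame hI hγ.timelike hpar hhel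
  have EL := fun u hu => curvature_eulerLagrange (u := u) hI hγ hpar hhel hu
  have d1 := fun u (hu : u ∈ I) => hasDerivAt_of_contDiffOn hI F.smooth_one hu
  have d2 := fun u (hu : u ∈ I) => hasDerivAt_of_contDiffOn hI F.smooth_two hu
  have d3 := fun u (hu : u ∈ I) => hasDerivAt_of_contDiffOn hI F.smooth_three hu
  have d2' : ∀ u ∈ I, HasDerivAt (deriv (curvature2 γ)) (iteratedDeriv 2 (curvature2 γ) u) u :=
    fun u hu => by simpa using hasDerivAt_iteratedDeriv hI F.smooth_two 1 hu
  obtain ⟨c₁, h1⟩ := exists_eq_const hI hI'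
    (f := fun u => curvature1 γ u - 3 / 2 * curvature2 γ u ^ 2)
    fun u hu => ((d1 u hu).sub (((d2 u hu).pow 2).const_mul (3 / 2))).congr_deriv (by
      rw [(EL u hu).1]; push_cast; ring)
  obtain ⟨c₃, h3⟩ := exists_eq_const hI hI' (f := fun u => curvature2 γ u ^ 2 * curvature3 γ u)
    fun u hu => (((d2 u hu).pow 2).mul (d3 u hu)).congr_deriv (by
      simp only [Pi.pow_apply]
      push_cast
      linear_combination curvature2 γ u * (EL u hu).2.2)
  have hk3 : ∀ u ∈ I, curvature3 γ u = c₃ / curvature2 γ u ^ 2 := fun u hu => by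
    rw [← h3 u hu, mul_div_cancel_left₀ _ (pow_ne_zero 2 (F.pos_two u hu).ne')]
  have hk1 : ∀ u ∈ I, curvature1 γ u = 3 / 2 * curvature2 γ u ^ 2 + c₁ := fun u hu => by
    rw [← h1 u hu]; ring
  obtain ⟨c₂, h2⟩ := exists_eq_const hI hI'
    (f := fun u => deriv (curvature2 γ) u ^ 2 + curvature2 γ u ^ 4 +
      c₃ ^ 2 * (curvature2 γ u ^ 2)⁻¹ + 2 * c₁ * curvature2 γ u ^ 2)
    fun u hu => ((((d2' u hu).pow 2).add ((d2 u hu).pow 4)).add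
      ((((d2 u hu).pow 2).inv (pow_ne_zero 2 (F.pos_two u hu).ne')).const_mul (c₃ ^ 2))).add
        (((d2 u hu).pow 2).const_mul (2 * c₁)) |>.congr_deriv (by
      have hp := (F.pos_two u hu).ne'
      rw [(EL u hu).2.1, hk3 u hu, hk1 u hu]
      simp only [Pi.pow_apply]
      push_cast
      field_simp
      ring)
  -- The conserved energy is minus the character.
  refine ⟨c₁, -c₂, c₃, ?_, fun u hu => ⟨hk1 u hu, ?_, ?_⟩⟩
  · obtain ⟨u, hu⟩ := hne
    rw [← h3 u hu]
    exact (mul_pos (pow_pos (F.pos_two u hu) 2) (hhel u hu)).ne'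
  · rw [hk3 u hu, zpow_neg, div_eq_mul_inv]
    norm_cast
  · rw [← h2 u hu, zpow_neg]
    norm_cast
    ring

/-- The square of the second curvature solves the elliptic equation of the character cubic. -/
theorem curvature2_sq_ode (hI : IsOpen I) (hγ : IsConformalWorldLine I γ)
    (hpar : IsConformalParameter I γ) (hhel : ∀ u ∈ I, 0 < curvature3 γ u) {c₁ c₂ c₃ : ℝ}
    (hc : AreCharacters I γ c₁ c₂ c₃) {u : ℝ} (hu : u ∈ I) :
    HasDerivAt (fun u => curvature2 γ u ^ 2) (2 * curvature2 γ u * deriv (curvature2 γ) u) u ∧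
    HasDerivAt (fun u => 2 * curvature2 γ u * deriv (curvature2 γ) u)
      (-2 * (3 * (curvature2 γ u ^ 2) ^ 2 + 4 * c₁ * curvature2 γ u ^ 2 + c₂)) u ∧
    (2 * curvature2 γ u * deriv (curvature2 γ) u) ^ 2 =
      -4 * ((curvature2 γ u ^ 2) ^ 3 + 2 * c₁ * (curvature2 γ u ^ 2) ^ 2 +
        c₂ * curvature2 γ u ^ 2 + c₃ ^ 2) := by
  have F := isConformalFrame hI hγ.timelike hpar hhel
  have EL := curvature_eulerLagrange hI hγ hpar hhel hu
  have d2 := hasDerivAt_of_contDiffOn hI F.smooth_two hu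
  have d2' : HasDerivAt (deriv (curvature2 γ)) (iteratedDeriv 2 (curvature2 γ) u) u := by
    simpa using hasDerivAt_iteratedDeriv hI F.smooth_two 1 hu
  obtain ⟨hk1, hk3, hE⟩ := hc.2 u hu
  have hp := (F.pos_two u hu).ne'
  have hz : curvature2 γ u ^ (-2 : ℤ) = (curvature2 γ u ^ 2)⁻¹ := by rw [zpow_neg]; norm_cast
  rw [hz] at hk3 hE
  refine ⟨(d2.pow 2).congr_deriv (by push_cast; ring), ?_, ?_⟩
  · refine ((d2.const_mul 2).mul d2').congr_deriv ?_
    rw [EL.2.1, hk3, hk1]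
    have hk : curvature2 γ u * (c₃ * (curvature2 γ u ^ 2)⁻¹) ^ 2 * curvature2 γ u =
        c₃ ^ 2 * (curvature2 γ u ^ 2)⁻¹ := by field_simp
    -- The energy law eliminates k₂'² from (k₂²)'' = 2k₂'² + 2k₂k₂''.
    linear_combination 2 * hE + 2 * hk
  · have hk : curvature2 γ u ^ 2 * (curvature2 γ u ^ 2)⁻¹ = 1 :=
      mul_inv_cancel₀ (pow_ne_zero 2 hp)
    linear_combination 4 * curvature2 γ u ^ 2 * hE - 4 * c₃ ^ 2 * hk

/-- Since the curvatures are not all constant, the cubic is negative somewhere. -/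
theorem exists_characterCubic_neg (hI : IsOpen I) (hI' : I.OrdConnected)
    (hγ : IsConformalWorldLine I γ) (hpar : IsConformalParameter I γ)
    (hhel : ∀ u ∈ I, 0 < curvature3 γ u) (hnc : ¬ HasConstantCurvatures I γ) {c₁ c₂ c₃ : ℝ}
    (hc : AreCharacters I γ c₁ c₂ c₃) :
    ∃ x : ℝ, 0 < x ∧ x ^ 3 + 2 * c₁ * x ^ 2 + c₂ * x + c₃ ^ 2 < 0 := by
  have F := isConformalFrame hI hγ.timelike hpar hhel
  by_contra hcon
  push Not at hcon
  apply hnc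
  -- If the cubic is nonnegative at every positive point, then (2k₂k₂')² = -4Q₁(k₂²) ≤ 0, so k₂' =
  -- 0.
  have hzero : ∀ u ∈ I, HasDerivAt (curvature2 γ) 0 u := by
    intro u hu
    have hp := F.pos_two u hu
    refine (hasDerivAt_of_contDiffOn hI F.smooth_two hu).congr_deriv ?_
    have h1 := (curvature2_sq_ode hI hγ hpar hhel hc hu).2.2
    have h2 := hcon (curvature2 γ u ^ 2) (pow_pos hp 2)
    have h3 : (2 * curvature2 γ u * deriv (curvature2 γ) u) ^ 2 = 0 :=
      le_antisymm (by linarith) (sq_nonneg _)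
    rcases mul_eq_zero.1 (pow_eq_zero_iff two_ne_zero |>.1 h3) with h | h
    · exact absurd h (by positivity)
    · exact h
  obtain ⟨a, ha⟩ := exists_eq_const hI hI' hzero
  refine ⟨3 / 2 * a ^ 2 + c₁, a, c₃ * a ^ (-2 : ℤ), fun u hu => ?_⟩
  obtain ⟨hk1, hk3, -⟩ := hc.2 u hu
  rw [hk1, hk3, ha u hu]
  exact ⟨rfl, rfl, rfl⟩

end Characters

end ConformalStrain

/-! ### The phase parameters and the explicit curvatures -/

open ConformalStrain in
theorem proposition4p2 (I : Set ℝ) (hI : IsOpen I) (hI' : I.OrdConnected) (γ : ℝ → Vec)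
    (hγ : IsConformalWorldLine I γ) (hfull : IsLinearlyFull I γ)
    (hpar : IsConformalParameter I γ) (hor : IsIntrinsicallyOriented I γ)
    (hhel : ∀ u ∈ I, 0 < curvature3 γ u)
    (hnc : ¬ HasConstantCurvatures I γ) :
    (∃ e₁ e₂ e₃ : ℝ, ArePhaseParameters I γ e₁ e₂ e₃) ∧
    ∀ e₁ e₂ e₃ : ℝ, ArePhaseParameters I γ e₁ e₂ e₃ →
      e₁ < 0 ∧ 0 < e₂ ∧ e₂ < e₃ ∧
      ∀ ℓ₁ ℓ₂ ℓ₃ ℓ₄ m : ℝ, ℓ₃ = e₃ - e₁ → ℓ₄ = e₃ - e₂ → ℓ₁ = e₂ * ℓ₃ → ℓ₂ = e₁ * ℓ₄ →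
        m = ℓ₄ / ℓ₃ →
        ∃ u₀ : ℝ, ∀ u ∈ I,
          curvature2 γ u =
            √((ℓ₁ - ℓ₂ * jacobiSn (√ℓ₃ * u + u₀) m ^ 2) /
              (ℓ₃ - ℓ₄ * jacobiSn (√ℓ₃ * u + u₀) m ^ 2)) ∧
          curvature1 γ u = 3 / 2 * curvature2 γ u ^ 2 - 1 / 2 * (e₁ + e₂ + e₃) ∧
          curvature3 γ u = √(-(e₁ * e₂ * e₃)) * curvature2 γ u ^ (-2 : ℤ) := by
  -- On an empty interval the curvatures would be vacuously constant.
  have hne : I.Nonempty := by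
    by_contra h
    rw [Set.not_nonempty_iff_eq_empty] at h
    exact hnc ⟨0, 0, 0, by simp [h]⟩
  have F := isConformalFrame hI hγ.timelike hpar hhel
  constructor
  · obtain ⟨c₁, c₂, c₃, hc⟩ := exists_characters hI hI' hne hγ hpar hhel
    obtain ⟨x, hx, hneg⟩ := exists_characterCubic_neg hI hI' hγ hpar hhel hnc hc
    obtain ⟨e₁, e₂, e₃, h12, h23, hroots⟩ := exists_characterCubic_roots hc.1 hx hneg
    exact ⟨e₁, e₂, e₃, h12, h23, c₁, c₂, c₃, hc, hroots⟩
  · rintro e₁ e₂ e₃ ⟨h12, h23, c₁, c₂, c₃, hc, hroots⟩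
    have hQ := characterCubic_eq_of_roots hroots
    obtain ⟨x, hx, hneg⟩ := exists_characterCubic_neg hI hI' hγ hpar hhel hnc hc
    -- Comparing the two forms of the cubic at 0, 1, -1 yields Vieta's formulas.
    have v0 := hQ 0
    have v1 := hQ 1
    have v2 := hQ (-1)
    have hs : 2 * c₁ = -(e₁ + e₂ + e₃) := by linarith
    have hc2 : c₂ = e₁ * e₂ + e₁ * e₃ + e₂ * e₃ := by linarith
    have hc3 : c₃ ^ 2 = -(e₁ * e₂ * e₃) := by linarith
    have hc3pos : 0 < c₃ ^ 2 := pow_two_pos_of_ne_zero hc.1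
    -- If e₁ ≥ 0, the product of the roots would be nonnegative, but it equals -c₃² < 0.
    have he1 : e₁ < 0 := by
      by_contra h
      push Not at h
      have := mul_nonneg (mul_nonneg h (h.trans h12.le)) (h.trans (h12.trans h23).le)
      linarith
    -- If e₂ < 0, the product -c₃² < 0 forces e₃ < 0 too, and the cubic would be positive at x > 0.
    -- If e₂ = 0, then c₃ = 0.
    have he2 : 0 < e₂ := by
      rw [hQ] at hneg
      by_contra h
      push Not at h
      rcases h.lt_or_eq with h | h
      · have h3 : e₃ < 0 := by nlinarith [mul_pos_of_neg_of_neg he1 h]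
        have := mul_pos (mul_pos (by linarith : 0 < x - e₁) (by linarith : 0 < x - e₂))
          (by linarith : 0 < x - e₃)
        linarith
      · rw [h] at hc3
        linarith
    refine ⟨he1, he2, h23, ?_⟩
    rintro _ _ _ _ _ rfl rfl rfl rfl rfl
    have hode := fun u hu => curvature2_sq_ode (u := u) hI hγ hpar hhel hc hu
    obtain ⟨u₀, hu₀⟩ := exists_jacobiSn_of_cubic_ode hI hI' hne h12 h23
      (fun u hu => (hode u hu).1)
      (fun u hu => (hode u hu).2.1.congr_deriv (by
        rw [hc2]; linear_combination (-4 * curvature2 γ u ^ 2) * hs))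
      (fun u hu => (hode u hu).2.2.trans (by rw [hQ]))
      (fun u hu => he1.trans (pow_pos (F.pos_two u hu) 2))
    refine ⟨u₀, fun u hu => ⟨?_, ?_, ?_⟩⟩
    · rw [← hu₀ u hu, Real.sqrt_sq (F.pos_two u hu).le]
    · rw [(hc.2 u hu).1]
      linarith
    -- The cubic determines only c₃²; positive helicity selects the positive root.
    · have hc3p : 0 < c₃ := by
        have h := (hc.2 u hu).2.1 ▸ hhel u hu
        exact pos_of_mul_pos_left h (zpow_nonneg (F.pos_two u hu).le _)
      rw [← hc3, Real.sqrt_sq hc3p.le]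
      exact (hc.2 u hu).2.1
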